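/- Let $\phi:\mathbb R\to\mathbb C$ be an even Schwartz function whose Fourier transform $\widehat\phi(\xi)=\int_{\mathbb R}\phi(x)e^{-2\pi i x\xi}\,dx$ vanishes for $|\xi|\ge\sigma$, where $\sigma<2$. For complex $z$ write $\phi(z)=\int_{\mathbb R}\widehat\phi(\xi)e^{2\pi i z\xi}\,d\xi$, the entire extension of $\phi$. For a prime $m$ and a non-principal Dirichlet character $\chi$ modulo $m$, define the 1-level density of $L(s,\chi)$ by $$D(\chi;\phi)=\sum_{\rho}\phi\Big(\gamma_{\chi,\rho}\,\frac{\log(m/\pi)}{2\pi}\Big),$$ where $\rho=\tfrac12+i\gamma_{\chi,\rho}$ runs over the non-trivial zeros of $L(s,\chi)$ (those with $0<\Re\rho<1$), counted with multiplicity; the generalized Riemann hypothesis is not assumed, so $\gamma_{\chi,\rho}$ may be complex. Let $\chi_0$ be the principal character modulo $m$; implied constants may depend on $\phi$ and $\sigma$. Then: 1. For every prime $m$ and every $\chi\ne\chi_0$ modulo $m$, the sum defining $D(\chi;\phi)$ converges absolutely. 2. As $m\to\infty$ through the primes, $$\frac1{m-2}\sum_{\chi\ne\chi_0}D(\chi;\phi)=\int_{-\infty}^{\infty}\phi(y)\,dy-2S_1(m)-2S_2(m)+O\Big(\frac1{\log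 m}\Big),$$ where, with $p$ running over the primes, $$S_1(m)=\sum_p\frac{\log p}{p^{1/2}\log(m/\pi)}\,\widehat\phi\Big(\frac{\log p}{\log(m/\pi)}\Big)\frac1{m-2}\sum_{\chi\ne\chi_0}\chi(p),$$ $$S_2(m)=\sum_p\frac{\log p}{p\log(m/\pi)}\,\widehat\phi\Big(\frac{2\log p}{\log(m/\pi)}\Big)\frac1{m-2}\sum_{\chi\ne\chi_0}\chi^2(p).$$ 3. The prime-sum term satisfies $-2S_1(m)=O(m^{\sigma/2-1})$ as $m\to\infty$ through the primes. 4. Consequently, as $m\to\infty$ through the primes, $$\frac1{m-2}\sum_{\chi\ne\chi_0}D(\chi;\phi)\longrightarrow\int_{-\infty}^{\infty}\phi(y)\,dy.$$ 5. This agrees with the scaling limit of unitary matrices: if $U$ is a Haar-random $N\times N$ unitary matrix with eigenvalues $e^{i\theta_1},\dots,e^{i\theta_N}$, $\theta_j\in(-\pi,\pi]$, then $$\mathbb E\sum_{j=1}^N\phi\Big(\frac{N\theta_j}{2\pi}\Big)\longrightarrow\int_{-\infty}^{\infty}\phi(y)\,dy\qquad(N\to\infty).$$ -/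

import Mathlib

open Filter Topology MeasureTheory Asymptotics
open scoped SchwartzMap FourierTransform

/-- A prime number is nonzero, so that Dirichlet `L`-functions modulo a prime are available. -/
instance instNeZeroPrimes (m : Nat.Primes) : NeZero (m : ℕ) := ⟨m.2.ne_zero⟩

namespace OneLevel

noncomputable section

/-- The filter of prime moduli `m → ∞`. -/
def primesAtTop : Filter Nat.Primes := comap (fun m : Nat.Primes => (m : ℕ)) atTop

/-- For `φ` Schwartz with compactly supported Fourier transform, this is the entire extension of
`φ` to complex arguments, `z ↦ ∫ φ̂(ξ) e^{2πizξ} dξ`. -/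
def entireExt (φ : 𝓢(ℝ, ℂ)) (z : ℂ) : ℂ :=
  ∫ ξ : ℝ, (𝓕 φ) ξ * Complex.exp (2 * Real.pi * Complex.I * z * ξ)

/-- On the real axis the extension is `φ` itself (Fourier inversion). -/
theorem entireExt_ofReal (φ : 𝓢(ℝ, ℂ)) (x : ℝ) : entireExt φ (x : ℂ) = φ x := by
  have h : 𝓕⁻ (𝓕 (φ : ℝ → ℂ)) = φ := by
    refine φ.continuous.fourierInv_fourier_eq φ.integrable ?_
    rw [← SchwartzMap.fourier_coe]
    exact (𝓕 φ).integrable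
  have h2 := congrFun h x
  rw [Real.fourierInv_eq', ← SchwartzMap.fourier_coe] at h2
  rw [← h2, entireExt]
  congr 1
  funext ξ
  rw [smul_eq_mul, mul_comm]
  congr 2
  simp
  ring

/-- The non-trivial zeros of `L(s, χ)`: those in the critical strip (as a set). -/
def nontrivialZeros {m : ℕ} [NeZero m] (χ : DirichletCharacter ℂ m) : Set ℂ :=
  {ρ | 0 < ρ.re ∧ ρ.re < 1 ∧ χ.LFunction ρ = 0}

/-- The ordinate `γ` of a zero `ρ = 1/2 + iγ`; it is real exactly when `ρ` is on the critical
line. -/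
def ordinate (ρ : ℂ) : ℂ := (ρ - 1 / 2) / Complex.I

/-- The contribution `φ(γ log(m/π) / (2π))` of the zero `ρ = 1/2 + iγ`, counted with the
multiplicity of `ρ` as a zero of `L(s, χ)`. -/
def zeroTerm {m : ℕ} [NeZero m] (χ : DirichletCharacter ℂ m) (φ : 𝓢(ℝ, ℂ)) (ρ : ℂ) : ℂ :=
  (analyticOrderNatAt χ.LFunction ρ : ℂ) *
    entireExt φ (ordinate ρ * ((Real.log (m / Real.pi) / (2 * Real.pi) : ℝ) : ℂ))

/-- The 1-level density `D(χ; φ) = ∑_ρ φ(γ log(m/π) / (2π))` of `L(s, χ)`. -/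
def oneLevelDensity {m : ℕ} [NeZero m] (χ : DirichletCharacter ℂ m) (φ : 𝓢(ℝ, ℂ)) : ℂ :=
  ∑' ρ : nontrivialZeros χ, zeroTerm χ φ ρ

open Classical in
/-- The average `(m - 2)⁻¹ ∑_{χ ≠ χ₀} F(χ)` over the non-principal characters mod `m`
(there are `m - 2` of them for `m` prime). -/
def familyAverage (m : ℕ) [NeZero m] (F : DirichletCharacter ℂ m → ℂ) : ℂ :=
  ((m : ℂ) - 2)⁻¹ * ∑ χ : DirichletCharacter ℂ m with χ ≠ 1, F χ

/-- The averaged sum over primes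
`∑_p (log p / (p^{1/2} log(m/π))) φ̂(log p / log(m/π)) · (m-2)⁻¹ ∑_{χ ≠ χ₀} χ(p)`. -/
def primeSum (m : ℕ) [NeZero m] (φ : 𝓢(ℝ, ℂ)) : ℂ :=
  ∑' p : Nat.Primes,
    ((Real.log p / (Real.sqrt p * Real.log (m / Real.pi)) : ℝ) : ℂ) *
      (𝓕 φ) (Real.log p / Real.log (m / Real.pi)) *
      familyAverage m (fun χ => χ ((p : ℕ) : ZMod m))

/-- The averaged sum over squares of primes
`∑_p (log p / (p log(m/π))) φ̂(2 log p / log(m/π)) · (m-2)⁻¹ ∑_{χ ≠ χ₀} χ²(p)`. -/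
def primeSquareSum (m : ℕ) [NeZero m] (φ : 𝓢(ℝ, ℂ)) : ℂ :=
  ∑' p : Nat.Primes,
    ((Real.log p / (p * Real.log (m / Real.pi)) : ℝ) : ℂ) *
      (𝓕 φ) (2 * Real.log p / Real.log (m / Real.pi)) *
      familyAverage m (fun χ => (χ ^ 2) ((p : ℕ) : ZMod m))

/-! The unitary group `U(N)` with its Haar probability measure. -/

instance unitaryMeasurableSpace (N : ℕ) : MeasurableSpace (Matrix.unitaryGroup (Fin N) ℂ) :=
  borel _

instance unitaryBorelSpace (N : ℕ) : BorelSpace (Matrix.unitaryGroup (Fin N) ℂ) := ⟨rfl⟩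

theorem isCompact_unitaryGroup (N : ℕ) :
    IsCompact {U : Matrix (Fin N) (Fin N) ℂ | U ∈ Matrix.unitaryGroup (Fin N) ℂ} := by
  have hc : IsCompact (Set.univ.pi fun _ : Fin N => Set.univ.pi fun _ : Fin N =>
      Metric.closedBall (0 : ℂ) 1) :=
    isCompact_univ_pi fun _ => isCompact_univ_pi fun _ => isCompact_closedBall _ _
  refine IsCompact.of_isClosed_subset hc
    (isClosed_unitary (R := Matrix (Fin N) (Fin N) ℂ)) ?_
  intro U hU i _ j _
  simpa using entry_norm_bound_of_unitary hU i j

instance unitaryCompactSpace (N : ℕ) : CompactSpace (Matrix.unitaryGroup (Fin N) ℂ) :=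
  isCompact_iff_compactSpace.mp (isCompact_unitaryGroup N)

/-- Haar measure on `U(N)`, normalized to total mass one. -/
def unitaryHaar (N : ℕ) : Measure (Matrix.unitaryGroup (Fin N) ℂ) := Measure.haarMeasure ⊤

/-- The expectation over Haar-random `U ∈ U(N)` of `∑_j φ(N θ_j / (2π))`, where the eigenvalues of
`U`, with multiplicity, are `e^{iθ_j}` with `θ_j ∈ (-π, π]`. -/
def unitaryOneLevelDensity (N : ℕ) (φ : 𝓢(ℝ, ℂ)) : ℂ :=
  ∫ U : Matrix.unitaryGroup (Fin N) ℂ,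
    ((U : Matrix (Fin N) (Fin N) ℂ).charpoly.roots.map
      fun z => φ (N * Complex.arg z / (2 * Real.pi))).sum ∂(unitaryHaar N)

end

end OneLevel

/-! For prime `m` every non-principal `χ` is primitive, so its completed L-function `Λ(s, χ)` is
entire and vanishes exactly at the non-trivial zeros. Put `L = log (m/π)` and `H(s) = φ(γL/2π)` for
`s = 1/2 + iγ`. Compact support of `φ̂` makes `H` entire with decay `|Im s|⁻⁴` in vertical strips,
so off-line zeros cause no difficulty.

Integrating `Λ'/Λ · H` around growing rectangles gives the sum over zeros as a difference of
integrals over `Re s = 2` and `Re s = -1`. Landau's lemma (`sum_order_le_and_norm_logDeriv_sub_le`)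
bounds the zeros in unit windows and supplies heights at which the horizontal sides are negligible.
The functional equation folds the left line onto the right one (`two_pi_mul_oneLevelDensity`). On
`Re s = 2` the integrand splits into `log m` with the gamma factors, and a Dirichlet series over
prime powers. Neither the gamma factors nor a single `n⁻ˢ` has a pole in `Re s > 0`, so each piece
moves to `Re s = 1/2` without meeting a zero of `L(s, χ)`. The first piece gives `∫ φ + O(1/L)` and
the term at `n` gives `φ̂(log n / L)/√n`; the error is uniform in `χ`
(`exists_norm_explicitFormula_le`).

Averaging uses orthogonality: the mean of `χ(a)` is at most `1` in modulus, and at most `1/(m-2)`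
unless `a = 1`. Cubes and higher powers of primes contribute `O(1/L)`. In `S₁` the primes reach
about `m^σ`; those not congruent to `1` give `m^(σ/2)/m`, and those congruent to `1` are majorized
by all integers `jm + 1`, giving the same size (`norm_primeSum_le`). In `S₂` the support forces `p <
m/π`, where `p² = 1` mod `m` is impossible, so `S₂ = O(m^(-1/2))`.

For the unitary group, the mean of `∑ F(θ_j/2π)` is exactly `N ∫ F` for continuous `F` on the circle
(`integral_eigenSum`): invariance under scalar matrices kills the nonzero Fourier modes, and density
does the rest. With `F(x) = φ(Nx)` this is `∫ φ` over `[-N/2, N/2]`. -/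

namespace OneLevel

/-! ### Dividing out zeros of entire functions -/

/-- An entire function that is not identically zero has finite order everywhere. -/
theorem analyticOrderAt_ne_top_of_entire {f : ℂ → ℂ} (hf : Differentiable ℂ f)
    (hne : ∃ z, f z ≠ 0) (ρ : ℂ) : analyticOrderAt f ρ ≠ ⊤ := by
  intro h
  rw [analyticOrderAt_eq_top] at h
  obtain ⟨z, hz⟩ := hne
  have hA : AnalyticOnNhd ℂ f Set.univ := fun z _ => hf.analyticAt z
  exact hz (congrFun (hA.eq_of_eventuallyEq (g := 0) (fun z _ => analyticAt_const) h) z)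

/-- The quotient has a removable singularity at `ρ`: the local analytic factor `g₀` supplies the
missing value and differentiability there. -/
theorem exists_entire_factor_single {f : ℂ → ℂ} (hf : Differentiable ℂ f)
    (hne : ∃ z, f z ≠ 0) (ρ : ℂ) : ∃ g : ℂ → ℂ, Differentiable ℂ g ∧
      (∀ z, f z = (z - ρ) ^ analyticOrderNatAt f ρ * g z) ∧ g ρ ≠ 0 := by
  classical
  have hA := hf.analyticAt ρ
  obtain ⟨g₀, hg₀, hg₀ne, hev⟩ :=
    hA.analyticOrderAt_ne_top.mp (analyticOrderAt_ne_top_of_entire hf hne ρ)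
  set n := analyticOrderNatAt f ρ
  set g : ℂ → ℂ := Function.update (fun z => f z / (z - ρ) ^ n) ρ (g₀ ρ) with hg
  have hgne : ∀ z, z ≠ ρ → g z = f z / (z - ρ) ^ n := fun z hz => by simp [hg, hz]
  have hgρ : g ρ = g₀ ρ := by simp [hg]
  refine ⟨g, fun z => ?_, fun z => ?_, by rwa [hgρ]⟩
  · rcases eq_or_ne z ρ with rfl | hz
    · refine hg₀.differentiableAt.congr_of_eventuallyEq ?_
      filter_upwards [hev] with w hw
      rcases eq_or_ne w z with rfl | hwz
      · exact hgρ
      · rw [hgne w hwz, hw, smul_eq_mul, mul_div_cancel_left₀]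
        exact pow_ne_zero _ (sub_ne_zero.mpr hwz)
    · have : g =ᶠ[𝓝 z] fun w => f w / (w - ρ) ^ n := by
        filter_upwards [isOpen_ne.mem_nhds hz] with w hw using hgne w hw
      refine DifferentiableAt.congr_of_eventuallyEq ?_ this
      exact (hf z).div (by fun_prop) (pow_ne_zero _ (sub_ne_zero.mpr hz))
  · rcases eq_or_ne z ρ with rfl | hz
    · rw [hgρ]
      exact hev.self_of_nhds
    · rw [hgne z hz, mul_div_cancel₀]
      exact pow_ne_zero _ (sub_ne_zero.mpr hz)

/-- Dividing out finitely many zeros of an entire function, with multiplicity. -/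
theorem exists_entire_factor {f : ℂ → ℂ} (hf : Differentiable ℂ f) (hne : ∃ z, f z ≠ 0)
    (Z : Finset ℂ) : ∃ g : ℂ → ℂ, Differentiable ℂ g ∧
      (∀ z, f z = (∏ ρ ∈ Z, (z - ρ) ^ analyticOrderNatAt f ρ) * g z) ∧ ∀ ρ ∈ Z, g ρ ≠ 0 := by
  classical
  induction Z using Finset.induction_on with
  | empty => exact ⟨f, hf, by simp, by simp⟩
  | insert a Z ha ih =>
    obtain ⟨g, hg, hfg, hgZ⟩ := ih
    have hgne : ∃ z, g z ≠ 0 := by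
      obtain ⟨z, hz⟩ := hne
      exact ⟨z, fun h => hz (by rw [hfg, h, mul_zero])⟩
    -- The factors already removed do not vanish at `a`, so they leave the order at `a` unchanged.
    have hord : analyticOrderNatAt f a = analyticOrderNatAt g a := by
      have hP : AnalyticAt ℂ (fun z => ∏ ρ ∈ Z, (z - ρ) ^ analyticOrderNatAt f ρ) a :=
        Differentiable.analyticAt (by fun_prop) a
      have hPa : (∏ ρ ∈ Z, (a - ρ) ^ analyticOrderNatAt f ρ) ≠ 0 := by
        refine Finset.prod_ne_zero_iff.mpr fun ρ hρ => pow_ne_zero _ (sub_ne_zero.mpr ?_)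
        rintro rfl
        exact ha hρ
      have h := analyticOrderAt_mul hP (hg.analyticAt a)
      rw [(hP.analyticOrderAt_eq_zero).mpr hPa, zero_add] at h
      have hf' : f = (fun z => ∏ ρ ∈ Z, (z - ρ) ^ analyticOrderNatAt f ρ) * g := funext hfg
      rw [← hf'] at h
      rw [analyticOrderNatAt, h, analyticOrderNatAt]
    obtain ⟨g', hg', hgg', hg'a⟩ := exists_entire_factor_single hg hgne a
    refine ⟨g', hg', fun z => ?_, fun ρ hρ => ?_⟩
    · rw [Finset.prod_insert ha, hord, hfg z, hgg' z]
      ring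
    · rcases Finset.mem_insert.mp hρ with rfl | hρ
      · exact hg'a
      · intro h
        exact hgZ ρ hρ (by rw [hgg', h, mul_zero])

theorem finite_zeros_of_isCompact {f : ℂ → ℂ} (hf : Differentiable ℂ f) (hne : ∃ z, f z ≠ 0)
    {K : Set ℂ} (hK : IsCompact K) : {z ∈ K | f z = 0}.Finite := by
  obtain ⟨z, hz⟩ := hne
  have hA : AnalyticOnNhd ℂ f Set.univ := fun z _ => hf.analyticAt z
  have h := hA.preimage_zero_mem_codiscrete (x := z) hz
  have := hK.finite_sdiff_of_mem_codiscreteWithin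
    (Filter.codiscreteWithin_mono (Set.subset_univ K) h)
  refine this.subset fun w hw => ⟨hw.1, fun h => h hw.2⟩

/-- The logarithmic derivative of a product with finitely many linear factors. -/
theorem logDeriv_eq_sum_add {f g : ℂ → ℂ} {Z : Finset ℂ} {n : ℂ → ℕ} (hg : Differentiable ℂ g)
    (hfg : ∀ z, f z = (∏ ρ ∈ Z, (z - ρ) ^ n ρ) * g z) {z : ℂ} (hz : f z ≠ 0) (hzZ : z ∉ Z) :
    logDeriv f z = ∑ ρ ∈ Z, (n ρ : ℂ) / (z - ρ) + logDeriv g z := by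
  have hgz : g z ≠ 0 := fun h => hz (by rw [hfg, h, mul_zero])
  have hne : ∀ ρ ∈ Z, (z - ρ) ^ n ρ ≠ 0 := fun ρ hρ => by
    refine pow_ne_zero _ (sub_ne_zero.mpr ?_)
    rintro rfl
    exact hzZ hρ
  rw [show f = fun z => (∏ ρ ∈ Z, (z - ρ) ^ n ρ) * g z from funext hfg,
    logDeriv_mul z (Finset.prod_ne_zero_iff.mpr hne) hgz (by fun_prop) (hg z),
    logDeriv_prod hne fun ρ _ => by fun_prop]
  congr 1
  refine Finset.sum_congr rfl fun ρ _ => ?_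
  rw [logDeriv_fun_pow (by fun_prop), logDeriv_apply]
  simp [div_eq_mul_inv]

end OneLevel

/-! ### Logarithmic derivatives and Landau's lemma -/

namespace OneLevel

open Metric in
/-- A holomorphic function without zeros on a disc, whose modulus is at most `e ^ B` times its
value at the centre, has logarithmic derivative `O(B)`. -/
theorem norm_logDeriv_le_of_ne_zero {g : ℂ → ℂ} (hg : Differentiable ℂ g) {c : ℂ} {R B : ℝ}
    (hR : 0 < R) (hB : 0 < B) (hne : ∀ z ∈ ball c R, g z ≠ 0)
    (hle : ∀ z ∈ ball c R, ‖g z‖ ≤ ‖g c‖ * Real.exp B) {z : ℂ} (hz : z ∈ closedBall c (R / 2)) :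
    ‖logDeriv g z‖ ≤ 24 * B / R := by
  have hcmem : c ∈ ball c R := mem_ball_self hR
  have hld : DifferentiableOn ℂ (logDeriv g) (ball c R) := fun w hw =>
    ((hg.deriv w).div (hg w) (hne w hw)).differentiableWithinAt
  -- `h` is a holomorphic logarithm of `g / g c`: a primitive of `g'/g` on the disc with `h c = 0`.
  obtain ⟨h, hhc, hh⟩ := (hld.isExactOn_ball).with_val_at c 0
  have hconst : ∀ w ∈ ball c R, g w * Complex.exp (-h w) = g c := by
    have hd : ∀ w ∈ ball c R, HasDerivAt (fun w => g w * Complex.exp (-h w)) 0 w := by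
      intro w hw
      have h1 := (hg w).hasDerivAt.mul ((hh w hw).neg.cexp)
      refine h1.congr_deriv ?_
      rw [logDeriv_apply]
      field_simp [hne w hw]
      simp
    intro w hw
    have := (convex_ball c R).is_const_of_fderivWithin_eq_zero (𝕜 := ℂ)
      (f := fun w => g w * Complex.exp (-h w))
      (fun x hx => (hd x hx).differentiableAt.differentiableWithinAt) (fun x hx => by
        rw [fderivWithin_of_isOpen isOpen_ball hx, (hd x hx).hasFDerivAt.fderiv]
        ext; simp) hw hcmem
    simpa [hhc] using this
  have hre : ∀ w ∈ ball c R, (h w).re ≤ B := by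
    intro w hw
    have h1 := hconst w hw
    have h2 : ‖g w‖ = ‖g c‖ * Real.exp (h w).re := by
      rw [← h1, norm_mul, Complex.norm_exp, mul_assoc, ← Real.exp_add]
      simp
    have h3 := hle w hw
    rw [h2] at h3
    exact Real.exp_le_exp.mp (le_of_mul_le_mul_left h3 (norm_pos_iff.mpr (hne c hcmem)))
  -- Borel–Carathéodory at radius `3R/4` turns the bound on `Re h` into `2B · (3R/4)/(R/4) = 6B`.
  have hbound : ∀ w ∈ closedBall c (3 * R / 4), ‖h w‖ ≤ 6 * B := by
    intro w hw
    have hw' : ‖w - c‖ ≤ 3 * R / 4 := by simpa [dist_eq_norm] using hw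
    have := Complex.borelCaratheodory_zero (f := fun u => h (c + u)) (z := w - c) hB
      (R := R) (fun u hu => by
        have hmem : c + u ∈ ball c R := by simpa using hu
        exact ((hh _ hmem).differentiableAt.comp u (by fun_prop)).differentiableWithinAt)
      (fun u hu => hre _ (by simpa using hu)) hR
      (by simp only [mem_ball, dist_zero_right]; linarith) (by simpa using hhc)
    simp only [add_sub_cancel] at this
    refine this.trans ?_
    rw [div_le_iff₀ (by linarith)]
    nlinarith
  have hz' : dist z c ≤ R / 2 := hz
  have hsub : ∀ w, dist w z ≤ R / 4 → w ∈ ball c R := fun w hw => by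
    have := dist_triangle w z c
    simp only [mem_ball]; linarith
  have hder : deriv h z = logDeriv g z := (hh z (hsub z (by simp only [dist_self]; positivity))).deriv
  rw [← hder]
  -- Cauchy's estimate on a circle of radius `R/4` gives `6B/(R/4) = 24B/R`.
  have := Complex.norm_deriv_le_of_forall_mem_sphere_norm_le (f := h) (c := z) (R := R / 4)
    (C := 6 * B) (by positivity) (DifferentiableOn.diffContOnCl fun w hw => by
      rw [closure_ball _ (by positivity)] at hw
      exact (hh w (hsub w hw)).differentiableAt.differentiableWithinAt) (fun w hw => by
      refine hbound w ?_
      have h1 : dist w z = R / 4 := hw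
      have := dist_triangle w z c
      simp only [mem_closedBall]; linarith)
  refine this.trans (le_of_eq ?_)
  field_simp
  norm_num

open Metric in
/-- **Landau's lemma**: the number of zeros of an entire function in a disc, and its logarithmic
derivative up to the contribution of these zeros, in terms of its growth. -/
theorem sum_order_le_and_norm_logDeriv_sub_le {f : ℂ → ℂ} (hf : Differentiable ℂ f) {c : ℂ}
    {r B : ℝ} (hr : 0 < r) (hB : 0 < B) (hc : f c ≠ 0)
    (hle : ∀ z ∈ closedBall c r, ‖f z‖ ≤ ‖f c‖ * Real.exp B) {Z : Finset ℂ}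
    (hZ : ∀ z, z ∈ Z ↔ f z = 0 ∧ z ∈ closedBall c (r / 4)) :
    ∑ ρ ∈ Z, (analyticOrderNatAt f ρ : ℝ) ≤ B ∧ ∀ z ∈ closedBall c (r / 8), f z ≠ 0 →
      ‖logDeriv f z - ∑ ρ ∈ Z, (analyticOrderNatAt f ρ : ℂ) / (z - ρ)‖ ≤ 96 * B / r := by
  obtain ⟨g, hg, hfg, hgZ⟩ := exists_entire_factor hf ⟨c, hc⟩ Z
  set n := analyticOrderNatAt f
  have hgc : 0 < ‖g c‖ := norm_pos_iff.mpr fun h => hc (by rw [hfg, h, mul_zero])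
  -- A zero within `r/4` of `c` is at least three times farther from any point of the sphere than
  -- from `c`, so each removed factor gains `3`.
  have hsphere : ∀ z ∈ sphere c r, ‖g z‖ ≤ ‖g c‖ * Real.exp B / 3 ^ (∑ ρ ∈ Z, n ρ) := by
    intro z hz
    have hz' : dist z c = r := hz
    have hfar : ∀ ρ ∈ Z, 3 * ‖c - ρ‖ ≤ ‖z - ρ‖ ∧ 0 < ‖z - ρ‖ := by
      intro ρ hρ
      have h1 : dist ρ c ≤ r / 4 := ((hZ ρ).mp hρ).2
      have h2 := dist_triangle z ρ c
      rw [← dist_eq_norm, ← dist_eq_norm, dist_comm c ρ]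
      constructor <;> linarith
    have hprod : 3 ^ (∑ ρ ∈ Z, n ρ) * ∏ ρ ∈ Z, ‖c - ρ‖ ^ n ρ ≤ ∏ ρ ∈ Z, ‖z - ρ‖ ^ n ρ := by
      rw [← Finset.prod_pow_eq_pow_sum, ← Finset.prod_mul_distrib]
      refine Finset.prod_le_prod (fun ρ _ => by positivity) fun ρ hρ => ?_
      rw [← mul_pow]
      exact pow_le_pow_left₀ (by positivity) (hfar ρ hρ).1 _
    have hpos : 0 < ∏ ρ ∈ Z, ‖z - ρ‖ ^ n ρ :=
      Finset.prod_pos fun ρ hρ => pow_pos (hfar ρ hρ).2 _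
    have h1 := hle z (sphere_subset_closedBall hz)
    rw [hfg z, hfg c, norm_mul, norm_mul, norm_prod, norm_prod] at h1
    simp only [norm_pow] at h1
    rw [le_div_iff₀ (by positivity)]
    refine le_of_mul_le_mul_left ?_ hpos
    calc (∏ ρ ∈ Z, ‖z - ρ‖ ^ n ρ) * (‖g z‖ * 3 ^ (∑ ρ ∈ Z, n ρ))
        = ((∏ ρ ∈ Z, ‖z - ρ‖ ^ n ρ) * ‖g z‖) * 3 ^ (∑ ρ ∈ Z, n ρ) := by ring
      _ ≤ ((∏ ρ ∈ Z, ‖c - ρ‖ ^ n ρ) * ‖g c‖ * Real.exp B) * 3 ^ (∑ ρ ∈ Z, n ρ) := by gcongr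
      _ = (3 ^ (∑ ρ ∈ Z, n ρ) * ∏ ρ ∈ Z, ‖c - ρ‖ ^ n ρ) * (‖g c‖ * Real.exp B) := by ring
      _ ≤ _ := by gcongr
  -- Maximum principle. At the centre it yields `3 ^ (number of zeros) ≤ exp B`, and `log 3 ≥ 1`
  -- turns this into the count.
  have hball : ∀ z ∈ closedBall c r, ‖g z‖ ≤ ‖g c‖ * Real.exp B / 3 ^ (∑ ρ ∈ Z, n ρ) := by
    intro z hz
    refine Complex.norm_le_of_forall_mem_frontier_norm_le (isBounded_ball (x := c) (r := r))
      hg.diffContOnCl (fun w hw => ?_) (by rwa [closure_ball _ hr.ne'])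
    rw [frontier_ball _ hr.ne'] at hw
    exact hsphere w hw
  constructor
  · have h1 := hball c (mem_closedBall_self hr.le)
    rw [le_div_iff₀ (by positivity)] at h1
    have h2 : (3 : ℝ) ^ (∑ ρ ∈ Z, n ρ) ≤ Real.exp B := le_of_mul_le_mul_left h1 hgc
    have h3 := Real.log_le_log (by positivity) h2
    rw [Real.log_pow, Real.log_exp] at h3
    have h4 : 1 ≤ Real.log 3 := by
      rw [Real.le_log_iff_exp_le (by norm_num)]
      exact (Real.exp_one_lt_d9.trans (by norm_num)).le
    push_cast at h3
    have h5 : (0 : ℝ) ≤ ∑ ρ ∈ Z, (n ρ : ℝ) := Finset.sum_nonneg fun _ _ => by positivity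
    nlinarith
  · intro z hz hfz
    have hzZ : z ∉ Z := fun h => hfz ((hZ z).mp h).1
    rw [logDeriv_eq_sum_add hg hfg hfz hzZ, add_sub_cancel_left]
    have hbig : ∀ w ∈ ball c (r / 4), w ∈ closedBall c r := fun w hw =>
      closedBall_subset_closedBall (by linarith) (ball_subset_closedBall hw)
    -- `g` has no zeros within `r/4` of `c`; with `R = r/4` the constant `24B/R` becomes `96B/r`.
    have := norm_logDeriv_le_of_ne_zero hg (R := r / 4) (by positivity) hB (fun w hw h => by
      refine hgZ w ((hZ w).mpr ⟨by rw [hfg, h, mul_zero], ball_subset_closedBall hw⟩) h)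
      (fun w hw => (hball w (hbig w hw)).trans (div_le_self (by positivity)
        (one_le_pow₀ (by norm_num)))) (z := z) (by convert hz using 2; ring)
    refine this.trans (le_of_eq ?_)
    field_simp
    norm_num

end OneLevel

/-! ### Rectangle integrals and the argument principle -/

namespace OneLevel

/-- The integral of `F` over the boundary of the rectangle `[x₁, x₂] × [a, b]`. -/
noncomputable def rectIntegral (F : ℂ → ℂ) (x₁ x₂ a b : ℝ) : ℂ :=
  (∫ x : ℝ in x₁..x₂, F (x + a * Complex.I)) - (∫ x : ℝ in x₁..x₂, F (x + b * Complex.I)) +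
    Complex.I * (∫ y : ℝ in a..b, F (x₂ + y * Complex.I)) -
    Complex.I * ∫ y : ℝ in a..b, F (x₁ + y * Complex.I)

theorem rectIntegral_eq_zero {F : ℂ → ℂ} {x₁ x₂ a b : ℝ}
    (hF : DifferentiableOn ℂ F (Set.uIcc x₁ x₂ ×ℂ Set.uIcc a b)) :
    rectIntegral F x₁ x₂ a b = 0 := by
  simpa [rectIntegral] using Complex.integral_boundary_rect_eq_zero_of_differentiableOn F
    (⟨x₁, a⟩ : ℂ) ⟨x₂, b⟩ hF

/-- Boundary points of a rectangle belong to the set on which a function is assumed regular. -/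
theorem rectIntegral_congr {F G : ℂ → ℂ} {x₁ x₂ a b : ℝ}
    (h : ∀ z ∈ Set.uIcc x₁ x₂ ×ℂ Set.uIcc a b,
      z.re = x₁ ∨ z.re = x₂ ∨ z.im = a ∨ z.im = b → F z = G z) :
    rectIntegral F x₁ x₂ a b = rectIntegral G x₁ x₂ a b := by
  unfold rectIntegral
  have e : ∀ c ∈ Set.uIcc a b, c = a ∨ c = b → (∫ x : ℝ in x₁..x₂, F (x + c * Complex.I)) =
      ∫ x : ℝ in x₁..x₂, G (x + c * Complex.I) := fun c hc hab =>
    intervalIntegral.integral_congr fun x hx => h _ (by simp [Complex.mem_reProdIm, hx, hc])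
      (by simp; tauto)
  have e' : ∀ c ∈ Set.uIcc x₁ x₂, c = x₁ ∨ c = x₂ → (∫ y : ℝ in a..b, F (c + y * Complex.I)) =
      ∫ y : ℝ in a..b, G (c + y * Complex.I) := fun c hc hab =>
    intervalIntegral.integral_congr fun x hx => h _ (by simp [Complex.mem_reProdIm, hx, hc])
      (by simp; tauto)
  rw [e a Set.left_mem_uIcc (.inl rfl), e b Set.right_mem_uIcc (.inr rfl),
    e' x₁ Set.left_mem_uIcc (.inl rfl), e' x₂ Set.right_mem_uIcc (.inr rfl)]

/-- Continuity of a function on the boundary of a rectangle. -/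
def ContinuousOnRectBoundary (F : ℂ → ℂ) (x₁ x₂ a b : ℝ) : Prop :=
  ∀ z ∈ Set.uIcc x₁ x₂ ×ℂ Set.uIcc a b,
    z.re = x₁ ∨ z.re = x₂ ∨ z.im = a ∨ z.im = b → ContinuousAt F z

theorem ContinuousOnRectBoundary.horizontal {F : ℂ → ℂ} {x₁ x₂ a b : ℝ}
    (h : ContinuousOnRectBoundary F x₁ x₂ a b) {c : ℝ} (hc : c = a ∨ c = b) :
    IntervalIntegrable (fun x : ℝ => F (x + c * Complex.I)) volume x₁ x₂ := by
  refine ContinuousOn.intervalIntegrable fun x hx => ContinuousAt.continuousWithinAt ?_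
  refine ContinuousAt.comp (f := fun x : ℝ => (x + c * Complex.I : ℂ)) (h _ ?_ ?_) (by fun_prop)
  · rcases hc with rfl | rfl <;> simp [Complex.mem_reProdIm, hx]
  · simp; tauto

theorem ContinuousOnRectBoundary.vertical {F : ℂ → ℂ} {x₁ x₂ a b : ℝ}
    (h : ContinuousOnRectBoundary F x₁ x₂ a b) {c : ℝ} (hc : c = x₁ ∨ c = x₂) :
    IntervalIntegrable (fun y : ℝ => F (c + y * Complex.I)) volume a b := by
  refine ContinuousOn.intervalIntegrable fun x hx => ContinuousAt.continuousWithinAt ?_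
  refine ContinuousAt.comp (f := fun y : ℝ => (c + y * Complex.I : ℂ)) (h _ ?_ ?_) (by fun_prop)
  · rcases hc with rfl | rfl <;> simp [Complex.mem_reProdIm, hx]
  · simp; tauto

theorem rectIntegral_add {F G : ℂ → ℂ} {x₁ x₂ a b : ℝ}
    (hF : ContinuousOnRectBoundary F x₁ x₂ a b) (hG : ContinuousOnRectBoundary G x₁ x₂ a b) :
    rectIntegral (fun z => F z + G z) x₁ x₂ a b =
      rectIntegral F x₁ x₂ a b + rectIntegral G x₁ x₂ a b := by
  unfold rectIntegral
  rw [intervalIntegral.integral_add (hF.horizontal (.inl rfl)) (hG.horizontal (.inl rfl)),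
    intervalIntegral.integral_add (hF.horizontal (.inr rfl)) (hG.horizontal (.inr rfl)),
    intervalIntegral.integral_add (hF.vertical (.inl rfl)) (hG.vertical (.inl rfl)),
    intervalIntegral.integral_add (hF.vertical (.inr rfl)) (hG.vertical (.inr rfl))]
  ring

theorem rectIntegral_const_mul (c : ℂ) (F : ℂ → ℂ) (x₁ x₂ a b : ℝ) :
    rectIntegral (fun z => c * F z) x₁ x₂ a b = c * rectIntegral F x₁ x₂ a b := by
  simp only [rectIntegral, intervalIntegral.integral_const_mul]
  ring

theorem rectIntegral_sum {ι : Type*} {s : Finset ι} {F : ι → ℂ → ℂ} {x₁ x₂ a b : ℝ}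
    (hF : ∀ i ∈ s, ContinuousOnRectBoundary (F i) x₁ x₂ a b) :
    rectIntegral (fun z => ∑ i ∈ s, F i z) x₁ x₂ a b =
      ∑ i ∈ s, rectIntegral (F i) x₁ x₂ a b := by
  classical
  induction s using Finset.induction_on with
  | empty => simp [rectIntegral]
  | insert j s hj ih =>
    simp only [Finset.sum_insert hj]
    rw [rectIntegral_add (hF j (Finset.mem_insert_self _ _)), ih fun i hi =>
      hF i (Finset.mem_insert_of_mem hi)]
    intro z hz hz'
    exact tendsto_finsetSum _ fun i hi => hF i (Finset.mem_insert_of_mem hi) z hz hz'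

/-- On the open first quadrant, rotation by `-i` does not cross the branch cut. Each corner of a
rectangle around `ρ` thus contributes a quarter of `2πi`. -/
theorem log_eq_log_neg_I_mul_add {w : ℂ} (hre : 0 < w.re) (him : 0 < w.im) :
    Complex.log w = Complex.log (-Complex.I * w) + Real.pi / 2 * Complex.I := by
  have hne : -Complex.I * w ≠ 0 := by
    intro h
    have := congrArg Complex.re h
    simp at this
    exact him.ne' this
  have h2 : |(-Complex.I * w).arg| < Real.pi / 2 :=
    Complex.abs_arg_lt_pi_div_two_iff.mpr (.inl (by simpa using him))
  have h3 : (-Complex.I * w).arg < 0 := Complex.arg_neg_iff.mpr (by simpa using hre)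
  have h4 := (abs_lt.mp h2).1
  have h5 := Complex.log_mul Complex.I_ne_zero hne (x := Complex.I) (y := -Complex.I * w)
    (by rw [Complex.arg_I]; constructor <;> linarith [Real.pi_pos])
  rw [show Complex.I * (-Complex.I * w) = w by
    rw [← mul_assoc, mul_neg, Complex.I_mul_I]; simp] at h5
  rw [h5, Complex.log_I]
  ring

/-- The factor `u` turns a side of the rectangle into the right half-plane, where the principal
logarithm is smooth; it cancels on differentiation. -/
theorem integral_inv_sub_of_log {ρ u : ℂ} (c d : ℂ) {p q : ℝ} (hu : u ≠ 0)
    (h : ∀ x ∈ Set.uIcc p q, 0 < (u * (c + x * d - ρ)).re) :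
    ∫ x : ℝ in p..q, d * (c + x * d - ρ)⁻¹ =
      Complex.log (u * (c + q * d - ρ)) - Complex.log (u * (c + p * d - ρ)) := by
  have hne : ∀ x ∈ Set.uIcc p q, c + x * d - ρ ≠ 0 := fun x hx h0 => by
    have := h x hx
    simp [h0] at this
  refine intervalIntegral.integral_eq_sub_of_hasDerivAt
    (f := fun x : ℝ => Complex.log (u * (c + x * d - ρ))) (fun x hx => ?_) ?_
  · have h1 : HasDerivAt (fun x : ℝ => u * (c + x * d - ρ)) (u * d) x := by
      have h0 : HasDerivAt (fun x : ℝ => (x : ℂ)) 1 x := Complex.ofRealCLM.hasDerivAt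
      simpa using (((h0.mul_const d).const_add c).sub_const ρ).const_mul u
    refine (h1.clog_real (.inl (h x hx))).congr_deriv ?_
    have := hne x hx
    field_simp
  · refine ContinuousOn.intervalIntegrable ?_
    exact continuousOn_const.mul (ContinuousOn.inv₀ (by fun_prop) hne)

/-- The integral of `1 / (z - ρ)` over the boundary of a rectangle around `ρ`. -/
theorem rectIntegral_inv_sub {ρ : ℂ} {x₁ x₂ a b : ℝ} (h₁ : x₁ < ρ.re) (h₂ : ρ.re < x₂)
    (ha : a < ρ.im) (hb : ρ.im < b) :
    rectIntegral (fun z => (z - ρ)⁻¹) x₁ x₂ a b = 2 * Real.pi * Complex.I := by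
  have hI : Complex.I ≠ 0 := Complex.I_ne_zero
  have bot := integral_inv_sub_of_log (ρ := ρ) (u := Complex.I) (a * Complex.I) 1 (p := x₁)
    (q := x₂) hI (fun x _ => by simpa using ha)
  have top := integral_inv_sub_of_log (ρ := ρ) (u := -Complex.I) (b * Complex.I) 1 (p := x₁)
    (q := x₂) (neg_ne_zero.mpr hI) (fun x _ => by simpa using hb)
  have right := integral_inv_sub_of_log (ρ := ρ) (u := 1) x₂ Complex.I (p := a)
    (q := b) one_ne_zero (fun x _ => by simpa using h₂)
  have left := integral_inv_sub_of_log (ρ := ρ) (u := -1) x₁ Complex.I (p := a)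
    (q := b) (by norm_num) (fun x _ => by simpa using h₁)
  rw [intervalIntegral.integral_const_mul] at right left
  simp only [mul_one, one_mul] at bot top right left
  -- The antiderivatives on adjacent sides use different rotations; `c1` to `c4` are their
  -- mismatches at the four corners, `iπ/2` each.
  have c1 := log_eq_log_neg_I_mul_add (w := x₂ + b * Complex.I - ρ) (by simpa using h₂)
    (by simpa using hb)
  have c2 := log_eq_log_neg_I_mul_add (w := -Complex.I * (x₁ + b * Complex.I - ρ))
    (by simpa using hb) (by simpa using h₁)
  have c3 := log_eq_log_neg_I_mul_add (w := -1 * (x₁ + a * Complex.I - ρ))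
    (by simpa using h₁) (by simpa using ha)
  have c4 := log_eq_log_neg_I_mul_add (w := Complex.I * (x₂ + a * Complex.I - ρ))
    (by simpa using ha) (by simpa using h₂)
  have e2 : -Complex.I * (-Complex.I * (x₁ + b * Complex.I - ρ)) =
      -1 * (x₁ + b * Complex.I - ρ) := by
    linear_combination (x₁ + b * Complex.I - ρ) * Complex.I_mul_I
  have e3 : -Complex.I * (-1 * (x₁ + a * Complex.I - ρ)) =
      Complex.I * (x₁ + a * Complex.I - ρ) := by ring
  have e4 : -Complex.I * (Complex.I * (x₂ + a * Complex.I - ρ)) = x₂ + a * Complex.I - ρ := by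
    linear_combination (-1 : ℂ) * (x₂ + a * Complex.I - ρ) * Complex.I_mul_I
  rw [e2] at c2
  rw [e3] at c3
  rw [e4] at c4
  have e : ∀ x c : ℂ, c * Complex.I + x = x + c * Complex.I := fun _ _ => add_comm _ _
  simp only [e] at bot top
  unfold rectIntegral
  rw [bot, top, right, left]
  linear_combination c1 + c2 + c3 + c4

/-- **Argument principle** on a rectangle, weighted by an entire function. -/
theorem rectIntegral_logDeriv_mul {f H : ℂ → ℂ} (hf : Differentiable ℂ f)
    (hH : Differentiable ℂ H) {x₁ x₂ a b : ℝ} (hx : x₁ < x₂) (hab : a < b) {Z : Finset ℂ}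
    (hZ : ∀ z, z ∈ Z ↔ f z = 0 ∧ z ∈ Set.Icc x₁ x₂ ×ℂ Set.Icc a b)
    (hbd : ∀ z ∈ Set.Icc x₁ x₂ ×ℂ Set.Icc a b,
      z.re = x₁ ∨ z.re = x₂ ∨ z.im = a ∨ z.im = b → f z ≠ 0) :
    rectIntegral (fun z => logDeriv f z * H z) x₁ x₂ a b =
      2 * Real.pi * Complex.I * ∑ ρ ∈ Z, (analyticOrderNatAt f ρ : ℂ) * H ρ := by
  have hcorner : f (x₁ + a * Complex.I) ≠ 0 :=
    hbd _ (by simp [Complex.mem_reProdIm, hx.le, hab.le]) (by simp)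
  obtain ⟨g, hg, hfg, hgZ⟩ := exists_entire_factor hf ⟨_, hcorner⟩ Z
  set n := analyticOrderNatAt f
  have hgne : ∀ z ∈ Set.Icc x₁ x₂ ×ℂ Set.Icc a b, g z ≠ 0 := fun z hz h =>
    hgZ z ((hZ z).mpr ⟨by rw [hfg, h, mul_zero], hz⟩) h
  have hds : ∀ ρ, Differentiable ℂ (dslope H ρ) := fun ρ => by
    have := (Complex.differentiableOn_dslope (f := H) (c := ρ) (s := Set.univ) univ_mem).mpr
      hH.differentiableOn
    exact differentiableOn_univ.mp this
  -- Writing `H(z)/(z-ρ) = H(ρ)/(z-ρ) + dslope H ρ z`, all that is holomorphic on the rectangle is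
  -- collected in `K` and integrates to zero.
  set K : ℂ → ℂ := fun z => ∑ ρ ∈ Z, (n ρ : ℂ) * dslope H ρ z + logDeriv g z * H z with hK
  have hKd : ∀ z ∈ Set.Icc x₁ x₂ ×ℂ Set.Icc a b, DifferentiableAt ℂ K z := by
    intro z hz
    refine DifferentiableAt.add (by fun_prop) (DifferentiableAt.mul ?_ (hH z))
    exact (hg.deriv z).div (hg z) (hgne z hz)
  have hne : ∀ z ∈ Set.Icc x₁ x₂ ×ℂ Set.Icc a b,
      z.re = x₁ ∨ z.re = x₂ ∨ z.im = a ∨ z.im = b → ∀ ρ ∈ Z, z - ρ ≠ 0 := by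
    intro z hz hz' ρ hρ h
    rw [sub_eq_zero] at h
    exact hbd z hz hz' (h ▸ ((hZ ρ).mp hρ).1)
  have hcb : ∀ ρ ∈ Z, ContinuousOnRectBoundary
      (fun z => (n ρ : ℂ) * H ρ * (z - ρ)⁻¹) x₁ x₂ a b := by
    intro ρ hρ z hz hz'
    rw [Set.uIcc_of_le hx.le, Set.uIcc_of_le hab.le] at hz
    exact continuousAt_const.mul (ContinuousAt.inv₀ (by fun_prop) (hne z hz hz' ρ hρ))
  have hdecomp : rectIntegral (fun z => logDeriv f z * H z) x₁ x₂ a b =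
      rectIntegral (fun z => ∑ ρ ∈ Z, (n ρ : ℂ) * H ρ * (z - ρ)⁻¹ + K z) x₁ x₂ a b := by
    refine rectIntegral_congr fun z hz hz' => ?_
    rw [Set.uIcc_of_le hx.le, Set.uIcc_of_le hab.le] at hz
    have hfz := hbd z hz hz'
    have hzZ : z ∉ Z := fun h => hfz ((hZ z).mp h).1
    simp only [hK]
    rw [logDeriv_eq_sum_add hg hfg hfz hzZ, add_mul, ← add_assoc, Finset.sum_mul,
      ← Finset.sum_add_distrib]
    congr 1
    refine Finset.sum_congr rfl fun ρ hρ => ?_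
    have h1 := hne z hz hz' ρ hρ
    rw [dslope_of_ne _ (sub_ne_zero.mp h1), slope_def_field]
    field_simp
    ring
  rw [hdecomp, rectIntegral_add, rectIntegral_sum hcb, rectIntegral_eq_zero (F := K), add_zero,
    Finset.mul_sum]
  · refine Finset.sum_congr rfl fun ρ hρ => ?_
    obtain ⟨hρ0, hρ1⟩ := (hZ ρ).mp hρ
    -- No zero lies on the boundary, so `ρ` is strictly inside.
    have hb' := mt (hbd ρ hρ1) (not_not.mpr hρ0)
    push Not at hb'
    obtain ⟨⟨r1, r2⟩, ⟨r3, r4⟩⟩ := Complex.mem_reProdIm.mp hρ1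
    rw [rectIntegral_const_mul, rectIntegral_inv_sub (lt_of_le_of_ne r1 hb'.1.symm)
      (lt_of_le_of_ne r2 hb'.2.1) (lt_of_le_of_ne r3 hb'.2.2.1.symm)
      (lt_of_le_of_ne r4 hb'.2.2.2)]
    ring
  · rw [Set.uIcc_of_le hx.le, Set.uIcc_of_le hab.le]
    exact fun z hz => (hKd z hz).differentiableWithinAt
  · intro z hz hz'
    exact tendsto_finsetSum _ fun i hi => hcb i hi z hz hz'
  · intro z hz _
    rw [Set.uIcc_of_le hx.le, Set.uIcc_of_le hab.le] at hz
    exact (hKd z hz).continuousAt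

end OneLevel

/-! ### Sums over the zeros of a function in a strip -/

namespace OneLevel

open Metric in
/-- An entire function with zeros in the open critical strip only, whose growth around the line
`Re s = 2` is at most exponential in the height. -/
structure StripGrowth (f : ℂ → ℂ) (A : ℝ) : Prop where
  differentiable : Differentiable ℂ f
  one_le : 1 ≤ A
  zeros : ∀ z, f z = 0 → 0 < z.re ∧ z.re < 1
  growth : ∀ T : ℝ, ∀ z ∈ closedBall (2 + T * Complex.I) 32,
    ‖f z‖ ≤ ‖f (2 + T * Complex.I)‖ * Real.exp (A * (1 + |T|))

theorem StripGrowth.ne_zero {f : ℂ → ℂ} {A : ℝ} (hf : StripGrowth f A) {z : ℂ}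
    (hz : 1 ≤ z.re ∨ z.re ≤ 0) : f z ≠ 0 := fun h => by
  have := hf.zeros z h
  rcases hz with hz | hz <;> linarith

-- Landau's lemma with `r = 32`, so that `r/4 = 8` and `r/8 = 4`. The disc of radius `4` about `2 +
-- iT` contains `-1 ≤ Re z ≤ 2`, `|Im z - T| ≤ 1`, because `3² + 1² ≤ 4²`.
open Metric in
theorem StripGrowth.exists_zeros {f : ℂ → ℂ} {A : ℝ} (hf : StripGrowth f A) (T : ℝ) :
    ∃ Z : Finset ℂ, (∀ z, z ∈ Z ↔ f z = 0 ∧ z ∈ closedBall (2 + T * Complex.I) 8) ∧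
      ∑ ρ ∈ Z, (analyticOrderNatAt f ρ : ℝ) ≤ A * (1 + |T|) ∧
      ∀ z ∈ closedBall (2 + T * Complex.I) 4, f z ≠ 0 →
        ‖logDeriv f z - ∑ ρ ∈ Z, (analyticOrderNatAt f ρ : ℂ) / (z - ρ)‖ ≤
          3 * (A * (1 + |T|)) := by
  set c : ℂ := 2 + T * Complex.I with hc
  have hA := hf.one_le
  have hcne : f c ≠ 0 := hf.ne_zero (.inl (by simp [hc]))
  have hfin := finite_zeros_of_isCompact hf.differentiable ⟨c, hcne⟩ (isCompact_closedBall c 8)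
  have hB : 0 < A * (1 + |T|) := by positivity
  have hmem : ∀ z, z ∈ hfin.toFinset ↔ f z = 0 ∧ z ∈ closedBall c 8 := fun z => by
    rw [Set.Finite.mem_toFinset]; exact and_comm
  obtain ⟨h1, h2⟩ := sum_order_le_and_norm_logDeriv_sub_le hf.differentiable (r := 32)
    (by norm_num) hB hcne (hf.growth T) (Z := hfin.toFinset)
    (fun z => by rw [hmem]; norm_num)
  refine ⟨hfin.toFinset, hmem, h1, fun z hz hfz => (h2 z (by convert hz using 2; norm_num) hfz).trans
    (le_of_eq (by ring))⟩

theorem StripGrowth.one_le_order {f : ℂ → ℂ} {A : ℝ} (hf : StripGrowth f A) {ρ : ℂ}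
    (hρ : f ρ = 0) : 1 ≤ analyticOrderNatAt f ρ := by
  have h1 := analyticOrderAt_ne_top_of_entire hf.differentiable
    ⟨2, hf.ne_zero (.inl (by simp))⟩ ρ
  have h2 := (hf.differentiable.analyticAt ρ).analyticOrderAt_ne_zero.mpr hρ
  rw [Nat.one_le_iff_ne_zero]
  intro h
  rw [← Nat.cast_analyticOrderNatAt h1, h] at h2
  exact h2 rfl

theorem norm_sub_add_mul_I_le {z : ℂ} {T a b r : ℝ} (h1 : |z.re - 2| ≤ a) (h2 : |z.im - T| ≤ b)
    (hr : 0 ≤ r) (h : a ^ 2 + b ^ 2 ≤ r ^ 2) :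
    z ∈ Metric.closedBall (2 + T * Complex.I) r := by
  rw [Metric.mem_closedBall, dist_eq_norm, ← sq_le_sq₀ (norm_nonneg _) hr, Complex.sq_norm,
    Complex.normSq_apply]
  simp only [Complex.sub_re, Complex.add_re, Complex.re_ofNat, Complex.mul_re, Complex.ofReal_re,
    Complex.I_re, mul_zero, Complex.ofReal_im, Complex.I_im, mul_one, sub_self, add_zero,
    Complex.sub_im, Complex.add_im, Complex.im_ofNat, Complex.mul_im, zero_add]
  have h3 := sq_le_sq' (neg_le_of_abs_le h1) (le_of_abs_le h1)
  have h4 := sq_le_sq' (neg_le_of_abs_le h2) (le_of_abs_le h2)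
  nlinarith

theorem norm_sum_div_sub_le {Z : Finset ℂ} {n : ℂ → ℕ} {z : ℂ} {δ : ℝ} (hδ : 0 < δ)
    (h : ∀ ρ ∈ Z, δ ≤ ‖z - ρ‖) :
    ‖∑ ρ ∈ Z, (n ρ : ℂ) / (z - ρ)‖ ≤ (∑ ρ ∈ Z, (n ρ : ℝ)) / δ := by
  rw [Finset.sum_div]
  refine (norm_sum_le _ _).trans (Finset.sum_le_sum fun ρ hρ => ?_)
  rw [norm_div, Complex.norm_natCast]
  exact div_le_div_of_nonneg_left (by positivity) hδ (h ρ hρ)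

/-- Both lines are at distance at least `1` from every zero, so the sum over nearby zeros is at most
their number. -/
theorem StripGrowth.norm_logDeriv_vertical_le {f : ℂ → ℂ} {A : ℝ} (hf : StripGrowth f A) {z : ℂ}
    (hz : z.re = 2 ∨ z.re = -1) : ‖logDeriv f z‖ ≤ 4 * (A * (1 + |z.im|)) := by
  obtain ⟨Z, hZ, h1, h2⟩ := hf.exists_zeros z.im
  have hfz : f z ≠ 0 := hf.ne_zero (by rcases hz with h | h <;> rw [h] <;> norm_num)
  have h3 := h2 z (norm_sub_add_mul_I_le (a := 3) (b := 0)
    (by rcases hz with h | h <;> rw [h] <;> norm_num) (by simp) (by norm_num) (by norm_num)) hfz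
  have h4 := norm_sum_div_sub_le (Z := Z) (n := analyticOrderNatAt f) (z := z) one_pos
    fun ρ hρ => by
      refine le_trans ?_ (Complex.abs_re_le_norm _)
      obtain ⟨p, q⟩ := hf.zeros ρ ((hZ ρ).mp hρ).1
      rw [Complex.sub_re]
      rcases hz with h | h <;> rw [h, le_abs]
      · left; linarith
      · right; linarith
  have h5 := norm_le_norm_sub_add (logDeriv f z)
    (∑ ρ ∈ Z, (analyticOrderNatAt f ρ : ℂ) / (z - ρ))
  linarith

/-- A real number in a unit interval that stays away from finitely many given ones. -/
theorem exists_forall_le_abs_sub (s : Finset ℝ) (T : ℝ) {δ : ℝ} (hδ : 0 < δ)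
    (h : 2 * δ * s.card < 1) : ∃ t ∈ Set.Icc T (T + 1), ∀ x ∈ s, δ ≤ |t - x| := by
  by_contra! hcon
  have hsub : Set.Icc T (T + 1) ⊆ ⋃ x ∈ s, Metric.ball x δ := by
    intro t ht
    obtain ⟨x, hx, hxt⟩ := hcon t ht
    exact Set.mem_biUnion hx (by simpa [Real.dist_eq] using hxt)
  -- Otherwise intervals of total length `2δ · card s < 1` would cover an interval of length `1`.
  have h1 := (measure_mono hsub).trans (measure_biUnion_finset_le (μ := volume) s _)
  simp only [Real.volume_Icc, Real.volume_ball, Finset.sum_const, nsmul_eq_mul] at h1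
  rw [add_sub_cancel_left, ← ENNReal.ofReal_natCast, ← ENNReal.ofReal_mul (by positivity),
    ENNReal.ofReal_le_ofReal_iff (by positivity)] at h1
  linarith

/-- At most `N` zeros are nearby, so some height in the unit interval avoids all their ordinates by
`1/(4N)`. The sum over zeros is then at most `N · 4N`, and the remainder `3N ≤ 3N²` makes `7N²`. -/
theorem StripGrowth.exists_height {f : ℂ → ℂ} {A : ℝ} (hf : StripGrowth f A) (T : ℝ) :
    ∃ t ∈ Set.Icc T (T + 1), ∀ z : ℂ, z.im = t → z.re ∈ Set.Icc (-1 : ℝ) 2 →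
      f z ≠ 0 ∧ ‖logDeriv f z‖ ≤ 7 * (A * (1 + |T|)) ^ 2 := by
  classical
  obtain ⟨Z, hZ, h1, h2⟩ := hf.exists_zeros T
  set N := A * (1 + |T|) with hN
  have hN1 : 1 ≤ N := by
    have := hf.one_le
    have := abs_nonneg T
    nlinarith
  have hcard : (Z.card : ℝ) ≤ N := by
    refine le_trans ?_ h1
    rw [Finset.card_eq_sum_ones, Nat.cast_sum]
    exact Finset.sum_le_sum fun ρ hρ => by
      exact_mod_cast hf.one_le_order ((hZ ρ).mp hρ).1
  obtain ⟨t, ht, htZ⟩ := exists_forall_le_abs_sub (Z.image Complex.im) T (δ := 1 / (4 * N))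
    (by positivity) (by
      have : ((Z.image Complex.im).card : ℝ) ≤ N :=
        le_trans (by exact_mod_cast Finset.card_image_le) hcard
      rw [show 2 * (1 / (4 * N)) * ((Z.image Complex.im).card : ℝ) =
        ((Z.image Complex.im).card : ℝ) / N / 2 by field_simp; norm_num]
      have : ((Z.image Complex.im).card : ℝ) / N ≤ 1 := by
        rw [div_le_one (by positivity)]; exact this
      linarith)
  refine ⟨t, ht, fun z hz hre => ?_⟩
  have hre' : |z.re - 2| ≤ 3 := by rw [abs_le]; constructor <;> linarith [hre.1, hre.2]
  have him' : |z.im - T| ≤ 1 := by rw [hz, abs_le]; constructor <;> linarith [ht.1, ht.2]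
  have hdist : ∀ ρ ∈ Z, 1 / (4 * N) ≤ ‖z - ρ‖ := fun ρ hρ => by
    refine le_trans ?_ (Complex.abs_im_le_norm _)
    rw [Complex.sub_im, hz]
    exact htZ _ (Finset.mem_image_of_mem _ hρ)
  have hfz : f z ≠ 0 := fun h => by
    have hzZ : z ∈ Z := (hZ z).mpr
      ⟨h, norm_sub_add_mul_I_le hre' him' (by norm_num) (by norm_num)⟩
    have := hdist z hzZ
    rw [sub_self, norm_zero] at this
    have : 0 < 1 / (4 * N) := by positivity
    linarith
  refine ⟨hfz, ?_⟩
  have h3 := h2 z (norm_sub_add_mul_I_le hre' him' (by norm_num) (by norm_num)) hfz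
  have h4 := norm_sum_div_sub_le (Z := Z) (n := analyticOrderNatAt f) (z := z) (by positivity) hdist
  have h5 := norm_le_norm_sub_add (logDeriv f z)
    (∑ ρ ∈ Z, (analyticOrderNatAt f ρ : ℂ) / (z - ρ))
  rw [div_div_eq_mul_div, div_one] at h4
  nlinarith

theorem summable_int_one_div_one_add_abs_cube :
    Summable fun k : ℤ => 1 / (1 + |(k : ℝ)|) ^ 3 := by
  have h : Summable fun n : ℕ => 1 / (1 + (n : ℝ)) ^ 3 := by
    have := (summable_nat_add_iff 1).mpr (Real.summable_one_div_nat_pow.mpr (by norm_num : 1 < 3))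
    refine this.congr fun n => ?_
    push_cast
    rw [add_comm]
  refine Summable.of_nat_of_neg ?_ ?_ <;> simpa using h

theorem one_add_abs_le {x k : ℝ} (h : |x - k| ≤ 1) : (1 + |k|) / 2 ≤ 1 + |x| := by
  have := abs_sub_abs_le_abs_sub k x
  rw [abs_sub_comm] at this
  have := abs_nonneg x
  linarith

/-- Group the zeros by `⌊Im ρ⌋ = k`. A group has at most `A(1+|k|)` members with multiplicity, each
weighted by at most `16C/(1+|k|)⁴`, which leaves a convergent sum of cubes. -/
theorem StripGrowth.summable {f H : ℂ → ℂ} {A C : ℝ} (hf : StripGrowth f A)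
    (hH : ∀ z : ℂ, z.re ∈ Set.Icc (-1 : ℝ) 2 → ‖H z‖ ≤ C / (1 + |z.im|) ^ 4)
    {S : Set ℂ} (hS : ∀ z, z ∈ S ↔ f z = 0) :
    Summable fun ρ : S => (analyticOrderNatAt f ρ : ℂ) * H ρ := by
  classical
  have hA := hf.one_le
  have hC : 0 ≤ C := by
    have h0 := hH 0 (by norm_num)
    have h2 := (norm_nonneg _).trans h0
    simpa using h2
  have hfib : ∀ (u : Finset S) (k : ℤ), ∑ ρ ∈ u.filter fun ρ : S => ⌊(ρ : ℂ).im⌋ = k,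
      ‖(analyticOrderNatAt f ρ : ℂ) * H ρ‖ ≤ 16 * C * A * (1 / (1 + |(k : ℝ)|) ^ 3) := by
    intro u k
    obtain ⟨Z, hZ, h1, -⟩ := hf.exists_zeros k
    have hk : 0 < 1 + |(k : ℝ)| := by positivity
    have hsub : (u.filter fun ρ : S => ⌊(ρ : ℂ).im⌋ = k).map (Function.Embedding.subtype _) ⊆ Z := by
      intro z hz
      simp only [Finset.mem_map, Finset.mem_filter, Function.Embedding.coe_subtype] at hz
      obtain ⟨ρ, ⟨-, hρk⟩, rfl⟩ := hz
      have h0 := (hS ρ).mp ρ.2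
      obtain ⟨p, q⟩ := hf.zeros _ h0
      rw [Int.floor_eq_iff] at hρk
      refine (hZ _).mpr ⟨h0, ?_⟩
      have := norm_sub_add_mul_I_le (z := ρ) (T := k) (a := 2) (b := 1) (r := 8)
        (by rw [abs_le]; constructor <;> linarith)
        (by rw [abs_le]; constructor <;> linarith) (by norm_num) (by norm_num)
      simpa using this
    have hterm : ∀ ρ ∈ u.filter fun ρ : S => ⌊(ρ : ℂ).im⌋ = k,
        ‖(analyticOrderNatAt f ρ : ℂ) * H ρ‖ ≤
          (analyticOrderNatAt f ρ : ℝ) * (16 * C / (1 + |(k : ℝ)|) ^ 4) := by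
      intro ρ hρ
      have hρk := (Finset.mem_filter.mp hρ).2
      rw [Int.floor_eq_iff] at hρk
      have h0 := (hS ρ).mp ρ.2
      obtain ⟨p, q⟩ := hf.zeros _ h0
      rw [norm_mul, Complex.norm_natCast]
      refine mul_le_mul_of_nonneg_left ?_ (by positivity)
      refine (hH ρ ⟨by linarith, by linarith⟩).trans ?_
      have h2 := one_add_abs_le (x := (ρ : ℂ).im) (k := k)
        (by rw [abs_le]; constructor <;> linarith)
      calc C / (1 + |(ρ : ℂ).im|) ^ 4 ≤ C / ((1 + |(k : ℝ)|) / 2) ^ 4 := by gcongr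
        _ = _ := by field_simp; norm_num
    calc _ ≤ ∑ ρ ∈ u.filter fun ρ : S => ⌊(ρ : ℂ).im⌋ = k,
          (analyticOrderNatAt f ρ : ℝ) * (16 * C / (1 + |(k : ℝ)|) ^ 4) := Finset.sum_le_sum hterm
      _ = (∑ ρ ∈ (u.filter fun ρ : S => ⌊(ρ : ℂ).im⌋ = k).map (Function.Embedding.subtype _),
          (analyticOrderNatAt f ρ : ℝ)) * (16 * C / (1 + |(k : ℝ)|) ^ 4) := by
        rw [Finset.sum_map, Finset.sum_mul]; rfl
      _ ≤ (A * (1 + |(k : ℝ)|)) * (16 * C / (1 + |(k : ℝ)|) ^ 4) := by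
        refine mul_le_mul_of_nonneg_right (le_trans ?_ h1) (by positivity)
        exact Finset.sum_le_sum_of_subset_of_nonneg hsub fun _ _ _ => by positivity
      _ = _ := by field_simp
  have hsum := summable_int_one_div_one_add_abs_cube.mul_left (16 * C * A)
  refine Summable.of_norm (summable_of_sum_le (c := ∑' k : ℤ, 16 * C * A *
    (1 / (1 + |(k : ℝ)|) ^ 3)) (fun _ => norm_nonneg _) fun u => ?_)
  rw [← Finset.sum_fiberwise_of_maps_to (s := u) (t := u.image fun ρ : S => ⌊(ρ : ℂ).im⌋)
    (g := fun ρ : S => ⌊(ρ : ℂ).im⌋) (fun ρ hρ => Finset.mem_image_of_mem _ hρ)]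
  refine (Finset.sum_le_sum fun k _ => hfib u k).trans ?_
  exact hsum.sum_le_tsum _ fun k _ => by positivity

theorem integrable_of_norm_le_div_one_add_sq {F : ℝ → ℂ} {C : ℝ} (hF : Continuous F)
    (h : ∀ t, ‖F t‖ ≤ C / (1 + |t|) ^ 2) : Integrable F := by
  have h1 : Integrable fun t : ℝ => C * (1 + ‖t‖) ^ (-(2 : ℝ)) :=
    (integrable_one_add_norm (by simp)).const_mul C
  refine h1.mono' hF.aestronglyMeasurable (ae_of_all _ fun t => (h t).trans (le_of_eq ?_))
  rw [Real.norm_eq_abs, Real.rpow_neg (by positivity), div_eq_mul_inv]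
  norm_cast

/-- The rectangle integrals of a function that decays on good horizontal lines converge to the
difference of the integrals over the vertical lines. -/
theorem tendsto_rectIntegral {F : ℂ → ℂ} {x₁ x₂ : ℝ} {a b : ℕ → ℝ} (ha : Tendsto a atTop atBot)
    (hb : Tendsto b atTop atTop) (h1 : Integrable fun t : ℝ => F (x₁ + t * Complex.I))
    (h2 : Integrable fun t : ℝ => F (x₂ + t * Complex.I)) {ε : ℕ → ℝ} (hε : Tendsto ε atTop (𝓝 0))
    (hbd : ∀ n, ∀ x ∈ Set.uIoc x₁ x₂, ‖F (x + a n * Complex.I)‖ ≤ ε n ∧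
      ‖F (x + b n * Complex.I)‖ ≤ ε n) :
    Tendsto (fun n => rectIntegral F x₁ x₂ (a n) (b n)) atTop
      (𝓝 (Complex.I * (∫ t : ℝ, F (x₂ + t * Complex.I)) -
        Complex.I * ∫ t : ℝ, F (x₁ + t * Complex.I))) := by
  have hz : Tendsto (fun n => ε n * |x₂ - x₁|) atTop (𝓝 0) := by simpa using hε.mul_const _
  have ta : Tendsto (fun n => ∫ x : ℝ in x₁..x₂, F (x + a n * Complex.I)) atTop (𝓝 0) :=
    squeeze_zero_norm (fun n => intervalIntegral.norm_integral_le_of_norm_le_const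
      fun x hx => (hbd n x hx).1) hz
  have tb : Tendsto (fun n => ∫ x : ℝ in x₁..x₂, F (x + b n * Complex.I)) atTop (𝓝 0) :=
    squeeze_zero_norm (fun n => intervalIntegral.norm_integral_le_of_norm_le_const
      fun x hx => (hbd n x hx).2) hz
  have v1 := intervalIntegral_tendsto_integral h1 ha hb
  have v2 := intervalIntegral_tendsto_integral h2 ha hb
  simpa [rectIntegral] using
    ((ta.sub tb).add (v2.const_mul Complex.I)).sub (v1.const_mul Complex.I)

/-- Shifting a line of integration within a strip of holomorphy. -/
theorem integral_vertical_eq {F : ℂ → ℂ} {x₁ x₂ C : ℝ} (hx : x₁ ≤ x₂)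
    (hF : DifferentiableOn ℂ F {z | z.re ∈ Set.Icc x₁ x₂})
    (hC : ∀ z : ℂ, z.re ∈ Set.Icc x₁ x₂ → ‖F z‖ ≤ C / (1 + |z.im|) ^ 2) :
    ∫ t : ℝ, F (x₂ + t * Complex.I) = ∫ t : ℝ, F (x₁ + t * Complex.I) := by
  have hint : ∀ x ∈ Set.Icc x₁ x₂, Integrable fun t : ℝ => F (x + t * Complex.I) := fun x hx => by
    refine integrable_of_norm_le_div_one_add_sq (C := C) ?_ fun t => ?_
    · rw [← continuousOn_univ]
      exact hF.continuousOn.comp (f := fun t : ℝ => (x + t * Complex.I : ℂ)) (by fun_prop)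
        fun t _ => by simpa using hx
    · simpa using hC (x + t * Complex.I) (by simpa using hx)
  have hε : Tendsto (fun n : ℕ => C / (1 + (n : ℝ)) ^ 2) atTop (𝓝 0) := by
    refine tendsto_const_nhds.div_atTop ?_
    exact (tendsto_pow_atTop two_ne_zero).comp
      (tendsto_atTop_add_const_left _ _ tendsto_natCast_atTop_atTop)
  have h := tendsto_rectIntegral (a := fun n : ℕ => -(n : ℝ)) (b := fun n : ℕ => (n : ℝ))
    (tendsto_neg_atTop_atBot.comp tendsto_natCast_atTop_atTop) tendsto_natCast_atTop_atTop
    (hint x₁ (by simp [hx])) (hint x₂ (by simp [hx])) hε (fun n x hx' => by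
      rw [Set.uIoc_of_le hx] at hx'
      have hx'' : x ∈ Set.Icc x₁ x₂ := ⟨hx'.1.le, hx'.2⟩
      constructor
      · simpa using hC (x + (-(n : ℝ) : ℝ) * Complex.I) (by simpa using hx'')
      · simpa using hC (x + (n : ℝ) * Complex.I) (by simpa using hx''))
  have h0 : ∀ n : ℕ, rectIntegral F x₁ x₂ (-(n : ℝ)) n = 0 := fun n =>
    rectIntegral_eq_zero (hF.mono fun z hz => by
      have := (Complex.mem_reProdIm.mp hz).1
      rwa [Set.uIcc_of_le hx] at this)
  simp only [h0] at h
  have h3 := tendsto_nhds_unique tendsto_const_nhds h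
  rw [← mul_sub] at h3
  exact sub_eq_zero.mp ((mul_eq_zero.mp h3.symm).resolve_left Complex.I_ne_zero)

theorem StripGrowth.integrable_vertical {f H : ℂ → ℂ} {A C : ℝ} (hf : StripGrowth f A)
    (hHd : Differentiable ℂ H)
    (hH : ∀ z : ℂ, z.re ∈ Set.Icc (-1 : ℝ) 2 → ‖H z‖ ≤ C / (1 + |z.im|) ^ 4) {x : ℝ}
    (hx : x = 2 ∨ x = -1) :
    Integrable fun t : ℝ => logDeriv f (x + t * Complex.I) * H (x + t * Complex.I) := by
  refine integrable_of_norm_le_div_one_add_sq (C := 4 * A * C) ?_ fun t => ?_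
  · refine Continuous.mul ?_ (hHd.continuous.comp (by fun_prop))
    refine Continuous.div ?_ (hf.differentiable.continuous.comp (by fun_prop)) fun t => ?_
    · exact hf.differentiable.deriv.continuous.comp (by fun_prop)
    · refine hf.ne_zero ?_
      rcases hx with rfl | rfl <;> simp
  · have h1 := hf.norm_logDeriv_vertical_le (z := x + t * Complex.I)
      (by rcases hx with rfl | rfl <;> simp)
    have h2 := hH (x + t * Complex.I) (by rcases hx with rfl | rfl <;> norm_num)
    simp only [Complex.add_im, Complex.ofReal_im, Complex.mul_im, Complex.ofReal_re, Complex.I_im,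
      mul_one, Complex.I_re, mul_zero, add_zero, zero_add] at h1 h2
    have hA := hf.one_le
    have hC : 0 ≤ C := by
      have := (norm_nonneg _).trans h2
      rwa [le_div_iff₀ (by positivity), zero_mul] at this
    rw [norm_mul]
    have ht : 1 ≤ 1 + |t| := by linarith [abs_nonneg t]
    calc _ ≤ 4 * (A * (1 + |t|)) * (C / (1 + |t|) ^ 4) := by gcongr
      _ = 4 * A * C / (1 + |t|) ^ 3 := by field_simp
      _ ≤ _ := by gcongr; norm_num

/-- The sum over all zeros as a difference of integrals over vertical lines. -/
theorem StripGrowth.tsum_zeros {f H : ℂ → ℂ} {A C : ℝ} (hf : StripGrowth f A)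
    (hHd : Differentiable ℂ H)
    (hH : ∀ z : ℂ, z.re ∈ Set.Icc (-1 : ℝ) 2 → ‖H z‖ ≤ C / (1 + |z.im|) ^ 4)
    {S : Set ℂ} (hS : ∀ z, z ∈ S ↔ f z = 0) :
    2 * Real.pi * ∑' ρ : S, (analyticOrderNatAt f ρ : ℂ) * H ρ =
      (∫ t : ℝ, logDeriv f (2 + t * Complex.I) * H (2 + t * Complex.I)) -
        ∫ t : ℝ, logDeriv f (-1 + t * Complex.I) * H (-1 + t * Complex.I) := by
  classical
  have hA := hf.one_le
  have hC : 0 ≤ C := by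
    have h0 := hH 0 (by norm_num)
    have h2 := (norm_nonneg _).trans h0
    simpa using h2
  choose t ht hgood using fun k : ℤ => hf.exists_height k
  -- The good heights `a n ∈ [-n-2, -n-1]` and `b n ∈ [n, n+1]` are monotone in `n`, so the
  -- rectangles increase. The offset `2` keeps `a n < b n` even at `n = 0`.
  set a : ℕ → ℝ := fun n => t (-n - 2) with ha
  set b : ℕ → ℝ := fun n => t n with hb
  have ha' : ∀ n : ℕ, a n ∈ Set.Icc (-(n : ℝ) - 2) (-(n : ℝ) - 1) := fun n => by
    have := ht (-n - 2)
    push_cast at this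
    exact ⟨this.1, by linarith [this.2]⟩
  have hb' : ∀ n : ℕ, b n ∈ Set.Icc (n : ℝ) (n + 1) := fun n => by simpa using ht n
  have hab : ∀ n, a n < b n := fun n => by
    have := (ha' n).2
    have := (hb' n).1
    have : (0 : ℝ) ≤ n := by positivity
    linarith
  have hcne : ∃ z, f z ≠ 0 := ⟨2, hf.ne_zero (.inl (by simp))⟩
  have hfin : ∀ n, {z ∈ Set.Icc (-1 : ℝ) 2 ×ℂ Set.Icc (a n) (b n) | f z = 0}.Finite := fun n =>
    finite_zeros_of_isCompact hf.differentiable hcne (isCompact_Icc.reProdIm isCompact_Icc)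
  set Z : ℕ → Finset ℂ := fun n => (hfin n).toFinset with hZ
  have hZmem : ∀ n z, z ∈ Z n ↔ f z = 0 ∧ z ∈ Set.Icc (-1 : ℝ) 2 ×ℂ Set.Icc (a n) (b n) :=
    fun n z => by rw [hZ, Set.Finite.mem_toFinset]; exact and_comm
  have hrect : ∀ n, rectIntegral (fun z => logDeriv f z * H z) (-1) 2 (a n) (b n) =
      2 * Real.pi * Complex.I * ∑ ρ ∈ Z n, (analyticOrderNatAt f ρ : ℂ) * H ρ := fun n => by
    refine rectIntegral_logDeriv_mul hf.differentiable hHd (by norm_num) (hab n) (hZmem n) ?_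
    rintro z hz (h | h | h | h)
    · exact hf.ne_zero (.inr (by rw [h]; norm_num))
    · exact hf.ne_zero (.inl (by rw [h]; norm_num))
    · exact (hgood _ z h (Complex.mem_reProdIm.mp hz).1).1
    · exact (hgood _ z h (Complex.mem_reProdIm.mp hz).1).1
  have hZS : ∀ n, ∀ z ∈ Z n, z ∈ S := fun n z hz => (hS z).mpr ((hZmem n z).mp hz).1
  have hmono : Monotone fun n => (Z n).subtype (· ∈ S) := by
    refine monotone_nat_of_le_succ fun n z hz => ?_
    rw [Finset.mem_subtype, hZmem] at hz ⊢
    refine ⟨hz.1, (Complex.mem_reProdIm.mp hz.2).1, ?_⟩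
    have h1 := (Complex.mem_reProdIm.mp hz.2).2
    have h2 := (ha' (n + 1)).2
    have h3 := (ha' n).1
    have h4 := (hb' n).2
    have h5 := (hb' (n + 1)).1
    push_cast at h2 h5
    exact ⟨by linarith [h1.1], by linarith [h1.2]⟩
  have hcover : ∀ ρ : S, ∃ n, ρ ∈ (Z n).subtype (· ∈ S) := by
    intro ρ
    obtain ⟨n, hn⟩ := exists_nat_ge |(ρ : ℂ).im|
    have h0 := (hS ρ).mp ρ.2
    have h1 := hf.zeros _ h0
    have h2 := abs_le.mp hn
    refine ⟨n, ?_⟩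
    rw [Finset.mem_subtype, hZmem]
    refine ⟨h0, ⟨by linarith, by linarith⟩, ⟨?_, ?_⟩⟩
    · linarith [(ha' n).2, h2.1]
    · linarith [(hb' n).1, h2.2]
  have hsum := ((hf.summable hH hS).hasSum.comp
    (tendsto_atTop_finset_of_monotone hmono hcover)).const_mul (2 * Real.pi * Complex.I)
  have hsum' : ∀ n, ∑ ρ ∈ (Z n).subtype (· ∈ S), (analyticOrderNatAt f ρ : ℂ) * H ρ =
      ∑ ρ ∈ Z n, (analyticOrderNatAt f ρ : ℂ) * H ρ := fun n =>
    Finset.sum_subtype_of_mem (fun ρ => (analyticOrderNatAt f ρ : ℂ) * H ρ) (hZS n)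
  simp only [Function.comp_def, hsum', ← hrect] at hsum
  -- The product of `7A²(1+|k|)²` from the good heights and `16C/(1+|k|)⁴` from the weight.
  set ε : ℕ → ℝ := fun n => 7 * 16 * A ^ 2 * C / (1 + (n : ℝ)) ^ 2 with hε
  have hε0 : Tendsto ε atTop (𝓝 0) := by
    refine tendsto_const_nhds.div_atTop ?_
    exact (tendsto_pow_atTop two_ne_zero).comp
      (tendsto_atTop_add_const_left _ _ tendsto_natCast_atTop_atTop)
  have hline : ∀ (k : ℤ) (n : ℕ), (n : ℝ) ≤ |(k : ℝ)| → ∀ x ∈ Set.uIoc (-1 : ℝ) 2,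
      ‖logDeriv f (x + t k * Complex.I) * H (x + t k * Complex.I)‖ ≤ ε n := by
    intro k n hkn x hx
    rw [Set.uIoc_of_le (by norm_num)] at hx
    have hx' : x ∈ Set.Icc (-1 : ℝ) 2 := ⟨hx.1.le, hx.2⟩
    have h1 := (hgood k (x + t k * Complex.I) (by simp) (by simpa using hx')).2
    have h2 := hH (x + t k * Complex.I) (by simpa using hx')
    simp only [Complex.add_im, Complex.ofReal_im, Complex.mul_im, Complex.ofReal_re, Complex.I_im,
      mul_one, Complex.I_re, mul_zero, add_zero, zero_add] at h2
    have h3 := one_add_abs_le (x := t k) (k := k) (by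
      rw [abs_le]; constructor <;> linarith [(ht k).1, (ht k).2])
    rw [norm_mul]
    calc _ ≤ 7 * (A * (1 + |(k : ℝ)|)) ^ 2 * (C / (1 + |t k|) ^ 4) := by gcongr
      _ ≤ 7 * (A * (1 + |(k : ℝ)|)) ^ 2 * (C / ((1 + |(k : ℝ)|) / 2) ^ 4) := by gcongr
      _ = 7 * 16 * A ^ 2 * C / (1 + |(k : ℝ)|) ^ 2 := by field_simp; norm_num
      _ ≤ _ := by simp only [hε]; gcongr
  have hlim := tendsto_rectIntegral (F := fun z => logDeriv f z * H z) (x₁ := -1) (x₂ := 2)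
    (a := a) (b := b)
    (tendsto_atBot_mono (fun n => (show a n ≤ -(n : ℝ) by linarith [(ha' n).2]))
      (tendsto_neg_atTop_atBot.comp tendsto_natCast_atTop_atTop))
    (tendsto_atTop_mono (fun n => (hb' n).1) tendsto_natCast_atTop_atTop)
    (hf.integrable_vertical hHd hH (.inr rfl)) (hf.integrable_vertical hHd hH (.inl rfl))
    hε0 (fun n x hx => ⟨hline _ n (by
      push_cast
      rw [abs_of_nonpos (by have : (0 : ℝ) ≤ n := by positivity
                            linarith)]
      linarith) x hx, hline _ n (by simp) x hx⟩)
  have := tendsto_nhds_unique hsum hlim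
  push_cast at this
  refine mul_left_cancel₀ Complex.I_ne_zero ?_
  linear_combination this

end OneLevel

/-! ### The entire extension of the test function and its decay -/

namespace OneLevel

/-- The Fourier–Laplace integral `∫ ψ(ξ) e^{2πizξ} dξ`. -/
noncomputable def laplaceExt (ψ : 𝓢(ℝ, ℂ)) (z : ℂ) : ℂ :=
  ∫ ξ : ℝ, ψ ξ * Complex.exp (2 * Real.pi * Complex.I * z * ξ)

theorem hasCompactSupport_of_forall_lt {ψ : ℝ → ℂ} {R : ℝ} (h : ∀ ξ, R < |ξ| → ψ ξ = 0) :
    HasCompactSupport ψ :=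
  HasCompactSupport.of_support_subset_isCompact (isCompact_Icc (a := -R) (b := R)) fun ξ hξ => by
    rw [Set.mem_Icc, ← abs_le]
    by_contra hcon
    exact hξ (h ξ (not_le.mp hcon))

theorem deriv_eq_zero_of_forall_lt {ψ : ℝ → ℂ} {R : ℝ} (h : ∀ ξ, R < |ξ| → ψ ξ = 0) :
    ∀ ξ, R < |ξ| → deriv ψ ξ = 0 := fun ξ hξ => by
  have hopen : {ξ : ℝ | R < |ξ|} ∈ 𝓝 ξ :=
    (isOpen_lt continuous_const continuous_abs).mem_nhds hξ
  have : ψ =ᶠ[𝓝 ξ] fun _ => 0 := by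
    filter_upwards [hopen] with x hx using h x hx
  rw [this.deriv_eq]
  simp

theorem norm_laplace_kernel (z : ℂ) (ξ : ℝ) :
    ‖Complex.exp (2 * Real.pi * Complex.I * z * ξ)‖ = Real.exp (-(2 * Real.pi * z.im * ξ)) := by
  rw [Complex.norm_exp]
  congr 1
  simp

theorem norm_laplace_integrand_le {ψ : ℝ → ℂ} {R : ℝ} (h : ∀ ξ, R < |ξ| → ψ ξ = 0) {z : ℂ}
    {B : ℝ} (hz : |z.im| ≤ B) (ξ : ℝ) :
    ‖ψ ξ * Complex.exp (2 * Real.pi * Complex.I * z * ξ)‖ ≤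
      ‖ψ ξ‖ * Real.exp (2 * Real.pi * B * R) := by
  rw [norm_mul, norm_laplace_kernel]
  rcases lt_or_ge R |ξ| with hξ | hξ
  · simp [h ξ hξ]
  · refine mul_le_mul_of_nonneg_left (Real.exp_le_exp.mpr ?_) (norm_nonneg _)
    have hB : 0 ≤ B := (abs_nonneg _).trans hz
    have h1 : -(z.im * ξ) ≤ B * R :=
      (neg_le_abs _).trans (by rw [abs_mul]; gcongr)
    have := mul_le_mul_of_nonneg_left h1 (show 0 ≤ 2 * Real.pi by positivity)
    linarith

theorem norm_laplaceExt_le {ψ : 𝓢(ℝ, ℂ)} {R : ℝ} (h : ∀ ξ, R < |ξ| → ψ ξ = 0) {z : ℂ}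
    {B : ℝ} (hz : |z.im| ≤ B) :
    ‖laplaceExt ψ z‖ ≤ (∫ ξ, ‖ψ ξ‖) * Real.exp (2 * Real.pi * B * R) := by
  rw [← integral_mul_const]
  exact norm_integral_le_of_norm_le (ψ.integrable.norm.mul_const _)
    (ae_of_all _ (norm_laplace_integrand_le h hz))

/-- Integration by parts: compact support makes the products with the exponential integrable for
every complex `z` and leaves no boundary term. -/
theorem laplaceExt_deriv {ψ : 𝓢(ℝ, ℂ)} {R : ℝ} (h : ∀ ξ, R < |ξ| → ψ ξ = 0) (z : ℂ) :
    laplaceExt (SchwartzMap.derivCLM ℂ ℂ ψ) z =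
      -(2 * Real.pi * Complex.I * z) * laplaceExt ψ z := by
  have hcs := hasCompactSupport_of_forall_lt h
  set w : ℂ := 2 * Real.pi * Complex.I * z
  have hexp : Continuous fun ξ : ℝ => Complex.exp (w * ξ) := by fun_prop
  have hd : ∀ ξ : ℝ, HasDerivAt (fun ξ : ℝ => Complex.exp (w * ξ))
      (w * Complex.exp (w * ξ)) ξ := fun ξ => by
    have h0 : HasDerivAt (fun x : ℝ => (x : ℂ)) 1 ξ := Complex.ofRealCLM.hasDerivAt
    exact ((h0.const_mul w).cexp).congr_deriv (by ring)
  have hψ : ∀ ξ, HasDerivAt ψ (deriv ψ ξ) ξ := fun ξ => (ψ.differentiableAt).hasDerivAt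
  have hψ' : Continuous (deriv ψ) := by
    have := (SchwartzMap.derivCLM ℂ ℂ ψ).continuous
    exact this.congr fun ξ => SchwartzMap.derivCLM_apply ℂ ψ ξ
  have hcs' : HasCompactSupport (deriv ψ) := hcs.deriv
  have key := integral_mul_deriv_eq_deriv_mul_of_integrable (u := fun ξ : ℝ => Complex.exp (w * ξ))
    (v := ψ) (fun ξ _ => hd ξ) (fun ξ _ => hψ ξ)
    ((hexp.mul hψ').integrable_of_hasCompactSupport (hcs'.mul_left))
    (((continuous_const.mul hexp).mul ψ.continuous).integrable_of_hasCompactSupport (hcs.mul_left))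
    ((hexp.mul ψ.continuous).integrable_of_hasCompactSupport (hcs.mul_left))
  calc laplaceExt (SchwartzMap.derivCLM ℂ ℂ ψ) z
      = ∫ ξ : ℝ, Complex.exp (w * ξ) * deriv ψ ξ := by
        unfold laplaceExt
        congr 1; funext ξ
        rw [SchwartzMap.derivCLM_apply, mul_comm]
    _ = -∫ ξ : ℝ, w * Complex.exp (w * ξ) * ψ ξ := key
    _ = _ := by
        unfold laplaceExt
        rw [neg_mul, ← integral_const_mul]
        congr 2; funext ξ
        ring

theorem differentiable_laplaceExt {ψ : 𝓢(ℝ, ℂ)} {R : ℝ} (h : ∀ ξ, R < |ξ| → ψ ξ = 0) :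
    Differentiable ℂ (laplaceExt ψ) := by
  intro z₀
  have hcs := hasCompactSupport_of_forall_lt h
  have hcont : ∀ z : ℂ, Continuous fun ξ : ℝ =>
      ψ ξ * Complex.exp (2 * Real.pi * Complex.I * z * ξ) := fun z =>
    ψ.continuous.mul (by fun_prop)
  have hR : ∀ ξ, R < |ξ| → (ψ ξ * (2 * Real.pi * Complex.I * ξ)) = 0 := fun ξ hξ => by
    rw [h ξ hξ, zero_mul]
  have hbd : Continuous fun ξ : ℝ => ‖ψ ξ * (2 * Real.pi * Complex.I * ξ)‖ *
      Real.exp (2 * Real.pi * (|z₀.im| + 1) * R) :=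
    ((ψ.continuous.mul (by fun_prop)).norm).mul continuous_const
  have key := hasDerivAt_integral_of_dominated_loc_of_deriv_le (μ := volume)
    (F := fun (z : ℂ) (ξ : ℝ) => ψ ξ * Complex.exp (2 * Real.pi * Complex.I * z * ξ))
    (F' := fun (z : ℂ) (ξ : ℝ) => ψ ξ * (2 * Real.pi * Complex.I * ξ) *
      Complex.exp (2 * Real.pi * Complex.I * z * ξ)) (x₀ := z₀)
    (bound := fun ξ => ‖ψ ξ * (2 * Real.pi * Complex.I * ξ)‖ *
      Real.exp (2 * Real.pi * (|z₀.im| + 1) * R)) (Metric.ball_mem_nhds z₀ one_pos)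
    (Eventually.of_forall fun z => (hcont z).aestronglyMeasurable)
    ((hcont z₀).integrable_of_hasCompactSupport hcs.mul_right)
    ((ψ.continuous.mul (by fun_prop)).mul (by fun_prop)).aestronglyMeasurable
    (ae_of_all _ fun ξ z hz => norm_laplace_integrand_le hR (by
      have h1 : ‖z - z₀‖ < 1 := by simpa [dist_eq_norm] using hz
      have h2 := Complex.abs_im_le_norm (z - z₀)
      rw [Complex.sub_im] at h2
      have h3 := abs_sub_abs_le_abs_sub z.im z₀.im
      linarith) ξ)
    (hbd.integrable_of_hasCompactSupport
      (((hcs.mul_right (f' := fun ξ : ℝ => (2 * Real.pi * Complex.I * ξ : ℂ))).norm).mul_right))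
    (ae_of_all _ fun ξ z _ => by
      have h1 : HasDerivAt (fun z : ℂ => 2 * Real.pi * Complex.I * z * ξ)
          (2 * Real.pi * Complex.I * ξ) z := by
        simpa using ((hasDerivAt_id z).const_mul (2 * Real.pi * Complex.I)).mul_const (ξ : ℂ)
      exact (h1.cexp.const_mul (ψ ξ)).congr_deriv (by ring))
  exact key.2.differentiableAt

/-- Four integrations by parts bound `|z|⁴` times the transform; with the trivial bound and `(1+x)⁴
≤ 8(1+x⁴)` this is the claim. Exponent four absorbs the quadratic growth of `Λ'/Λ` at the good
heights and still leaves decay. -/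
theorem exists_norm_laplaceExt_le {ψ : 𝓢(ℝ, ℂ)} {R : ℝ} (h : ∀ ξ, R < |ξ| → ψ ξ = 0) (B : ℝ) :
    ∃ C, ∀ z : ℂ, |z.im| ≤ B → ‖laplaceExt ψ z‖ ≤ C / (1 + ‖z‖) ^ 4 := by
  set D : 𝓢(ℝ, ℂ) → 𝓢(ℝ, ℂ) := fun χ => SchwartzMap.derivCLM ℂ ℂ χ with hD
  have step : ∀ χ : 𝓢(ℝ, ℂ), (∀ ξ, R < |ξ| → χ ξ = 0) → ∀ ξ, R < |ξ| → D χ ξ = 0 :=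
    fun χ hχ ξ hξ => by
      simp only [hD, SchwartzMap.derivCLM_apply]
      exact deriv_eq_zero_of_forall_lt hχ ξ hξ
  have h1 := step _ h
  have h2 := step _ h1
  have h3 := step _ h2
  have h4 := step _ h3
  set E := Real.exp (2 * Real.pi * B * R)
  refine ⟨8 * ((∫ ξ, ‖ψ ξ‖) * E + (∫ ξ, ‖D (D (D (D ψ))) ξ‖) * E), fun z hz => ?_⟩
  have b0 := norm_laplaceExt_le h hz
  have b4 := norm_laplaceExt_le h4 hz
  simp only [hD] at b4
  rw [laplaceExt_deriv h3, laplaceExt_deriv h2, laplaceExt_deriv h1, laplaceExt_deriv h] at b4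
  simp only [norm_mul, norm_neg, Complex.norm_ofNat, Complex.norm_real, Complex.norm_I, mul_one,
    Real.norm_eq_abs, abs_of_pos Real.pi_pos] at b4
  have hpi : 1 ≤ 2 * Real.pi := by linarith [Real.pi_gt_three]
  have b5 : ‖z‖ ^ 4 * ‖laplaceExt ψ z‖ ≤ (∫ ξ, ‖D (D (D (D ψ))) ξ‖) * E := by
    refine le_trans ?_ b4
    calc ‖z‖ ^ 4 * ‖laplaceExt ψ z‖ = 1 ^ 4 * (‖z‖ ^ 4 * ‖laplaceExt ψ z‖) := by ring
      _ ≤ (2 * Real.pi) ^ 4 * (‖z‖ ^ 4 * ‖laplaceExt ψ z‖) := by gcongr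
      _ = _ := by ring
  rw [le_div_iff₀ (by positivity)]
  have h6 := add_pow_le zero_le_one (norm_nonneg z) 4
  norm_num at h6
  calc _ ≤ ‖laplaceExt ψ z‖ * (8 * (1 + ‖z‖ ^ 4)) := by gcongr
    _ = 8 * (‖laplaceExt ψ z‖ + ‖z‖ ^ 4 * ‖laplaceExt ψ z‖) := by ring
    _ ≤ _ := by gcongr

theorem fourier_neg_of_even {φ : 𝓢(ℝ, ℂ)} (hφ : Function.Even φ) (ξ : ℝ) :
    (𝓕 φ) (-ξ) = (𝓕 φ) ξ := by
  rw [SchwartzMap.fourier_coe, Real.fourier_eq', Real.fourier_eq', ← integral_neg_eq_self]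
  congr 1; funext v
  rw [hφ v]
  simp

theorem entireExt_neg {φ : 𝓢(ℝ, ℂ)} (hφ : Function.Even φ) (z : ℂ) :
    entireExt φ (-z) = entireExt φ z := by
  unfold entireExt
  rw [← integral_neg_eq_self]
  congr 1; funext ξ
  rw [fourier_neg_of_even hφ]
  simp

/-- The test function `φ(γ L / (2π))` as a function of `ρ = 1/2 + iγ`. -/
noncomputable def zeroWeight (φ : 𝓢(ℝ, ℂ)) (L : ℝ) (s : ℂ) : ℂ :=
  entireExt φ (ordinate s * ((L / (2 * Real.pi) : ℝ) : ℂ))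

theorem ordinate_re (s : ℂ) : (ordinate s).re = s.im := by
  simp [ordinate, Complex.div_I]

theorem ordinate_im (s : ℂ) : (ordinate s).im = 1 / 2 - s.re := by
  simp [ordinate, Complex.div_I]

theorem ordinate_half_add (t : ℝ) : ordinate (1 / 2 + t * Complex.I) = t := by
  simp [ordinate]

/-- The reflection `s ↦ 1 - s` negates `γ`. Evenness of `φ` enters the explicit formula only here.
-/
theorem zeroWeight_one_sub {φ : 𝓢(ℝ, ℂ)} (hφ : Function.Even φ) (L : ℝ) (s : ℂ) :
    zeroWeight φ L (1 - s) = zeroWeight φ L s := by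
  rw [zeroWeight, show ordinate (1 - s) = -ordinate s by unfold ordinate; ring, neg_mul,
    entireExt_neg hφ, zeroWeight]

theorem zeroWeight_half_add (φ : 𝓢(ℝ, ℂ)) (L t : ℝ) :
    zeroWeight φ L (1 / 2 + t * Complex.I) = φ (t * (L / (2 * Real.pi))) := by
  rw [zeroWeight, ordinate_half_add, ← Complex.ofReal_mul, entireExt_ofReal]

theorem differentiable_zeroWeight {φ : 𝓢(ℝ, ℂ)} {R : ℝ} (h : ∀ ξ, R < |ξ| → (𝓕 φ) ξ = 0) (L : ℝ) :
    Differentiable ℂ (zeroWeight φ L) := by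
  have h1 : Differentiable ℂ (entireExt φ) := differentiable_laplaceExt (ψ := 𝓕 φ) h
  refine h1.comp ?_
  unfold ordinate
  fun_prop

/-- For `-1 ≤ Re s ≤ 2` the imaginary part `1/2 - Re s` of `γ` is at most `3/2` in modulus. The
constant depends on `L`, which is harmless: it serves only convergence and contour shifts. -/
theorem exists_norm_zeroWeight_le {φ : 𝓢(ℝ, ℂ)} {R : ℝ} (h : ∀ ξ, R < |ξ| → (𝓕 φ) ξ = 0) {L : ℝ}
    (hL : L ≠ 0) : ∃ C, ∀ s : ℂ, s.re ∈ Set.Icc (-1 : ℝ) 2 →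
      ‖zeroWeight φ L s‖ ≤ C / (1 + |s.im|) ^ 4 := by
  set c : ℝ := L / (2 * Real.pi)
  have hc : 0 < |c| := abs_pos.mpr (div_ne_zero hL (by positivity))
  obtain ⟨C, hC⟩ := exists_norm_laplaceExt_le (ψ := 𝓕 φ) h (3 / 2 * |c|)
  refine ⟨C * (1 + |c|⁻¹) ^ 4, fun s hs => ?_⟩
  have h1 := hC (ordinate s * (c : ℂ)) (by
    rw [Complex.im_mul_ofReal, ordinate_im, abs_mul]
    gcongr
    rw [abs_le]; constructor <;> linarith [hs.1, hs.2])
  have hC0 : 0 ≤ C := by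
    have := (norm_nonneg _).trans h1
    rwa [le_div_iff₀ (by positivity), zero_mul] at this
  refine h1.trans ?_
  have h2 : |c| * |s.im| ≤ ‖ordinate s * (c : ℂ)‖ := by
    rw [norm_mul, Complex.norm_real, Real.norm_eq_abs, mul_comm, ← ordinate_re s]
    gcongr
    exact Complex.abs_re_le_norm _
  rw [div_le_div_iff₀ (by positivity) (by positivity), mul_assoc, ← mul_pow]
  gcongr
  have h3 : (1 + |c|⁻¹) * (1 + ‖ordinate s * (c : ℂ)‖) =
      1 + ‖ordinate s * (c : ℂ)‖ + |c|⁻¹ + |c|⁻¹ * ‖ordinate s * (c : ℂ)‖ := by ring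
  have h4 : |s.im| ≤ |c|⁻¹ * ‖ordinate s * (c : ℂ)‖ := by
    rw [inv_mul_eq_div, le_div_iff₀ hc]
    linarith
  have := norm_nonneg (ordinate s * (c : ℂ))
  have : 0 < |c|⁻¹ := by positivity
  linarith

end OneLevel

/-! ### Growth of the gamma factor -/

namespace OneLevel

theorem norm_Gamma_le_Gamma_re {s : ℂ} (hs : 0 < s.re) : ‖Complex.Gamma s‖ ≤ Real.Gamma s.re := by
  rw [Complex.Gamma_eq_integral hs, Real.Gamma_eq_integral hs, Complex.GammaIntegral]
  refine (norm_integral_le_integral_norm _).trans (le_of_eq ?_)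
  refine setIntegral_congr_fun measurableSet_Ioi fun x hx => ?_
  have hx' : 0 < x := hx
  simp only [norm_mul]
  rw [Complex.norm_cpow_eq_rpow_re_of_pos hx', Complex.norm_real, Real.norm_eq_abs,
    abs_of_pos (Real.exp_pos _)]
  simp

theorem exists_Gamma_le {a b : ℝ} (ha : 0 < a) :
    ∃ C : ℝ, ∀ x ∈ Set.Icc a b, Real.Gamma x ≤ C := by
  have hc : ContinuousOn Real.Gamma (Set.Icc a b) := fun x hx =>
    (Real.differentiableAt_Gamma fun m h => by
      have : (0 : ℝ) ≤ m := by positivity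
      linarith [hx.1]).continuousAt.continuousWithinAt
  obtain ⟨C, hC⟩ := isCompact_Icc.exists_bound_of_continuousOn hc
  exact ⟨C, fun x hx => (le_abs_self _).trans (hC x hx)⟩

theorem norm_sin_le_exp (z : ℂ) : ‖Complex.sin z‖ ≤ Real.exp |z.im| := by
  rw [Complex.sin, norm_div, norm_mul, Complex.norm_I, mul_one, Complex.norm_two]
  have h1 : ‖Complex.exp (-z * Complex.I)‖ ≤ Real.exp |z.im| := by
    rw [Complex.norm_exp]
    exact Real.exp_le_exp.mpr (by simpa using le_abs_self z.im)
  have h2 : ‖Complex.exp (z * Complex.I)‖ ≤ Real.exp |z.im| := by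
    rw [Complex.norm_exp]
    exact Real.exp_le_exp.mpr (by simpa using neg_le_abs z.im)
  have := norm_sub_le (Complex.exp (-z * Complex.I)) (Complex.exp (z * Complex.I))
  linarith

/-- The reflection formula `1/Γ(z) = Γ(1-z) sin(πz)/π` settles `|Re z| ≤ 1/2`. The recursion `Γ(z) =
(z-1)Γ(z-1)`, with `|z-1| ≥ |Im z| ≥ 1`, then moves one unit to the right at no cost. -/
theorem exists_norm_inv_Gamma_le_of_one_le_im (n : ℕ) : ∃ C : ℝ, ∀ z : ℂ,
    z.re ∈ Set.Icc (-1 / 2 : ℝ) (n + 1 / 2) → 1 ≤ |z.im| →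
      ‖(Complex.Gamma z)⁻¹‖ ≤ C * Real.exp (Real.pi * |z.im|) := by
  induction n with
  | zero =>
    obtain ⟨C, hC⟩ := exists_Gamma_le (a := 1 / 2) (b := 3 / 2) (by norm_num)
    refine ⟨C / Real.pi, fun z hz hz' => ?_⟩
    simp only [CharP.cast_eq_zero, zero_add] at hz
    have h1 := Complex.Gamma_mul_Gamma_one_sub z
    have h2 : Complex.Gamma (1 - z) ≠ 0 := Complex.Gamma_ne_zero_of_re_pos (by
      rw [Complex.sub_re, Complex.one_re]; linarith [hz.2])
    have h3 : (Complex.Gamma z)⁻¹ = Complex.Gamma (1 - z) * Complex.sin (Real.pi * z) / Real.pi := by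
      rw [← inv_inj, inv_inv, inv_div, mul_comm (Complex.Gamma (1 - z)), ← div_div, ← h1,
        mul_div_cancel_right₀ _ h2]
    have h4 := norm_Gamma_le_Gamma_re (s := 1 - z) (by
      rw [Complex.sub_re, Complex.one_re]; linarith [hz.2])
    have h5 := hC (1 - z).re (by
      rw [Complex.sub_re, Complex.one_re]; constructor <;> linarith [hz.1, hz.2])
    have h6 := norm_sin_le_exp (Real.pi * z)
    rw [Complex.im_ofReal_mul, abs_mul, abs_of_pos Real.pi_pos] at h6
    rw [h3, norm_div, norm_mul, Complex.norm_real, Real.norm_eq_abs, abs_of_pos Real.pi_pos,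
      div_mul_eq_mul_div]
    have h7 : 0 ≤ C := (norm_nonneg _).trans (h4.trans h5)
    gcongr
    exact h4.trans h5
  | succ n ih =>
    obtain ⟨C, hC⟩ := ih
    refine ⟨C, fun z hz hz' => ?_⟩
    push_cast at hz
    rcases le_total z.re (n + 1 / 2) with h | h
    · exact hC z ⟨hz.1, h⟩ hz'
    · have hne : z - 1 ≠ 0 := fun h0 => by
        have : z.im = 0 := by simpa using congrArg Complex.im h0
        rw [this] at hz'
        norm_num at hz'
      have h1 := Complex.Gamma_add_one (z - 1) hne
      rw [sub_add_cancel] at h1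
      have h2 := hC (z - 1) (by
        have : (0 : ℝ) ≤ n := by positivity
        rw [Complex.sub_re, Complex.one_re]; constructor <;> linarith [hz.1, hz.2]) (by simpa)
      simp only [Complex.sub_im, Complex.one_im, sub_zero] at h2
      rw [h1, mul_inv, norm_mul]
      have h3 : ‖(z - 1)⁻¹‖ ≤ 1 := by
        rw [norm_inv]
        refine inv_le_one_of_one_le₀ (hz'.trans ?_)
        simpa using Complex.abs_im_le_norm (z - 1)
      calc _ ≤ 1 * ‖(Complex.Gamma (z - 1))⁻¹‖ := by gcongr
        _ ≤ _ := by rwa [one_mul]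

/-- The remaining region `|Im z| ≤ 1` is compact and `1/Γ` is entire. -/
theorem exists_norm_inv_Gamma_le (n : ℕ) : ∃ C : ℝ, 0 < C ∧ ∀ z : ℂ,
    z.re ∈ Set.Icc (-1 / 2 : ℝ) (n + 1 / 2) →
      ‖(Complex.Gamma z)⁻¹‖ ≤ Real.exp (C * (1 + |z.im|)) := by
  obtain ⟨C₁, hC₁⟩ := exists_norm_inv_Gamma_le_of_one_le_im n
  have hcont : Continuous fun z : ℂ => (Complex.Gamma z)⁻¹ :=
    Complex.differentiable_one_div_Gamma.continuous
  obtain ⟨C₂, hC₂⟩ := ((isCompact_Icc (a := (-1 / 2 : ℝ)) (b := n + 1 / 2)).reProdIm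
    (isCompact_Icc (a := (-1 : ℝ)) (b := 1))).exists_bound_of_continuousOn hcont.continuousOn
  set C := max (max C₁ C₂) Real.pi
  have hCpi : Real.pi ≤ C := le_max_right _ _
  have hC1 : C₁ ≤ C := (le_max_left _ _).trans (le_max_left _ _)
  have hC2 : C₂ ≤ C := (le_max_right _ _).trans (le_max_left _ _)
  have hCexp : C ≤ Real.exp C := by linarith [Real.add_one_le_exp C]
  have hCpos : 0 < C := Real.pi_pos.trans_le hCpi
  refine ⟨C, hCpos, fun z hz => ?_⟩
  rcases le_total 1 |z.im| with h | h
  · calc _ ≤ C₁ * Real.exp (Real.pi * |z.im|) := hC₁ z hz h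
      _ ≤ Real.exp C * Real.exp (C * |z.im|) := by gcongr; linarith
      _ = _ := by rw [← Real.exp_add]; ring_nf
  · calc _ ≤ C₂ := hC₂ z ⟨hz, abs_le.mp h⟩
      _ ≤ Real.exp C := by linarith
      _ ≤ _ := Real.exp_le_exp.mpr (le_mul_of_one_le_right hCpos.le (by
        linarith [abs_nonneg z.im]))

theorem exists_norm_inv_Gammaℝ_le : ∃ C : ℝ, 0 < C ∧ ∀ s : ℂ, s.re ∈ Set.Icc (-1 : ℝ) 4 →
    ‖(Complex.Gammaℝ s)⁻¹‖ ≤ Real.exp (C * (1 + |s.im|)) := by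
  obtain ⟨C, hC0, hC⟩ := exists_norm_inv_Gamma_le 2
  refine ⟨2 * Real.log Real.pi + C, ?_, fun s hs => ?_⟩
  · have := Real.log_nonneg (by linarith [Real.pi_gt_three] : (1 : ℝ) ≤ Real.pi)
    linarith
  have hlog := Real.log_nonneg (by linarith [Real.pi_gt_three] : (1 : ℝ) ≤ Real.pi)
  have h1 := hC (s / 2) (by
    simp only [Complex.div_ofNat_re]
    push_cast
    constructor <;> linarith [hs.1, hs.2])
  simp only [Complex.div_ofNat_im, abs_div, Nat.abs_ofNat] at h1
  rw [Complex.Gammaℝ, mul_inv, norm_mul, norm_inv, Complex.norm_cpow_eq_rpow_re_of_pos Real.pi_pos]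
  have h2 : (Real.pi ^ (-s / 2 : ℂ).re)⁻¹ ≤ Real.exp (2 * Real.log Real.pi) := by
    rw [← Real.rpow_neg Real.pi_pos.le, Real.rpow_def_of_pos Real.pi_pos]
    refine Real.exp_le_exp.mpr ?_
    simp only [Complex.div_ofNat_re, Complex.neg_re]
    nlinarith [hs.2]
  calc _ ≤ Real.exp (2 * Real.log Real.pi) * Real.exp (C * (1 + |s.im| / 2)) := by gcongr
    _ = Real.exp (2 * Real.log Real.pi + C * (1 + |s.im| / 2)) := by rw [Real.exp_add]
    _ ≤ _ := Real.exp_le_exp.mpr (by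
      have h3 := mul_nonneg hlog (abs_nonneg s.im)
      have h4 := mul_nonneg hC0.le (abs_nonneg s.im)
      nlinarith)

theorem exists_norm_Gammaℝ_le : ∃ C : ℝ, 0 < C ∧ ∀ s : ℂ, s.re ∈ Set.Icc (1 / 2 : ℝ) 3 →
    ‖Complex.Gammaℝ s‖ ≤ Real.exp C := by
  obtain ⟨C, hC⟩ := exists_Gamma_le (a := 1 / 4) (b := 3 / 2) (by norm_num)
  refine ⟨max C 1, by positivity, fun s hs => ?_⟩
  have hre : (s / 2).re ∈ Set.Icc (1 / 4 : ℝ) (3 / 2) := by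
    simp only [Complex.div_ofNat_re]; constructor <;> linarith [hs.1, hs.2]
  rw [Complex.Gammaℝ, norm_mul, Complex.norm_cpow_eq_rpow_re_of_pos Real.pi_pos]
  have h1 := (norm_Gamma_le_Gamma_re (s := s / 2) (by linarith [hre.1])).trans (hC _ hre)
  have h2 : Real.pi ^ (-s / 2 : ℂ).re ≤ 1 :=
    Real.rpow_le_one_of_one_le_of_nonpos (by linarith [Real.pi_gt_three]) (by
      simp only [Complex.div_ofNat_re, Complex.neg_re]; linarith [hs.1])
  calc _ ≤ 1 * C := by gcongr
    _ ≤ Real.exp (max C 1) := by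
      linarith [Real.add_one_le_exp (max C 1), le_max_left C 1]

/-- The logarithmic derivative of the archimedean factor grows at most linearly. -/
theorem exists_norm_logDeriv_Gammaℝ_le : ∃ C : ℝ, 0 < C ∧ ∀ s : ℂ,
    s.re ∈ Set.Icc (1 / 2 : ℝ) 3 → ‖logDeriv Complex.Gammaℝ s‖ ≤ C * (1 + |s.im|) := by
  obtain ⟨C₁, hC₁0, hC₁⟩ := exists_norm_inv_Gammaℝ_le
  obtain ⟨C₂, hC₂0, hC₂⟩ := exists_norm_Gammaℝ_le
  refine ⟨48 * (2 * C₁ + C₂), by positivity, fun s hs => ?_⟩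
  -- `1/Γ_ℝ` is entire and has no zeros in `Re s > 0`, which contains the open disc of radius `1/2`
  -- about `s`; hence `norm_logDeriv_le_of_ne_zero` applies to it.
  set g : ℂ → ℂ := fun s => (Complex.Gammaℝ s)⁻¹
  have hinv : logDeriv Complex.Gammaℝ s = -logDeriv g s := by
    have : Complex.Gammaℝ = fun s => 1 / g s := by funext s; simp [g]
    have hne := Complex.Gammaℝ_ne_zero_of_re_pos (s := s) (by linarith [hs.1])
    rw [this, logDeriv_div (f := fun _ => 1) (g := g) s one_ne_zero (inv_ne_zero hne) (by fun_prop)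
      Complex.differentiable_Gammaℝ_inv.differentiableAt]
    simp
  have hball : ∀ z ∈ Metric.ball s (1 / 2), |z.re - s.re| < 1 / 2 ∧ |z.im - s.im| < 1 / 2 := by
    intro z hz
    have h1 : ‖z - s‖ < 1 / 2 := by simpa [dist_eq_norm] using hz
    rw [← Complex.sub_re, ← Complex.sub_im]
    exact ⟨(Complex.abs_re_le_norm _).trans_lt h1, (Complex.abs_im_le_norm _).trans_lt h1⟩
  rw [hinv, norm_neg]
  have ht := abs_nonneg s.im
  have := norm_logDeriv_le_of_ne_zero (g := g) Complex.differentiable_Gammaℝ_inv (c := s)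
    (R := 1 / 2) (B := (2 * C₁ + C₂) * (1 + |s.im|)) (by norm_num) (by positivity)
    (fun z hz => inv_ne_zero (Complex.Gammaℝ_ne_zero_of_re_pos (by
      have := (abs_lt.mp (hball z hz).1).1
      linarith [hs.1]))) (fun z hz => by
      obtain ⟨h1, h2⟩ := hball z hz
      rw [abs_lt] at h1
      have h3 := hC₁ z (by constructor <;> linarith [hs.1, hs.2])
      have h4 := hC₂ s hs
      have h5 : 1 ≤ ‖g s‖ * Real.exp C₂ := by
        have hne := Complex.Gammaℝ_ne_zero_of_re_pos (s := s) (by linarith [hs.1])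
        simp only [g, norm_inv]
        rw [inv_mul_eq_div, one_le_div (norm_pos_iff.mpr hne)]
        exact h4
      have h6 : |z.im| ≤ |s.im| + 1 := by
        have := abs_sub_abs_le_abs_sub z.im s.im
        linarith
      calc ‖g z‖ ≤ Real.exp (C₁ * (1 + |z.im|)) := h3
        _ ≤ (‖g s‖ * Real.exp C₂) * Real.exp (C₁ * (2 + |s.im|)) := by
          refine le_trans ?_ (le_mul_of_one_le_left (Real.exp_pos _).le h5)
          exact Real.exp_le_exp.mpr (mul_le_mul_of_nonneg_left (by linarith) hC₁0.le)
        _ = ‖g s‖ * Real.exp (C₂ + C₁ * (2 + |s.im|)) := by rw [mul_assoc, Real.exp_add]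
        _ ≤ _ := by
          gcongr
          have h7 := mul_nonneg hC₁0.le ht
          have h8 := mul_nonneg hC₂0.le ht
          nlinarith) (z := s) (Metric.mem_closedBall_self (by norm_num))
  refine this.trans (le_of_eq ?_)
  ring

end OneLevel

/-! ### Completed Dirichlet L-functions -/

namespace OneLevel

/-- A function that is bounded on every closed vertical strip. -/
def BoundedOnStrips (g : ℂ → ℂ) : Prop :=
  ∀ a b : ℝ, ∃ C : ℝ, 0 ≤ C ∧ ∀ s : ℂ, s.re ∈ Set.Icc a b → ‖g s‖ ≤ C

namespace BoundedOnStrips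

theorem const (c : ℂ) : BoundedOnStrips fun _ => c := fun _ _ => ⟨‖c‖, norm_nonneg c, fun _ _ => le_rfl⟩

theorem add {g h : ℂ → ℂ} (hg : BoundedOnStrips g) (hh : BoundedOnStrips h) :
    BoundedOnStrips fun s => g s + h s := fun a b => by
  obtain ⟨C, hC, h1⟩ := hg a b
  obtain ⟨D, hD, h2⟩ := hh a b
  exact ⟨C + D, by positivity, fun s hs =>
    (norm_add_le _ _).trans (add_le_add (h1 s hs) (h2 s hs))⟩

theorem mul {g h : ℂ → ℂ} (hg : BoundedOnStrips g) (hh : BoundedOnStrips h) :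
    BoundedOnStrips fun s => g s * h s := fun a b => by
  obtain ⟨C, hC, h1⟩ := hg a b
  obtain ⟨D, hD, h2⟩ := hh a b
  exact ⟨C * D, by positivity, fun s hs => by
    rw [norm_mul]; exact mul_le_mul (h1 s hs) (h2 s hs) (norm_nonneg _) hC⟩

theorem sum {ι : Type*} {t : Finset ι} {g : ι → ℂ → ℂ} (hg : ∀ i ∈ t, BoundedOnStrips (g i)) :
    BoundedOnStrips fun s => ∑ i ∈ t, g i s := by
  classical
  induction t using Finset.induction_on with
  | empty => simpa using const 0
  | insert j t hj ih =>
    simp only [Finset.sum_insert hj]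
    exact (hg j (Finset.mem_insert_self _ _)).add
      (ih fun i hi => hg i (Finset.mem_insert_of_mem hi))

theorem natCast_cpow_neg (N : ℕ) [NeZero N] : BoundedOnStrips fun s => (N : ℂ) ^ (-s) := fun a b => by
  have hN : (1 : ℝ) ≤ N := by exact_mod_cast NeZero.one_le
  refine ⟨(N : ℝ) ^ (-a), by positivity, fun s hs => ?_⟩
  rw [Complex.norm_natCast_cpow_of_pos (NeZero.pos N), Complex.neg_re]
  exact Real.rpow_le_rpow_of_exponent_le hN (by linarith [hs.1])

/-- For `a ≤ Re s ≤ b`, `t^(Re s - 1)` is at most `t^(a-1) + t^(b-1)`, whichever side of `1` the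
point `t` is on. -/
theorem mellin {f : ℝ → ℂ} (hf : ∀ s, MellinConvergent f s) : BoundedOnStrips (mellin f) := by
  intro a b
  have hint : ∀ c : ℝ, IntegrableOn (fun t : ℝ => t ^ (c - 1) * ‖f t‖) (Set.Ioi 0) := fun c => by
    have := (hf (c : ℂ)).norm
    refine IntegrableOn.congr_fun this (fun t ht => ?_) measurableSet_Ioi
    have ht' : 0 < t := ht
    simp only [norm_smul]
    rw [Complex.norm_cpow_eq_rpow_re_of_pos ht']
    simp
  refine ⟨∫ t in Set.Ioi (0 : ℝ), (t ^ (a - 1) * ‖f t‖ + t ^ (b - 1) * ‖f t‖),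
    setIntegral_nonneg measurableSet_Ioi fun t ht => ?_, fun s hs => ?_⟩
  · have ht' : 0 < t := ht
    positivity
  · unfold _root_.mellin
    refine norm_integral_le_of_norm_le ((hint a).add (hint b))
      ((ae_restrict_iff' measurableSet_Ioi).mpr (ae_of_all _ fun t ht => ?_))
    have ht' : 0 < t := ht
    rw [norm_smul, Complex.norm_cpow_eq_rpow_re_of_pos ht', Complex.sub_re, Complex.one_re,
      ← add_mul]
    refine mul_le_mul_of_nonneg_right ?_ (norm_nonneg _)
    rcases le_total 1 t with h | h
    · exact (Real.rpow_le_rpow_of_exponent_le h (by linarith [hs.2])).trans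
        (le_add_of_nonneg_left (by positivity))
    · exact (Real.rpow_le_rpow_of_exponent_ge ht' h (by linarith [hs.1])).trans
        (le_add_of_nonneg_right (by positivity))

theorem comp_affine {g : ℂ → ℂ} (hg : BoundedOnStrips g) (c : ℝ) :
    BoundedOnStrips fun s => g ((s + c) / 2) := fun a b => by
  obtain ⟨C, hC, h⟩ := hg ((a + c) / 2) ((b + c) / 2)
  refine ⟨C, hC, fun s hs => h _ ?_⟩
  simp only [Complex.div_ofNat_re, Complex.add_re, Complex.ofReal_re]
  constructor <;> linarith [hs.1, hs.2]

end BoundedOnStrips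

/-- With the polar part removed, this is half the Mellin transform at `s/2` of a kernel whose
integral converges for every `s`. In the odd case no removal is needed. -/
theorem boundedOnStrips_completedHurwitzZetaEven₀ (a : UnitAddCircle) :
    BoundedOnStrips (HurwitzZeta.completedHurwitzZetaEven₀ a) := by
  have h := (BoundedOnStrips.mellin (f := (HurwitzZeta.hurwitzEvenFEPair a).f_modif) fun s =>
    ((HurwitzZeta.hurwitzEvenFEPair a).isStrongFEPair_toStrongFEPair.hasMellin s).1).comp_affine 0
  have h2 := h.mul (BoundedOnStrips.const (1 / 2))
  convert h2 using 2 with s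
  simp only [Complex.ofReal_zero, add_zero, HurwitzZeta.completedHurwitzZetaEven₀,
    WeakFEPair.Λ₀]
  ring

theorem boundedOnStrips_completedHurwitzZetaOdd (a : UnitAddCircle) :
    BoundedOnStrips (HurwitzZeta.completedHurwitzZetaOdd a) := by
  have hs := HurwitzZeta.isStrong_hurwitzOddFEPair a
  have h := (BoundedOnStrips.mellin (f := (HurwitzZeta.hurwitzOddFEPair a).f) fun s =>
    (hs.hasMellin s).1).comp_affine 1
  have h2 := h.mul (BoundedOnStrips.const (1 / 2))
  convert h2 using 2 with s
  simp only [Complex.ofReal_one, HurwitzZeta.completedHurwitzZetaOdd, hs.Λ_eq]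
  ring

/-- `χ` and `χ⁻¹` have the same parity, so one shift `a` serves both. -/
theorem exists_gammaFactor_eq {m : ℕ} (χ : DirichletCharacter ℂ m) : ∃ a : ℝ, (a = 0 ∨ a = 1) ∧
    (∀ s, DirichletCharacter.gammaFactor χ s = Complex.Gammaℝ (s + a)) ∧
    ∀ s, DirichletCharacter.gammaFactor χ⁻¹ s = Complex.Gammaℝ (s + a) := by
  have hinv : χ⁻¹ (-1) = (χ (-1))⁻¹ := by
    exact MulChar.inv_apply_eq_inv' χ (-1)
  rcases χ.even_or_odd with h | h
  · have h' : χ⁻¹.Even := by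
      unfold DirichletCharacter.Even at h ⊢
      rw [hinv, h, inv_one]
    exact ⟨0, .inl rfl, fun s => by rw [h.gammaFactor_def]; simp,
      fun s => by rw [h'.gammaFactor_def]; simp⟩
  · have h' : χ⁻¹.Odd := by
      unfold DirichletCharacter.Odd at h ⊢
      rw [hinv, h]; norm_num
    exact ⟨1, .inr rfl, fun s => by rw [h.gammaFactor_def]; simp,
      fun s => by rw [h'.gammaFactor_def]; simp⟩

theorem gammaFactor_ne_zero {m : ℕ} (χ : DirichletCharacter ℂ m) {s : ℂ} (hs : 0 < s.re) :
    DirichletCharacter.gammaFactor χ s ≠ 0 := by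
  obtain ⟨a, ha, h, -⟩ := exists_gammaFactor_eq χ
  rw [h]
  refine Complex.Gammaℝ_ne_zero_of_re_pos ?_
  rw [Complex.add_re, Complex.ofReal_re]
  rcases ha with rfl | rfl <;> linarith

variable {m : ℕ} [NeZero m]

theorem level_ne_one {χ : DirichletCharacter ℂ m} (hχ : χ ≠ 1) : m ≠ 1 := by
  rintro rfl
  exact hχ (DirichletCharacter.level_one χ)

/-- Both polar terms vanish, as `χ 0 = 0` and `∑ χ = 0`; a finite combination of bounded Hurwitz
functions remains. -/
theorem boundedOnStrips_completedLFunction {χ : DirichletCharacter ℂ m} (hχ : χ ≠ 1) :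
    BoundedOnStrips (DirichletCharacter.completedLFunction χ) := by
  have hfun : DirichletCharacter.completedLFunction χ =
      ZMod.completedLFunction₀ (χ : ZMod m → ℂ) := by
    funext s
    rw [DirichletCharacter.completedLFunction, ZMod.completedLFunction_eq,
      χ.map_zero' (level_ne_one hχ), MulChar.sum_eq_zero_of_ne_one hχ]
    simp
  rw [hfun]
  unfold ZMod.completedLFunction₀
  have hN := BoundedOnStrips.natCast_cpow_neg m
  refine (hN.mul (.sum fun j _ => (BoundedOnStrips.const _).mul ?_)).add
    (hN.mul (.sum fun j _ => (BoundedOnStrips.const _).mul ?_))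
  · exact boundedOnStrips_completedHurwitzZetaEven₀ _
  · exact boundedOnStrips_completedHurwitzZetaOdd _

theorem completedLFunction_eq_mul {χ : DirichletCharacter ℂ m} (hχ : χ ≠ 1) {s : ℂ}
    (hs : 0 < s.re) : DirichletCharacter.completedLFunction χ s =
      DirichletCharacter.gammaFactor χ s * DirichletCharacter.LFunction χ s := by
  rw [DirichletCharacter.LFunction_eq_completed_div_gammaFactor χ s (.inr (level_ne_one hχ)),
    mul_div_cancel₀ _ (gammaFactor_ne_zero χ hs)]

theorem completedLFunction_ne_zero_of_one_le_re {χ : DirichletCharacter ℂ m} (hχ : χ ≠ 1) {s : ℂ}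
    (hs : 1 ≤ s.re) : DirichletCharacter.completedLFunction χ s ≠ 0 := by
  rw [completedLFunction_eq_mul hχ (by linarith)]
  exact mul_ne_zero (gammaFactor_ne_zero χ (by linarith))
    (DirichletCharacter.LFunction_ne_zero_of_one_le_re χ (.inl hχ) hs)

/-- The functional equation at `-1` makes `Λ(2, χ) ≠ 0` a multiple of the root number, so no Gauss
sum has to be evaluated. -/
theorem rootNumber_ne_zero {χ : DirichletCharacter ℂ m} (hχ : χ ≠ 1) (hp : χ.IsPrimitive) :
    DirichletCharacter.rootNumber χ ≠ 0 := fun h0 => by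
  have h := hp.completedLFunction_one_sub (-1)
  rw [h0, mul_zero, zero_mul] at h
  exact completedLFunction_ne_zero_of_one_le_re hχ (by norm_num) h

/-- Nonvanishing on `Re s ≥ 1` is carried to `Re s ≤ 0` by the functional equation. -/
theorem completedLFunction_zero_mem_strip {χ : DirichletCharacter ℂ m} (hχ : χ ≠ 1)
    (hp : χ.IsPrimitive) {s : ℂ} (hs : DirichletCharacter.completedLFunction χ s = 0) :
    0 < s.re ∧ s.re < 1 := by
  constructor
  · by_contra! hcon
    have h := hp.completedLFunction_one_sub (1 - s)
    rw [sub_sub_cancel, hs] at h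
    refine mul_ne_zero (mul_ne_zero ?_ (rootNumber_ne_zero hχ hp))
      (completedLFunction_ne_zero_of_one_le_re (inv_ne_one.mpr hχ) (s := 1 - s) ?_) h.symm
    · rw [Complex.cpow_ne_zero_iff]
      exact .inl (NeZero.ne _)
    · rw [Complex.sub_re, Complex.one_re]; linarith
  · by_contra! hcon
    exact completedLFunction_ne_zero_of_one_le_re hχ hcon hs

-- `1/L(s, χ)` is the series with coefficients `χ(n)μ(n)`, whose absolute values on `Re s = 2` do
-- not depend on the height.
open LSeries.notation ArithmeticFunction in
theorem exists_le_norm_LFunction (χ : DirichletCharacter ℂ m) : ∃ d : ℝ, 0 < d ∧ ∀ T : ℝ,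
    d ≤ ‖DirichletCharacter.LFunction χ (2 + T * Complex.I)‖ := by
  set g : ℕ → ℂ := ↗χ * ↗ArithmeticFunction.moebius with hg
  have hterm : ∀ (T : ℝ) (n : ℕ),
      ‖LSeries.term g (2 + T * Complex.I) n‖ = ‖LSeries.term g 2 n‖ := fun T n => by
    rw [LSeries.norm_term_eq, LSeries.norm_term_eq]
    simp
  set D := ∑' n, ‖LSeries.term g 2 n‖ with hD
  have key : ∀ T : ℝ, 1 ≤ ‖DirichletCharacter.LFunction χ (2 + T * Complex.I)‖ * D := fun T => by
    have hs : 1 < (2 + T * Complex.I : ℂ).re := by simp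
    have h1 := DirichletCharacter.LSeries.mul_mu_eq_one χ hs
    rw [← DirichletCharacter.LFunction_eq_LSeries χ hs] at h1
    have hsum : LSeriesSummable g (2 + T * Complex.I) :=
      DirichletCharacter.LSeriesSummable_mul χ (LSeriesSummable_moebius_iff.mpr hs)
    have h2 : ‖L g (2 + T * Complex.I)‖ ≤ D := by
      rw [hD, ← funext (hterm T)]
      exact norm_tsum_le_tsum_norm hsum.norm
    have h3 := congrArg norm h1
    rw [norm_mul, norm_one] at h3
    rw [← h3]
    exact mul_le_mul_of_nonneg_left h2 (norm_nonneg _)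
  have hDpos : 0 < D := by
    by_contra! hcon
    have := mul_nonpos_of_nonneg_of_nonpos (norm_nonneg (DirichletCharacter.LFunction χ
      (2 + (0 : ℝ) * Complex.I))) hcon
    linarith [key 0]
  exact ⟨D⁻¹, inv_pos.mpr hDpos, fun T => by
    rw [inv_le_iff_one_le_mul₀ hDpos]; exact key T⟩

/-- `Λ` is bounded on `-30 ≤ Re z ≤ 34`, while at `2 + iT` both `L` and the gamma factor are bounded
below, the latter by `exp(-C(1+|T|))`. `A` may depend on `χ`, since it serves only convergence. -/
theorem exists_stripGrowth {χ : DirichletCharacter ℂ m} (hχ : χ ≠ 1) (hp : χ.IsPrimitive) :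
    ∃ A, StripGrowth (DirichletCharacter.completedLFunction χ) A := by
  obtain ⟨M, hM0, hM⟩ := boundedOnStrips_completedLFunction hχ (-30) 34
  obtain ⟨d, hd0, hd⟩ := exists_le_norm_LFunction χ
  obtain ⟨C, hC0, hC⟩ := exists_norm_inv_Gammaℝ_le
  obtain ⟨a, ha, hγ, -⟩ := exists_gammaFactor_eq χ
  have hE : 0 ≤ M / d := by positivity
  refine ⟨C + M / d + 1, DirichletCharacter.differentiable_completedLFunction hχ, by linarith,
    fun z hz => completedLFunction_zero_mem_strip hχ hp hz, fun T z hz => ?_⟩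
  have hre : (2 + T * Complex.I : ℂ).re = 2 := by simp
  have him : (2 + T * Complex.I : ℂ).im = T := by simp
  have hz' : ‖z - (2 + T * Complex.I)‖ ≤ 32 := by simpa [dist_eq_norm] using hz
  have h1 : |z.re - 2| ≤ 32 := by
    have := (Complex.abs_re_le_norm _).trans hz'
    rwa [Complex.sub_re, hre] at this
  have h2 := hM z (by constructor <;> linarith [(abs_le.mp h1).1, (abs_le.mp h1).2])
  have h3 : 1 ≤ ‖DirichletCharacter.gammaFactor χ (2 + T * Complex.I)‖ *
      Real.exp (C * (1 + |T|)) := by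
    have h4 := hC (2 + T * Complex.I + a) (by
      rw [Complex.add_re, hre, Complex.ofReal_re]
      rcases ha with rfl | rfl <;> norm_num)
    have hne := gammaFactor_ne_zero χ (s := 2 + T * Complex.I) (by rw [hre]; norm_num)
    rw [Complex.add_im, him, Complex.ofReal_im, add_zero, ← hγ, norm_inv] at h4
    rwa [inv_le_iff_one_le_mul₀ (norm_pos_iff.mpr hne), mul_comm] at h4
  have h5 : M ≤ d * Real.exp (M / d) := by
    have h6 := Real.add_one_le_exp (M / d)
    calc M = d * (M / d) := by field_simp
      _ ≤ _ := mul_le_mul_of_nonneg_left (by linarith) hd0.le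
  rw [completedLFunction_eq_mul hχ (s := 2 + T * Complex.I) (by rw [hre]; norm_num), norm_mul]
  have hT := abs_nonneg T
  calc _ ≤ M := h2
    _ ≤ d * Real.exp (M / d) := h5
    _ ≤ ‖DirichletCharacter.LFunction χ (2 + T * Complex.I)‖ * Real.exp (M / d) := by
        gcongr; exact hd T
    _ ≤ (‖DirichletCharacter.gammaFactor χ (2 + T * Complex.I)‖ * Real.exp (C * (1 + |T|))) *
        (‖DirichletCharacter.LFunction χ (2 + T * Complex.I)‖ * Real.exp (M / d)) :=
      le_mul_of_one_le_left (by positivity) h3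
    _ = ‖DirichletCharacter.gammaFactor χ (2 + T * Complex.I)‖ *
        ‖DirichletCharacter.LFunction χ (2 + T * Complex.I)‖ *
          Real.exp (C * (1 + |T|) + M / d) := by rw [Real.exp_add]; ring
    _ ≤ _ := by
      gcongr
      nlinarith [mul_nonneg hE hT]

theorem mem_nontrivialZeros_iff {χ : DirichletCharacter ℂ m} (hχ : χ ≠ 1) (hp : χ.IsPrimitive)
    (z : ℂ) : z ∈ nontrivialZeros χ ↔ DirichletCharacter.completedLFunction χ z = 0 := by
  constructor
  · rintro ⟨h0, -, h⟩
    rw [completedLFunction_eq_mul hχ h0, h, mul_zero]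
  · intro h
    obtain ⟨h0, h1⟩ := completedLFunction_zero_mem_strip hχ hp h
    rw [completedLFunction_eq_mul hχ h0] at h
    exact ⟨h0, h1, (mul_eq_zero.mp h).resolve_left (gammaFactor_ne_zero χ h0)⟩

/-- The reciprocal gamma factor is entire and nonzero at `z`. -/
theorem analyticOrderNatAt_LFunction {χ : DirichletCharacter ℂ m} (hχ : χ ≠ 1) {z : ℂ}
    (hz : 0 < z.re) : analyticOrderNatAt χ.LFunction z =
      analyticOrderNatAt (DirichletCharacter.completedLFunction χ) z := by
  obtain ⟨a, ha, hγ, -⟩ := exists_gammaFactor_eq χ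
  have hfun : χ.LFunction = DirichletCharacter.completedLFunction χ *
      fun s => (Complex.Gammaℝ (s + a))⁻¹ := by
    funext s
    rw [DirichletCharacter.LFunction_eq_completed_div_gammaFactor χ s (.inr (level_ne_one hχ)),
      Pi.mul_apply, hγ, div_eq_mul_inv]
  have hd : Differentiable ℂ fun s : ℂ => (Complex.Gammaℝ (s + a))⁻¹ :=
    Complex.differentiable_Gammaℝ_inv.comp (by fun_prop)
  have hne : (Complex.Gammaℝ (z + a))⁻¹ ≠ 0 := by
    rw [← hγ]
    exact inv_ne_zero (gammaFactor_ne_zero χ hz)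
  rw [analyticOrderNatAt, hfun, analyticOrderAt_mul
    ((DirichletCharacter.differentiable_completedLFunction hχ).analyticAt z) (hd.analyticAt z),
    ((hd.analyticAt z).analyticOrderAt_eq_zero).mpr hne, add_zero, analyticOrderNatAt]

theorem isPrimitive_of_prime {p : ℕ} (hp : p.Prime) [NeZero p] {χ : DirichletCharacter ℂ p}
    (hχ : χ ≠ 1) : χ.IsPrimitive := by
  rcases (Nat.dvd_prime hp).mp χ.conductor_dvd_level with h | h
  · exact absurd (DirichletCharacter.eq_one_iff_conductor_eq_one.mpr h) hχ
  · exact h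

end OneLevel

/-! ### The contour identity for one character -/

namespace OneLevel

section ExplicitFormula

theorem integrable_vertical_zeroWeight {φ : 𝓢(ℝ, ℂ)} {R L : ℝ}
    (h : ∀ ξ, R < |ξ| → (𝓕 φ) ξ = 0) (hL : L ≠ 0) :
    Integrable fun t : ℝ => zeroWeight φ L (2 + t * Complex.I) := by
  obtain ⟨C, hC⟩ := exists_norm_zeroWeight_le h hL
  have hHd := differentiable_zeroWeight h L
  have hC0 : 0 ≤ C := by
    have := (norm_nonneg _).trans (hC 0 (by norm_num))
    simpa using this
  refine integrable_of_norm_le_div_one_add_sq (C := C)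
    (hHd.continuous.comp (by fun_prop)) fun t => (hC _ (by norm_num)).trans ?_
  have ht : 1 ≤ 1 + |t| := by linarith [abs_nonneg t]
  simp only [Complex.add_im, Complex.mul_im, Complex.ofReal_re, Complex.I_im, mul_one,
    Complex.ofReal_im, Complex.I_re, mul_zero, add_zero, Complex.im_ofNat, zero_add]
  gcongr
  norm_num

variable {m : ℕ} [NeZero m]

/-- Logarithmic derivative of the functional equation; the power `m^(s-1/2)` produces `log m`. -/
theorem logDeriv_completedLFunction_one_sub {χ : DirichletCharacter ℂ m} (hχ : χ ≠ 1)
    (hp : χ.IsPrimitive) {s : ℂ} (hs : 1 ≤ s.re) :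
    logDeriv (DirichletCharacter.completedLFunction χ) (1 - s) =
      -(Real.log m + logDeriv (DirichletCharacter.completedLFunction χ⁻¹) s) := by
  have hχ' : χ⁻¹ ≠ 1 := inv_ne_one.mpr hχ
  have hm : (m : ℂ) ≠ 0 := Nat.cast_ne_zero.mpr (NeZero.ne m)
  have hfun : DirichletCharacter.completedLFunction χ ∘ (fun s => 1 - s) = fun s : ℂ =>
      ((m : ℂ) ^ (s - 1 / 2) * DirichletCharacter.rootNumber χ) *
        DirichletCharacter.completedLFunction χ⁻¹ s := by
    funext s
    exact hp.completedLFunction_one_sub s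
  have h1 := logDeriv_comp (f := DirichletCharacter.completedLFunction χ) (g := fun s => 1 - s)
    (x := s) (DirichletCharacter.differentiable_completedLFunction hχ _) (by fun_prop)
  have hd : HasDerivAt (fun s : ℂ => (m : ℂ) ^ (s - 1 / 2) * DirichletCharacter.rootNumber χ)
      ((m : ℂ) ^ (s - 1 / 2) * Complex.log m * DirichletCharacter.rootNumber χ) s := by
    have := (((hasDerivAt_id s).sub_const (1 / 2 : ℂ)).const_cpow (c := (m : ℂ))
      (.inl hm)).mul_const (DirichletCharacter.rootNumber χ)
    simpa using this
  have hne : (m : ℂ) ^ (s - 1 / 2) ≠ 0 := by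
    simp [Complex.cpow_eq_zero_iff, hm]
  have hε := rootNumber_ne_zero hχ hp
  rw [hfun, logDeriv_mul (f := fun s : ℂ => (m : ℂ) ^ (s - 1 / 2) *
    DirichletCharacter.rootNumber χ) (g := DirichletCharacter.completedLFunction χ⁻¹) s (mul_ne_zero hne hε)
    (completedLFunction_ne_zero_of_one_le_re hχ' hs) hd.differentiableAt
    (DirichletCharacter.differentiable_completedLFunction hχ' _)] at h1
  have h2 : deriv (fun s : ℂ => 1 - s) s = -1 := by simp
  have h3 : (m : ℂ) ^ (s - 1 / 2) * Complex.log m * DirichletCharacter.rootNumber χ /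
      ((m : ℂ) ^ (s - 1 / 2) * DirichletCharacter.rootNumber χ) = Complex.log m := by
    generalize (m : ℂ) ^ (s - 1 / 2) = x at hne
    field_simp
  rw [h2, logDeriv_apply, hd.deriv, h3] at h1
  rw [Complex.ofReal_log (by positivity), Complex.ofReal_natCast]
  linear_combination h1

theorem logDeriv_completedLFunction {χ : DirichletCharacter ℂ m} (hχ : χ ≠ 1) {s : ℂ}
    (hs : 1 < s.re) : logDeriv (DirichletCharacter.completedLFunction χ) s =
      logDeriv (DirichletCharacter.gammaFactor χ) s -
        LSeries (fun n => χ n * ArithmeticFunction.vonMangoldt n) s := by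
  have hev : DirichletCharacter.completedLFunction χ =ᶠ[𝓝 s] fun s =>
      DirichletCharacter.gammaFactor χ s * DirichletCharacter.LFunction χ s := by
    filter_upwards [(isOpen_lt continuous_const Complex.continuous_re).mem_nhds
      (show (0 : ℝ) < s.re by linarith)] with z hz
    exact completedLFunction_eq_mul hχ hz
  obtain ⟨a, ha, hγ, -⟩ := exists_gammaFactor_eq χ
  have hγd : DifferentiableAt ℂ (DirichletCharacter.gammaFactor χ) s := by
    have h1 : DirichletCharacter.gammaFactor χ = fun s => ((Complex.Gammaℝ (s + a))⁻¹)⁻¹ := by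
      funext s; rw [hγ, inv_inv]
    rw [h1]
    refine DifferentiableAt.inv ((Complex.differentiable_Gammaℝ_inv.comp (f := fun s : ℂ => s + a)
      (by fun_prop)) s) ?_
    rw [← hγ]
    exact inv_ne_zero (gammaFactor_ne_zero χ (by linarith))
  have hL := DirichletCharacter.LFunction_ne_zero_of_one_le_re χ (.inl hχ) hs.le
  rw [(logDeriv_congr_nhds hev).eq_of_nhds, logDeriv_mul (f := DirichletCharacter.gammaFactor χ)
    (g := DirichletCharacter.LFunction χ) s (gammaFactor_ne_zero χ (by linarith)) hL hγd
    (DirichletCharacter.differentiable_LFunction hχ _)]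
  have h2 := DirichletCharacter.LSeries_twist_vonMangoldt_eq χ hs
  have h3 : (fun n : ℕ => χ n * (ArithmeticFunction.vonMangoldt n : ℂ)) =
    (fun n : ℕ => χ n) * (fun n : ℕ => (ArithmeticFunction.vonMangoldt n : ℂ)) := rfl
  rw [h3, h2, logDeriv_apply (DirichletCharacter.LFunction χ),
    DirichletCharacter.deriv_LFunction_eq_deriv_LSeries χ hs,
    DirichletCharacter.LFunction_eq_LSeries χ hs]
  ring

theorem summable_zeroTerm {φ : 𝓢(ℝ, ℂ)} {R : ℝ} (h : ∀ ξ, R < |ξ| → (𝓕 φ) ξ = 0)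
    {χ : DirichletCharacter ℂ m} (hχ : χ ≠ 1) (hp : χ.IsPrimitive)
    (hL : Real.log (m / Real.pi) ≠ 0) :
    Summable fun ρ : nontrivialZeros χ => zeroTerm χ φ ρ := by
  obtain ⟨A, hA⟩ := exists_stripGrowth hχ hp
  obtain ⟨C, hC⟩ := exists_norm_zeroWeight_le h hL
  refine (hA.summable hC (mem_nontrivialZeros_iff hχ hp)).congr fun ρ => ?_
  rw [zeroTerm, analyticOrderNatAt_LFunction hχ ρ.2.1, zeroWeight]

/-- The integral over `Re s = -1` is carried to `Re s = 2` by `s ↦ 1 - s`, under which the weight is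
invariant and `χ` becomes `χ⁻¹`. -/
theorem two_pi_mul_oneLevelDensity {φ : 𝓢(ℝ, ℂ)} (hφ : Function.Even φ) {R : ℝ}
    (h : ∀ ξ, R < |ξ| → (𝓕 φ) ξ = 0) {χ : DirichletCharacter ℂ m} (hχ : χ ≠ 1)
    (hp : χ.IsPrimitive) {L : ℝ} (hLm : L = Real.log (m / Real.pi)) (hL : L ≠ 0) :
    Integrable (fun t : ℝ =>
      (logDeriv (DirichletCharacter.completedLFunction χ) (2 + t * Complex.I) +
        logDeriv (DirichletCharacter.completedLFunction χ⁻¹) (2 + t * Complex.I) + Real.log m) *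
        zeroWeight φ L (2 + t * Complex.I)) ∧
    2 * Real.pi * oneLevelDensity χ φ = ∫ t : ℝ,
      (logDeriv (DirichletCharacter.completedLFunction χ) (2 + t * Complex.I) +
        logDeriv (DirichletCharacter.completedLFunction χ⁻¹) (2 + t * Complex.I) + Real.log m) *
        zeroWeight φ L (2 + t * Complex.I) := by
  have hχ' : χ⁻¹ ≠ 1 := inv_ne_one.mpr hχ
  have hp' : χ⁻¹.IsPrimitive := by
    simpa [DirichletCharacter.IsPrimitive, DirichletCharacter.conductor_inv] using hp
  obtain ⟨A, hA⟩ := exists_stripGrowth hχ hp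
  obtain ⟨A', hA'⟩ := exists_stripGrowth hχ' hp'
  obtain ⟨C, hC⟩ := exists_norm_zeroWeight_le h hL
  have hHd := differentiable_zeroWeight h L
  have hD : oneLevelDensity χ φ = ∑' ρ : nontrivialZeros χ,
      (analyticOrderNatAt (DirichletCharacter.completedLFunction χ) ρ : ℂ) *
        zeroWeight φ L ρ := by
    refine tsum_congr fun ρ => ?_
    rw [zeroTerm, analyticOrderNatAt_LFunction hχ ρ.2.1, zeroWeight, hLm]
  have h1 := hA.integrable_vertical hHd hC (.inl rfl)
  have h2 := hA'.integrable_vertical hHd hC (.inl rfl)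
  have h3 := integrable_vertical_zeroWeight h hL
  push_cast at h1 h2
  have h4 : ∫ t : ℝ, logDeriv (DirichletCharacter.completedLFunction χ) (-1 + t * Complex.I) *
      zeroWeight φ L (-1 + t * Complex.I) = ∫ t : ℝ,
      -((logDeriv (DirichletCharacter.completedLFunction χ⁻¹) (2 + t * Complex.I) + Real.log m) *
        zeroWeight φ L (2 + t * Complex.I)) := by
    rw [← integral_neg_eq_self]
    refine integral_congr_ae (.of_forall fun t => ?_)
    have h5 : (-1 + ((-t : ℝ) : ℂ) * Complex.I) = 1 - (2 + t * Complex.I) := by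
      push_cast; ring
    simp only
    rw [h5, zeroWeight_one_sub hφ, logDeriv_completedLFunction_one_sub hχ hp (by norm_num)]
    ring
  refine ⟨by simp only [add_mul]; exact (h1.add h2).add (h3.const_mul _), ?_⟩
  rw [hD, hA.tsum_zeros hHd hC (mem_nontrivialZeros_iff hχ hp), h4, integral_neg, sub_neg_eq_add, ← integral_add h1]
  · refine integral_congr_ae (.of_forall fun t => ?_)
    simp only
    ring
  · simp only [add_mul]
    exact h2.add (h3.const_mul _)

end ExplicitFormula

end OneLevel

/-! ### Moving the integrals to the critical line -/

namespace OneLevel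

section VerticalShift

variable {φ : 𝓢(ℝ, ℂ)} {R L : ℝ}

/-- Linear growth against fourth-power decay allows the line to move. On `Re s = 1/2` the weight is
`φ` at a real argument. -/
theorem integral_mul_zeroWeight (h : ∀ ξ, R < |ξ| → (𝓕 φ) ξ = 0) (hL : L ≠ 0) {F : ℂ → ℂ} {K : ℝ}
    (hF : DifferentiableOn ℂ F {z | z.re ∈ Set.Icc (1 / 2 : ℝ) 2})
    (hK : ∀ z : ℂ, z.re ∈ Set.Icc (1 / 2 : ℝ) 2 → ‖F z‖ ≤ K * (1 + |z.im|)) :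
    ∫ t : ℝ, F (2 + t * Complex.I) * zeroWeight φ L (2 + t * Complex.I) =
      ∫ t : ℝ, F (1 / 2 + t * Complex.I) * φ (t * (L / (2 * Real.pi))) := by
  obtain ⟨C, hC⟩ := exists_norm_zeroWeight_le h hL
  have hHd := differentiable_zeroWeight h L
  have h1 := integral_vertical_eq (F := fun z => F z * zeroWeight φ L z) (x₁ := 1 / 2) (x₂ := 2)
    (C := K * C) (by norm_num) (hF.mul hHd.differentiableOn) fun z hz => ?_
  · push_cast at h1
    simpa only [zeroWeight_half_add] using h1
  · have hF' := hK z hz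
    have hH' := hC z ⟨by linarith [hz.1], hz.2⟩
    have ht : 1 ≤ 1 + |z.im| := by linarith [abs_nonneg z.im]
    have hKC : 0 ≤ K * C := by
      have hK0 : 0 ≤ K := by
        have := (norm_nonneg _).trans hF'
        nlinarith
      have hC0 : 0 ≤ C := by
        have := (norm_nonneg _).trans hH'
        rwa [le_div_iff₀ (by positivity), zero_mul] at this
      positivity
    rw [norm_mul]
    calc _ ≤ K * (1 + |z.im|) * (C / (1 + |z.im|) ^ 4) :=
          mul_le_mul hF' hH' (norm_nonneg _) ((norm_nonneg _).trans hF')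
      _ = K * C / (1 + |z.im|) ^ 3 := by field_simp
      _ ≤ _ := by gcongr; norm_num

theorem integral_comp_mul_div_two_pi (hL : 0 < L) (g : ℝ → ℂ) :
    ∫ t : ℝ, g (t * (L / (2 * Real.pi))) = (2 * Real.pi / L : ℝ) * ∫ y : ℝ, g y := by
  rw [Measure.integral_comp_mul_right, abs_of_pos (by positivity), Complex.real_smul, inv_div]

/-- Substituting `t = 2πy/L` turns `n^(-it)` into the Fourier character at `log n / L`. -/
theorem integral_natCast_cpow_mul (hL : 0 < L) {n : ℕ} (hn : n ≠ 0) :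
    ∫ t : ℝ, (n : ℂ) ^ (-(1 / 2 + t * Complex.I)) * φ (t * (L / (2 * Real.pi))) =
      (2 * Real.pi / L : ℝ) * ((Real.sqrt n : ℂ)⁻¹ * (𝓕 φ) (Real.log n / L)) := by
  have hn' : (n : ℂ) ≠ 0 := Nat.cast_ne_zero.mpr hn
  have h1 := integral_comp_mul_div_two_pi hL fun y : ℝ =>
    (n : ℂ) ^ (-(1 / 2 + ((y * (2 * Real.pi / L) : ℝ) : ℂ) * Complex.I)) * φ y
  have h2 : ∀ t : ℝ, t * (L / (2 * Real.pi)) * (2 * Real.pi / L) = t := fun t => by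
    have := Real.pi_pos; field_simp
  simp only [h2] at h1
  rw [h1, SchwartzMap.fourier_coe, Real.fourier_eq', ← integral_const_mul (Real.sqrt n : ℂ)⁻¹]
  congr 1
  refine integral_congr_ae (.of_forall fun y => ?_)
  simp only [smul_eq_mul]
  rw [← mul_assoc]
  congr 1
  have hsq : (Real.sqrt n : ℂ)⁻¹ = (n : ℂ) ^ (-(1 / 2) : ℂ) := by
    rw [Complex.cpow_neg, Real.sqrt_eq_rpow, Complex.ofReal_cpow (Nat.cast_nonneg n)]
    norm_num
  rw [neg_add, Complex.cpow_add _ _ hn', hsq, Complex.cpow_def_of_ne_zero hn' (-(_ * _))]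
  congr 2
  have : Complex.log n = (Real.log n : ℂ) := by
    rw [Complex.ofReal_log (by positivity), Complex.ofReal_natCast]
  rw [this]
  simp
  ring

/-- Sum and integral are exchanged on `Re s = 2`, where convergence is absolute. Only then is each
entire function `n⁻ˢ` moved to the critical line, so the zeros of the L-function play no part. -/
theorem integral_LSeries_mul_zeroWeight (h : ∀ ξ, R < |ξ| → (𝓕 φ) ξ = 0) (hL : 0 < L)
    {f : ℕ → ℂ} (hf0 : f 0 = 0) (hf : LSeriesSummable f 2) :
    ∫ t : ℝ, LSeries f (2 + t * Complex.I) * zeroWeight φ L (2 + t * Complex.I) =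
      (2 * Real.pi / L : ℝ) * ∑' n : ℕ, f n * ((Real.sqrt n : ℂ)⁻¹ * (𝓕 φ) (Real.log n / L)) := by
  obtain ⟨C, hC⟩ := exists_norm_zeroWeight_le h hL.ne'
  have hHd := differentiable_zeroWeight h L
  have hterm : ∀ (n : ℕ) (t : ℝ), LSeries.term f (2 + t * Complex.I) n =
      f n * (n : ℂ) ^ (-(2 + t * Complex.I)) := fun n t => by
    rcases eq_or_ne n 0 with rfl | hn
    · simp [hf0]
    · rw [LSeries.term_of_ne_zero hn, Complex.cpow_neg, div_eq_mul_inv]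
  have hnorm : ∀ (n : ℕ) (t : ℝ), ‖LSeries.term f (2 + t * Complex.I) n‖ =
      ‖LSeries.term f 2 n‖ := fun n t => by
    rw [LSeries.norm_term_eq, LSeries.norm_term_eq]
    simp
  have hHi := integrable_vertical_zeroWeight h hL.ne'
  have hmeas : ∀ n, AEStronglyMeasurable (fun t : ℝ => LSeries.term f (2 + t * Complex.I) n)
      volume := fun n => by
    refine Continuous.aestronglyMeasurable ?_
    rcases eq_or_ne n 0 with rfl | hn
    · simpa [hf0] using continuous_const
    · simp only [hterm]
      refine continuous_const.mul (Continuous.const_cpow (by fun_prop) (.inl ?_))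
      exact Nat.cast_ne_zero.mpr hn
  have hint : ∀ n, Integrable fun t : ℝ =>
      LSeries.term f (2 + t * Complex.I) n * zeroWeight φ L (2 + t * Complex.I) := fun n =>
    hHi.bdd_mul (hmeas n) (.of_forall fun t => (hnorm n t).le)
  have hsum : Summable fun n => ∫ t : ℝ,
      ‖LSeries.term f (2 + t * Complex.I) n * zeroWeight φ L (2 + t * Complex.I)‖ := by
    simp only [norm_mul, hnorm, integral_const_mul]
    exact hf.norm.mul_right _
  have hts : ∀ t : ℝ, ∑' n, LSeries.term f (2 + t * Complex.I) n *
      zeroWeight φ L (2 + t * Complex.I) =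
      LSeries f (2 + t * Complex.I) * zeroWeight φ L (2 + t * Complex.I) := fun t => by
    rw [tsum_mul_right, LSeries]
  have hswap := hasSum_integral_of_summable_integral_norm hint hsum
  simp only [hts] at hswap
  rw [← hswap.tsum_eq, ← tsum_mul_left]
  refine tsum_congr fun n => ?_
  rcases eq_or_ne n 0 with rfl | hn
  · simp [hf0]
  have hn' : (n : ℂ) ≠ 0 := Nat.cast_ne_zero.mpr hn
  simp only [hterm]
  have h1 := integral_mul_zeroWeight h hL.ne' (F := fun z => (n : ℂ) ^ (-z)) (K := 1)
    (DifferentiableOn.const_cpow (by fun_prop) (.inl hn')) fun z hz => ?_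
  · rw [integral_natCast_cpow_mul hL hn] at h1
    simp only [mul_assoc, integral_const_mul]
    rw [h1]
    ring
  · have hn1 : (1 : ℝ) ≤ n := Nat.one_le_cast.mpr (Nat.one_le_iff_ne_zero.mpr hn)
    rw [Complex.norm_natCast_cpow_of_pos (Nat.pos_of_ne_zero hn), one_mul]
    refine (Real.rpow_le_one_of_one_le_of_nonpos hn1 ?_).trans ?_
    · rw [Complex.neg_re]; linarith [hz.1]
    · linarith [abs_nonneg z.im]

end VerticalShift

end OneLevel

/-! ### The explicit formula, uniformly in the character -/

namespace OneLevel

theorem differentiableOn_logDeriv_Gammaℝ :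
    DifferentiableOn ℂ (logDeriv Complex.Gammaℝ) {s | 0 < s.re} := by
  have ho : IsOpen {s : ℂ | 0 < s.re} := isOpen_lt continuous_const Complex.continuous_re
  have hd : DifferentiableOn ℂ Complex.Gammaℝ {s | 0 < s.re} := fun s hs => by
    have h1 : Complex.Gammaℝ = fun s => ((Complex.Gammaℝ s)⁻¹)⁻¹ := by
      funext s; rw [inv_inv]
    rw [h1]
    exact (Complex.differentiable_Gammaℝ_inv.differentiableAt.inv
      (inv_ne_zero (Complex.Gammaℝ_ne_zero_of_re_pos hs))).differentiableWithinAt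
  exact (hd.deriv ho).div hd fun s hs => Complex.Gammaℝ_ne_zero_of_re_pos hs

section ExplicitFormula

variable {φ : 𝓢(ℝ, ℂ)} {R : ℝ}

theorem integrable_mul_zeroWeight {L : ℝ} (h : ∀ ξ, R < |ξ| → (𝓕 φ) ξ = 0) (hL : L ≠ 0) {F : ℂ → ℂ}
    {K : ℝ} (hF : DifferentiableOn ℂ F {z | z.re ∈ Set.Icc (1 / 2 : ℝ) 2})
    (hK : ∀ z : ℂ, z.re ∈ Set.Icc (1 / 2 : ℝ) 2 → ‖F z‖ ≤ K * (1 + |z.im|)) :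
    Integrable fun t : ℝ => F (2 + t * Complex.I) * zeroWeight φ L (2 + t * Complex.I) := by
  obtain ⟨C, hC⟩ := exists_norm_zeroWeight_le h hL
  refine integrable_of_norm_le_div_one_add_sq (C := K * C) ?_ fun t => ?_
  · refine Continuous.mul ?_ ((differentiable_zeroWeight h L).continuous.comp (by fun_prop))
    rw [← continuousOn_univ]
    exact hF.continuousOn.comp (f := fun t : ℝ => (2 + t * Complex.I : ℂ)) (by fun_prop)
      fun t _ => by norm_num
  · have h1 := hK (2 + t * Complex.I) (by norm_num)
    have h2 := hC (2 + t * Complex.I) (by norm_num)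
    simp only [Complex.add_im, Complex.mul_im, Complex.ofReal_re, Complex.I_im, mul_one,
      Complex.ofReal_im, Complex.I_re, mul_zero, add_zero, Complex.im_ofNat, zero_add] at h1 h2
    have ht : 1 ≤ 1 + |t| := by linarith [abs_nonneg t]
    have hKC : 0 ≤ K * C := by
      have hK0 : 0 ≤ K := by
        have := (norm_nonneg _).trans h1
        nlinarith
      have hC0 : 0 ≤ C := by
        have := (norm_nonneg _).trans h2
        rwa [le_div_iff₀ (by positivity), zero_mul] at this
      positivity
    rw [norm_mul]
    calc _ ≤ K * (1 + |t|) * (C / (1 + |t|) ^ 4) :=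
          mul_le_mul h1 h2 (norm_nonneg _) ((norm_nonneg _).trans h1)
      _ = K * C / (1 + |t|) ^ 3 := by field_simp
      _ ≤ _ := by gcongr; norm_num

/-- After `t = 2πy/L` the summand `L` gives exactly `2π ∫ φ`. The rest, `G`, is `O(1+|y|)` uniformly
in `L ≥ 1`, hence integrable against `φ`, and carries the factor `2π/L`. -/
theorem exists_norm_integral_gammaFactor_sub_le (φ : 𝓢(ℝ, ℂ)) : ∃ C : ℝ, 0 ≤ C ∧
    ∀ a : ℝ, a = 0 ∨ a = 1 → ∀ L : ℝ, 1 ≤ L →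
      ‖(∫ t : ℝ, ((L + Real.log Real.pi : ℝ) +
        2 * logDeriv Complex.Gammaℝ (1 / 2 + t * Complex.I + a)) * φ (t * (L / (2 * Real.pi)))) -
        2 * Real.pi * ∫ y : ℝ, φ y‖ ≤ C / L := by
  obtain ⟨C, hC0, hC⟩ := exists_norm_logDeriv_Gammaℝ_le
  have hπ := Real.pi_pos
  set K := |Real.log Real.pi| + 2 * C
  set M : ℝ → ℝ := fun y => K * ((1 + 2 * Real.pi * |y|) * ‖φ y‖)
  have hM : Integrable M := by
    have h1 := φ.integrable_pow_mul volume 1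
    have h2 := (φ.integrable (μ := volume)).norm
    refine ((h2.add (h1.const_mul (2 * Real.pi))).const_mul K).congr (.of_forall fun y => ?_)
    simp only [M, Pi.add_apply, pow_one, Real.norm_eq_abs]
    ring
  have hM0 : ∀ y, 0 ≤ M y := fun y => by positivity
  refine ⟨2 * Real.pi * ∫ y, M y, mul_nonneg (by positivity) (integral_nonneg hM0),
    fun a ha L hL => ?_⟩
  have hL0 : 0 < L := by linarith
  set G : ℝ → ℂ := fun y => Real.log Real.pi +
    2 * logDeriv Complex.Gammaℝ (1 / 2 + ((y * (2 * Real.pi / L) : ℝ) : ℂ) * Complex.I + a)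
    with hG
  have hGM : ∀ y, ‖G y * φ y‖ ≤ M y := fun y => by
    have h1 := hC (1 / 2 + ((y * (2 * Real.pi / L) : ℝ) : ℂ) * Complex.I + a) (by
      rcases ha with rfl | rfl <;> norm_num)
    have h2 : (1 / 2 + ((y * (2 * Real.pi / L) : ℝ) : ℂ) * Complex.I + a).im =
        y * (2 * Real.pi / L) := by simp
    have h3 : |y * (2 * Real.pi / L)| ≤ 2 * Real.pi * |y| := by
      rw [abs_mul, abs_of_pos (by positivity : 0 < 2 * Real.pi / L), mul_comm]
      exact mul_le_mul_of_nonneg_right (div_le_self (by positivity) hL) (abs_nonneg y)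
    rw [h2] at h1
    have h4 : ‖G y‖ ≤ K * (1 + 2 * Real.pi * |y|) := by
      have h5 := norm_add_le (Real.log Real.pi : ℂ)
        (2 * logDeriv Complex.Gammaℝ (1 / 2 + ((y * (2 * Real.pi / L) : ℝ) : ℂ) * Complex.I + a))
      rw [norm_mul, Complex.norm_real, Real.norm_eq_abs, Complex.norm_ofNat] at h5
      have h6 : 0 ≤ |Real.log Real.pi| * (2 * Real.pi * |y|) := by positivity
      have h7 := mul_le_mul_of_nonneg_left h3 hC0.le
      simp only [hG, K]
      nlinarith
    rw [norm_mul]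
    calc _ ≤ K * (1 + 2 * Real.pi * |y|) * ‖φ y‖ := mul_le_mul_of_nonneg_right h4 (norm_nonneg _)
      _ = _ := by simp only [M]; ring
  have hGc : Continuous G := by
    refine continuous_const.add (continuous_const.mul ?_)
    rw [← continuousOn_univ]
    refine differentiableOn_logDeriv_Gammaℝ.continuousOn.comp (by fun_prop) fun y _ => ?_
    rcases ha with rfl | rfl <;> norm_num
  have hGi : Integrable fun y => G y * φ y :=
    hM.mono' (hGc.mul φ.continuous).aestronglyMeasurable (.of_forall hGM)
  have hsub : ∀ t : ℝ, t * (L / (2 * Real.pi)) * (2 * Real.pi / L) = t := fun t => by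
    field_simp
  have h1 := integral_comp_mul_div_two_pi hL0 fun y : ℝ => (L + G y) * φ y
  simp only [hG, hsub] at h1
  have h2 : ∫ y, (L + G y) * φ y = L * (∫ y, φ y) + ∫ y, G y * φ y := by
    simp only [add_mul]
    rw [integral_add (φ.integrable.const_mul _) hGi, integral_const_mul]
  have h3 : (∫ t : ℝ, ((L + Real.log Real.pi : ℝ) +
        2 * logDeriv Complex.Gammaℝ (1 / 2 + t * Complex.I + a)) * φ (t * (L / (2 * Real.pi)))) =
      (2 * Real.pi / L : ℝ) * ∫ y, (L + G y) * φ y := by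
    rw [← h1]
    refine integral_congr_ae (.of_forall fun t => ?_)
    simp only
    push_cast
    ring
  have hLc : (L : ℂ) ≠ 0 := by exact_mod_cast hL0.ne'
  rw [h3, h2]
  have h4 : ((2 * Real.pi / L : ℝ) : ℂ) * (L * (∫ y, φ y) + ∫ y, G y * φ y) -
      2 * Real.pi * ∫ y, φ y = ((2 * Real.pi / L : ℝ) : ℂ) * ∫ y, G y * φ y := by
    push_cast
    field_simp
    ring
  rw [h4, norm_mul, Complex.norm_real, Real.norm_eq_abs, abs_of_pos (by positivity),
    mul_div_right_comm (2 * Real.pi)]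
  exact mul_le_mul_of_nonneg_left (norm_integral_le_of_norm_le hM (.of_forall hGM)) (by positivity)

/-- The term at `n` of the prime power sum in the explicit formula. -/
noncomputable def primePowerTerm (φ : 𝓢(ℝ, ℂ)) (L : ℝ) (n : ℕ) : ℂ :=
  ArithmeticFunction.vonMangoldt n * ((Real.sqrt n : ℂ)⁻¹ * (𝓕 φ) (Real.log n / L))

/-- The only error is the archimedean one, so `C` depends on neither `m` nor `χ`; averaging over the
family needs this. -/
theorem exists_norm_explicitFormula_le {φ : 𝓢(ℝ, ℂ)} (hφ : Function.Even φ)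
    (h : ∀ ξ, R < |ξ| → (𝓕 φ) ξ = 0) : ∃ C : ℝ, 0 ≤ C ∧
    ∀ (m : ℕ) [NeZero m] (χ : DirichletCharacter ℂ m), χ ≠ 1 → χ.IsPrimitive →
    ∀ L, L = Real.log (m / Real.pi) → 1 ≤ L →
    ‖oneLevelDensity χ φ - ((∫ y : ℝ, φ y) -
      (L : ℂ)⁻¹ * ∑' n : ℕ, (χ n + χ⁻¹ n) * primePowerTerm φ L n)‖ ≤ C / L := by
  obtain ⟨C, hC0, hC⟩ := exists_norm_integral_gammaFactor_sub_le φ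
  obtain ⟨K, hK0, hK⟩ := exists_norm_logDeriv_Gammaℝ_le
  refine ⟨C, hC0, fun m _ χ hχ hp L hLm hL => ?_⟩
  have hπ := Real.pi_pos
  have hL0 : 0 < L := by linarith
  have hχ' : χ⁻¹ ≠ 1 := inv_ne_one.mpr hχ
  obtain ⟨a, ha, hγ, hγ'⟩ := exists_gammaFactor_eq χ
  have hlog : Real.log m = L + Real.log Real.pi := by
    rw [hLm, Real.log_div (Nat.cast_ne_zero.mpr (NeZero.ne m)) hπ.ne']
    ring
  -- `J` collects `log m = L + log π` and the two equal gamma factors of `χ` and `χ⁻¹`.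
  set J : ℂ → ℂ := fun s => (L + Real.log Real.pi : ℝ) + 2 * logDeriv Complex.Gammaℝ (s + a) with hJ
  set f : ℕ → ℂ := fun n => χ n * ArithmeticFunction.vonMangoldt n +
    χ⁻¹ n * ArithmeticFunction.vonMangoldt n with hf
  have ha0 : 0 ≤ a ∧ a ≤ 1 := by rcases ha with rfl | rfl <;> norm_num
  have hJd : DifferentiableOn ℂ J {z | z.re ∈ Set.Icc (1 / 2 : ℝ) 2} := by
    refine (differentiableOn_const _).add ((differentiableOn_const _).mul ?_)
    refine differentiableOn_logDeriv_Gammaℝ.comp (by fun_prop) fun z hz => ?_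
    simp only [Set.mem_ofPred_eq, Complex.add_re, Complex.ofReal_re]
    linarith [hz.1]
  have hJb : ∀ z : ℂ, z.re ∈ Set.Icc (1 / 2 : ℝ) 2 →
      ‖J z‖ ≤ (|L + Real.log Real.pi| + 2 * K) * (1 + |z.im|) := fun z hz => by
    have h1 := hK (z + a) (by
      simp only [Set.mem_Icc, Complex.add_re, Complex.ofReal_re]
      exact ⟨by linarith [hz.1], by linarith [hz.2]⟩)
    have h2 := norm_add_le ((L + Real.log Real.pi : ℝ) : ℂ)
      (2 * logDeriv Complex.Gammaℝ (z + a))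
    rw [norm_mul, Complex.norm_real, Real.norm_eq_abs, Complex.norm_ofNat] at h2
    simp only [Complex.add_im, Complex.ofReal_im, add_zero] at h1
    have h3 : 0 ≤ |L + Real.log Real.pi| * |z.im| := by positivity
    simp only [hJ]
    nlinarith
  have h2re : (1 : ℝ) < (2 : ℂ).re := by norm_num
  have hf1 : ∀ (ψ : DirichletCharacter ℂ m) {s : ℂ}, 1 < s.re →
      LSeriesSummable (fun n => ψ n * ArithmeticFunction.vonMangoldt n) s := fun ψ s hs =>
    DirichletCharacter.LSeriesSummable_twist_vonMangoldt ψ hs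
  have hfs : LSeriesSummable f 2 := (hf1 χ h2re).add (hf1 χ⁻¹ h2re)
  have hf0 : f 0 = 0 := by simp [hf]
  obtain ⟨hXi, hX⟩ := two_pi_mul_oneLevelDensity hφ h hχ hp hLm hL0.ne'
  have hJi := integrable_mul_zeroWeight h hL0.ne' hJd hJb
  have hlogD : ∀ t : ℝ, logDeriv (DirichletCharacter.completedLFunction χ) (2 + t * Complex.I) +
        logDeriv (DirichletCharacter.completedLFunction χ⁻¹) (2 + t * Complex.I) + Real.log m =
      J (2 + t * Complex.I) - LSeries f (2 + t * Complex.I) := fun t => by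
    have hre : 1 < (2 + t * Complex.I).re := by norm_num
    have e1 : DirichletCharacter.gammaFactor χ = fun s => Complex.Gammaℝ (s + a) := funext hγ
    have e2 : DirichletCharacter.gammaFactor χ⁻¹ = fun s => Complex.Gammaℝ (s + a) := funext hγ'
    have e3 : ∀ s : ℂ, logDeriv (fun s => Complex.Gammaℝ (s + a)) s =
        logDeriv Complex.Gammaℝ (s + a) := fun s => by
      rw [logDeriv_apply, logDeriv_apply, deriv_comp_add_const]
    have e4 := LSeries_add (hf1 χ hre) (hf1 χ⁻¹ hre)
    rw [logDeriv_completedLFunction hχ hre, logDeriv_completedLFunction hχ' hre, e1, e2, e3, hlog]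
    have e5 : f = (fun n : ℕ => χ n * (ArithmeticFunction.vonMangoldt n : ℂ)) +
      fun n : ℕ => χ⁻¹ n * (ArithmeticFunction.vonMangoldt n : ℂ) := rfl
    rw [e5, e4]
    simp only [hJ]
    ring
  simp only [hlogD] at hXi hX
  have hint : ∫ t : ℝ, LSeries f (2 + t * Complex.I) * zeroWeight φ L (2 + t * Complex.I) =
      (∫ t : ℝ, J (2 + t * Complex.I) * zeroWeight φ L (2 + t * Complex.I)) -
        2 * Real.pi * oneLevelDensity χ φ := by
    rw [hX, ← integral_sub hJi hXi]
    refine integral_congr_ae (.of_forall fun t => ?_)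
    simp only
    ring
  rw [integral_LSeries_mul_zeroWeight h hL0 hf0 hfs, integral_mul_zeroWeight h hL0.ne' hJd hJb] at hint
  have hts : ∑' n : ℕ, f n * ((Real.sqrt n : ℂ)⁻¹ * (𝓕 φ) (Real.log n / L)) =
      ∑' n : ℕ, (χ n + χ⁻¹ n) * primePowerTerm φ L n := by
    refine tsum_congr fun n => ?_
    simp only [hf, primePowerTerm]
    ring
  rw [hts] at hint
  have hfin := hC a ha L hL
  have hLc : (L : ℂ) ≠ 0 := by exact_mod_cast hL0.ne'
  have hπc : (Real.pi : ℂ) ≠ 0 := by exact_mod_cast hπ.ne'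
  set T := ∑' n : ℕ, (χ n + χ⁻¹ n) * primePowerTerm φ L n
  set I₁ := ∫ t : ℝ, J (1 / 2 + t * Complex.I) * φ (t * (L / (2 * Real.pi)))
  have h5 : oneLevelDensity χ φ - ((∫ y : ℝ, φ y) - (L : ℂ)⁻¹ * T) =
      (2 * Real.pi : ℂ)⁻¹ * (I₁ - 2 * Real.pi * ∫ y : ℝ, φ y) := by
    push_cast at hint
    field_simp
    field_simp at hint
    linear_combination hint
  rw [h5, norm_mul]
  have h6 : ‖(2 * Real.pi : ℂ)⁻¹‖ ≤ 1 := by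
    rw [norm_inv, norm_mul, Complex.norm_real, Real.norm_eq_abs, abs_of_pos hπ, Complex.norm_ofNat]
    exact inv_le_one_of_one_le₀ (by linarith [Real.pi_gt_three])
  calc _ ≤ 1 * ‖I₁ - 2 * Real.pi * ∫ y : ℝ, φ y‖ := mul_le_mul_of_nonneg_right h6 (norm_nonneg _)
    _ ≤ _ := by rw [one_mul]; exact hfin

end ExplicitFormula

end OneLevel

/-! ### Averages over the non-principal characters -/

namespace OneLevel

section FamilyAverage

variable {m : ℕ} [NeZero m]

theorem familyAverage_congr {F G : DirichletCharacter ℂ m → ℂ} (h : ∀ χ, χ ≠ 1 → F χ = G χ) :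
    familyAverage m F = familyAverage m G := by
  classical
  unfold familyAverage
  congr 1
  exact Finset.sum_congr rfl fun χ hχ => h χ (Finset.mem_filter.mp hχ).2

theorem familyAverage_add (F G : DirichletCharacter ℂ m → ℂ) :
    familyAverage m (fun χ => F χ + G χ) = familyAverage m F + familyAverage m G := by
  unfold familyAverage
  rw [Finset.sum_add_distrib, mul_add]

theorem familyAverage_sub (F G : DirichletCharacter ℂ m → ℂ) :
    familyAverage m (fun χ => F χ - G χ) = familyAverage m F - familyAverage m G := by
  unfold familyAverage
  rw [Finset.sum_sub_distrib, mul_sub]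

theorem familyAverage_const_mul (c : ℂ) (F : DirichletCharacter ℂ m → ℂ) :
    familyAverage m (fun χ => c * F χ) = c * familyAverage m F := by
  unfold familyAverage
  rw [← Finset.mul_sum]
  ring

theorem familyAverage_tsum {F : ℕ → DirichletCharacter ℂ m → ℂ} (hF : ∀ χ, Summable fun n => F n χ) :
    familyAverage m (fun χ => ∑' n, F n χ) = ∑' n, familyAverage m (F n) := by
  unfold familyAverage
  rw [tsum_mul_left, ← Summable.tsum_finsetSum fun χ _ => hF χ]

theorem familyAverage_inv (F : DirichletCharacter ℂ m → ℂ) :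
    familyAverage m (fun χ => F χ⁻¹) = familyAverage m F := by
  classical
  unfold familyAverage
  congr 1
  exact Finset.sum_bij' (fun χ _ => χ⁻¹) (fun χ _ => χ⁻¹) (by simp) (by simp) (by simp) (by simp)
    (by simp)

theorem card_nonprincipal (hm : m.Prime) :
    ((Finset.univ.filter fun χ : DirichletCharacter ℂ m => χ ≠ 1).card : ℝ) = m - 2 := by
  classical
  rw [Finset.filter_ne', Finset.card_erase_of_mem (Finset.mem_univ _), Finset.card_univ,
    ← Nat.card_eq_fintype_card, DirichletCharacter.card_eq_totient_of_hasEnoughRootsOfUnity,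
    Nat.totient_prime hm, Nat.sub_sub, Nat.cast_sub hm.two_le]
  norm_num

theorem norm_familyAverage_le (hm : m.Prime) (hm2 : 2 < m) {F : DirichletCharacter ℂ m → ℂ} {B : ℝ}
    (h : ∀ χ, χ ≠ 1 → ‖F χ‖ ≤ B) : ‖familyAverage m F‖ ≤ B := by
  classical
  have h2 : (0 : ℝ) < m - 2 := by
    have : (2 : ℝ) < m := by exact_mod_cast hm2
    linarith
  have h3 : ‖((m : ℂ) - 2)⁻¹‖ = ((m : ℝ) - 2)⁻¹ := by
    rw [norm_inv, show (m : ℂ) - 2 = ((m - 2 : ℝ) : ℂ) by push_cast; rfl, Complex.norm_real,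
      Real.norm_eq_abs, abs_of_pos h2]
  unfold familyAverage
  rw [norm_mul, h3, inv_mul_le_iff₀ h2]
  refine (norm_sum_le_of_le _ fun χ hχ => h χ (Finset.mem_filter.mp hχ).2).trans ?_
  rw [Finset.sum_const, nsmul_eq_mul]
  have h4 := card_nonprincipal hm
  rw [← h4]

theorem familyAverage_const (hm : m.Prime) (hm2 : 2 < m) (c : ℂ) :
    familyAverage m (fun _ => c) = c := by
  classical
  have h4 := congrArg (fun x : ℝ => (x : ℂ)) (card_nonprincipal hm)
  have h5 : (m : ℂ) - 2 ≠ 0 := by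
    rw [sub_ne_zero]
    exact_mod_cast hm2.ne'
  unfold familyAverage
  rw [Finset.sum_const, nsmul_eq_mul]
  push_cast at h4
  rw [← mul_assoc]
  convert one_mul c
  rw [inv_mul_eq_one₀ h5, ← h4]

/-- Orthogonality over all characters, with the principal one subtracted. -/
theorem familyAverage_apply (hm : m.Prime) (a : ZMod m) :
    familyAverage m (fun χ => χ a) =
      ((m : ℂ) - 2)⁻¹ * ((if a = 1 then (m : ℂ) - 1 else 0) - if IsUnit a then 1 else 0) := by
  classical
  unfold familyAverage
  congr 1
  rw [Finset.filter_ne', Finset.sum_erase_eq_sub (Finset.mem_univ _),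
    DirichletCharacter.sum_characters_eq, Nat.totient_prime hm, Nat.cast_sub hm.one_le,
    Nat.cast_one]
  congr 1
  split_ifs with h
  · exact MulChar.one_apply h
  · exact MulChar.map_nonunit _ h

theorem norm_familyAverage_apply_le (hm : m.Prime) (hm2 : 2 < m) {a : ZMod m} (ha : a ≠ 1) :
    ‖familyAverage m (fun χ => χ a)‖ ≤ ((m : ℝ) - 2)⁻¹ := by
  have h2 : (0 : ℝ) < m - 2 := by
    have : (2 : ℝ) < m := by exact_mod_cast hm2
    linarith
  have h3 : ‖((m : ℂ) - 2)⁻¹‖ = ((m : ℝ) - 2)⁻¹ := by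
    rw [norm_inv, show (m : ℂ) - 2 = ((m - 2 : ℝ) : ℂ) by push_cast; rfl, Complex.norm_real,
      Real.norm_eq_abs, abs_of_pos h2]
  rw [familyAverage_apply hm, if_neg ha, norm_mul, h3]
  refine mul_le_of_le_one_right (inv_nonneg.mpr h2.le) ?_
  split_ifs <;> simp

theorem norm_familyAverage_apply_le_one (hm : m.Prime) (hm2 : 2 < m) (a : ZMod m) :
    ‖familyAverage m (fun χ => χ a)‖ ≤ 1 :=
  norm_familyAverage_le hm hm2 fun χ _ => χ.norm_le_one a

end FamilyAverage

/-! ### Separating primes, their squares and higher powers -/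

section PrimePowers

theorem exists_norm_fourier_le (φ : 𝓢(ℝ, ℂ)) : ∃ B : ℝ, 0 ≤ B ∧ ∀ ξ, ‖(𝓕 φ) ξ‖ ≤ B := by
  obtain ⟨B, hB0, hB⟩ := (𝓕 φ).decay 0 0
  exact ⟨B, hB0.le, fun ξ => by simpa using hB ξ⟩

theorem primePowerTerm_eq_zero {φ : 𝓢(ℝ, ℂ)} {R L : ℝ} (h : ∀ ξ, R < |ξ| → (𝓕 φ) ξ = 0) (hL : 0 < L)
    {n : ℕ} (hn : Real.exp (R * L) < n) : primePowerTerm φ L n = 0 := by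
  have h1 : R < Real.log n / L := by
    rw [lt_div_iff₀ hL]
    exact (Real.lt_log_iff_exp_lt ((Real.exp_pos _).trans hn)).mpr hn
  rw [primePowerTerm, h _ (h1.trans_le (le_abs_self _)), mul_zero, mul_zero]

/-- Compact support leaves only `n ≤ exp(RL)`, so the sum is finite. -/
theorem summable_mul_primePowerTerm {φ : 𝓢(ℝ, ℂ)} {R L : ℝ} (h : ∀ ξ, R < |ξ| → (𝓕 φ) ξ = 0)
    (hL : 0 < L) (c : ℕ → ℂ) : Summable fun n => c n * primePowerTerm φ L n := by
  refine summable_of_hasFiniteSupport ((Set.finite_Iic ⌈Real.exp (R * L)⌉₊).subset fun n hn => ?_)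
  by_contra hcon
  refine hn ?_
  rw [Set.mem_Iic, not_le] at hcon
  simp only [primePowerTerm_eq_zero h hL (Nat.lt_of_ceil_lt hcon), mul_zero]

theorem summable_log_div_rpow_primes :
    Summable fun p : Nat.Primes => Real.log p / (p : ℝ) ^ (3 / 2 : ℝ) := by
  have h1 := (ArithmeticFunction.LSeriesSummable_vonMangoldt
    (s := (3 / 2 : ℝ)) (by norm_num)).norm.comp_injective
      (i := fun p : Nat.Primes => (p : ℕ)) Subtype.val_injective
  refine h1.congr fun p => ?_
  simp only [Function.comp, LSeries.norm_term_eq, if_neg p.2.ne_zero, Complex.norm_real,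
    Complex.ofReal_re, Real.norm_eq_abs, ArithmeticFunction.vonMangoldt_apply_prime p.2]
  rw [abs_of_nonneg (Real.log_natCast_nonneg _)]

/-- The term at `p^(k+3)` is at most `B (log p) p^(-3/2) 2^(-k/2)`, summable over `p` and `k`. The
bound is free of `L`, so the prefactor `1/L` makes this part an error term. -/
theorem exists_norm_tsum_higher_primePowers_le (φ : 𝓢(ℝ, ℂ)) : ∃ C : ℝ, 0 ≤ C ∧
    ∀ (L : ℝ) (c : ℕ → ℂ), (∀ n, ‖c n‖ ≤ 1) →
    (Summable fun p : Nat.Primes => ∑' k : ℕ, c (p ^ (k + 3)) * primePowerTerm φ L (p ^ (k + 3))) ∧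
    ‖∑' (p : Nat.Primes) (k : ℕ), c (p ^ (k + 3)) * primePowerTerm φ L (p ^ (k + 3))‖ ≤ C := by
  obtain ⟨B, hB0, hB⟩ := exists_norm_fourier_le φ
  set r : ℝ := (Real.sqrt 2)⁻¹
  have hr0 : 0 ≤ r := by positivity
  have hr1 : r < 1 := inv_lt_one_of_one_lt₀ (by
    rw [Real.lt_sqrt zero_le_one]; norm_num)
  set w : Nat.Primes → ℝ := fun p => Real.log p / (p : ℝ) ^ (3 / 2 : ℝ) with hw
  have hw0 : ∀ p, 0 ≤ w p := fun p => div_nonneg (Real.log_natCast_nonneg _) (by positivity)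
  have hterm : ∀ (L : ℝ) (c : ℕ → ℂ), (∀ n, ‖c n‖ ≤ 1) → ∀ (p : Nat.Primes) (k : ℕ),
      ‖c (p ^ (k + 3)) * primePowerTerm φ L (p ^ (k + 3))‖ ≤ w p * B * r ^ k := by
    intro L c hc p k
    have hp0 : (0 : ℝ) < p := by exact_mod_cast p.2.pos
    have hsq : 0 < Real.sqrt p := Real.sqrt_pos.mpr hp0
    have h1 : ‖primePowerTerm φ L (p ^ (k + 3))‖ ≤
        Real.log p * ((Real.sqrt p ^ (k + 3))⁻¹ * B) := by
      rw [primePowerTerm, ArithmeticFunction.vonMangoldt_apply_pow (by omega),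
        ArithmeticFunction.vonMangoldt_apply_prime p.2, norm_mul, norm_mul, norm_inv,
        Complex.norm_real, Complex.norm_real, Real.norm_of_nonneg (Real.log_natCast_nonneg _),
        Real.norm_of_nonneg (Real.sqrt_nonneg _), Nat.cast_pow,
        show Real.sqrt ((p : ℝ) ^ (k + 3)) = Real.sqrt p ^ (k + 3) by
          rw [← Real.sqrt_sq (pow_nonneg (Real.sqrt_nonneg _) _), ← pow_mul, mul_comm, pow_mul,
            Real.sq_sqrt hp0.le]]
      exact mul_le_mul_of_nonneg_left (mul_le_mul_of_nonneg_left (hB _) (by positivity))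
        (Real.log_natCast_nonneg _)
    have h2 : (p : ℝ) ^ (3 / 2 : ℝ) = Real.sqrt p ^ 3 := by
      rw [Real.sqrt_eq_rpow, ← Real.rpow_natCast, ← Real.rpow_mul hp0.le]
      norm_num
    have h3 : (Real.sqrt p)⁻¹ ≤ r := by
      refine inv_anti₀ (by positivity) (Real.sqrt_le_sqrt ?_)
      exact_mod_cast p.2.two_le
    have h4 : (Real.sqrt p)⁻¹ ^ k ≤ r ^ k := pow_le_pow_left₀ (by positivity) h3 k
    rw [norm_mul]
    calc _ ≤ 1 * (Real.log p * ((Real.sqrt p ^ (k + 3))⁻¹ * B)) :=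
          mul_le_mul (hc _) h1 (norm_nonneg _) zero_le_one
      _ = w p * B * (Real.sqrt p)⁻¹ ^ k := by
          simp only [hw, h2, pow_add, inv_pow]
          field_simp
      _ ≤ _ := mul_le_mul_of_nonneg_left h4 (mul_nonneg (hw0 p) hB0)
  have hgeo := hasSum_geometric_of_lt_one hr0 hr1
  have hinner : ∀ (L : ℝ) (c : ℕ → ℂ), (∀ n, ‖c n‖ ≤ 1) → ∀ p : Nat.Primes,
      ‖∑' k : ℕ, c (p ^ (k + 3)) * primePowerTerm φ L (p ^ (k + 3))‖ ≤ w p * B * (1 - r)⁻¹ :=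
    fun L c hc p => tsum_of_norm_bounded (hgeo.mul_left _) (hterm L c hc p)
  have hs : Summable fun p => w p * B * (1 - r)⁻¹ :=
    (summable_log_div_rpow_primes.mul_right B).mul_right _
  refine ⟨∑' p, w p * B * (1 - r)⁻¹, tsum_nonneg fun p => ?_, fun L c hc => ⟨?_, ?_⟩⟩
  · exact mul_nonneg (mul_nonneg (hw0 p) hB0) (inv_nonneg.mpr (by linarith))
  · exact Summable.of_norm_bounded hs (hinner L c hc)
  · exact tsum_of_norm_bounded hs.hasSum (hinner L c hc)

theorem tsum_mul_primePowerTerm_eq {φ : 𝓢(ℝ, ℂ)} {R L : ℝ} (h : ∀ ξ, R < |ξ| → (𝓕 φ) ξ = 0)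
    (hL : 0 < L) {c : ℕ → ℂ} (hc : ∀ n, ‖c n‖ ≤ 1) :
    ∑' n : ℕ, c n * primePowerTerm φ L n =
      (∑' p : Nat.Primes, c p * primePowerTerm φ L p) +
      (∑' p : Nat.Primes, c (p ^ 2) * primePowerTerm φ L (p ^ 2)) +
      ∑' (p : Nat.Primes) (k : ℕ), c (p ^ (k + 3)) * primePowerTerm φ L (p ^ (k + 3)) := by
  obtain ⟨_, -, hC⟩ := exists_norm_tsum_higher_primePowers_le φ
  have hs := summable_mul_primePowerTerm h hL c
  have hpow : ∀ (p : Nat.Primes) (j : ℕ), Function.Injective fun k : ℕ => (p : ℕ) ^ (k + j) :=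
    fun p j a b hab => by
      have := Nat.pow_right_injective p.2.two_le hab
      omega
  rw [tsum_eq_tsum_primes_add_tsum_primes_of_support_subset_prime_powers hs, add_assoc]
  · congr 1
    rw [← Summable.tsum_add _ (hC L c hc).1]
    · exact tsum_congr fun p => Summable.tsum_eq_zero_add (hs.comp_injective (hpow p 2))
    · refine hs.comp_injective (i := fun p : Nat.Primes => (p : ℕ) ^ 2) fun p q hpq => ?_
      exact Subtype.ext (Nat.pow_left_injective (n := 2) (by norm_num) hpq)
  · intro n hn
    by_contra hcon
    refine hn ?_
    simp only [primePowerTerm, (ArithmeticFunction.vonMangoldt_eq_zero_iff).mpr hcon]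
    simp

end PrimePowers

end OneLevel

/-! ### The averaged explicit formula -/

namespace OneLevel

section AveragedFormula

theorem primeSum_eq {m : ℕ} [NeZero m] {φ : 𝓢(ℝ, ℂ)} {L : ℝ} (hL : L = Real.log (m / Real.pi)) :
    primeSum m φ = (L : ℂ)⁻¹ * ∑' p : Nat.Primes,
      familyAverage m (fun χ => χ ((p : ℕ) : ZMod m)) * primePowerTerm φ L p := by
  rw [← tsum_mul_left, primeSum, ← hL]
  refine tsum_congr fun p => ?_
  rw [primePowerTerm, ArithmeticFunction.vonMangoldt_apply_prime p.2]
  push_cast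
  ring

theorem primeSquareSum_eq {m : ℕ} [NeZero m] {φ : 𝓢(ℝ, ℂ)} {L : ℝ} (hL : L = Real.log (m / Real.pi)) :
    primeSquareSum m φ = (L : ℂ)⁻¹ * ∑' p : Nat.Primes,
      familyAverage m (fun χ => χ (((p : ℕ) ^ 2 : ℕ) : ZMod m)) * primePowerTerm φ L (p ^ 2) := by
  rw [← tsum_mul_left, primeSquareSum, ← hL]
  refine tsum_congr fun p => ?_
  have h1 : familyAverage m (fun χ => (χ ^ 2) ((p : ℕ) : ZMod m)) =
      familyAverage m (fun χ => χ (((p : ℕ) ^ 2 : ℕ) : ZMod m)) :=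
    familyAverage_congr fun χ _ => by
      rw [MulChar.pow_apply' χ two_ne_zero, Nat.cast_pow, map_pow]
  rw [h1, primePowerTerm, ArithmeticFunction.vonMangoldt_apply_pow two_ne_zero,
    ArithmeticFunction.vonMangoldt_apply_prime p.2, Nat.cast_pow (α := ℝ),
    Real.sqrt_sq (Nat.cast_nonneg _), Real.log_pow]
  push_cast
  ring

theorem exists_norm_familyAverage_oneLevelDensity_le {φ : 𝓢(ℝ, ℂ)} {R : ℝ} (hφ : Function.Even φ)
    (h : ∀ ξ, R < |ξ| → (𝓕 φ) ξ = 0) : ∃ C : ℝ, 0 ≤ C ∧ ∀ (m : ℕ) [NeZero m], m.Prime → 2 < m →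
    ∀ L, L = Real.log (m / Real.pi) → 1 ≤ L →
    ‖familyAverage m (fun χ => oneLevelDensity χ φ) - ((∫ y : ℝ, φ y) - 2 * primeSum m φ -
      2 * primeSquareSum m φ)‖ ≤ C / L := by
  obtain ⟨C₁, hC₁0, hC₁⟩ := exists_norm_explicitFormula_le hφ h
  obtain ⟨C₂, hC₂0, hC₂⟩ := exists_norm_tsum_higher_primePowers_le φ
  refine ⟨C₁ + 2 * C₂, by positivity, fun m _ hm hm2 L hLm hL => ?_⟩
  have hL0 : 0 < L := by linarith
  set a : ℕ → ℂ := fun n => familyAverage m (fun χ => χ (n : ZMod m)) with ha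
  have ha1 : ∀ n, ‖a n‖ ≤ 1 := fun n => norm_familyAverage_apply_le_one hm hm2 _
  -- Inversion permutes the family, so `χ` and `χ⁻¹` contribute equally; hence the factor `2`.
  have h1 : familyAverage m (fun χ =>
      ∑' n : ℕ, (χ n + χ⁻¹ n) * primePowerTerm φ L n) =
      2 * ∑' n : ℕ, a n * primePowerTerm φ L n := by
    rw [familyAverage_tsum fun χ => summable_mul_primePowerTerm h hL0 _, ← tsum_mul_left]
    refine tsum_congr fun n => ?_
    have e1 := familyAverage_inv (m := m) fun χ => χ (n : ZMod m)
    have e2 := familyAverage_const_mul (m := m) (primePowerTerm φ L n)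
      fun χ => χ (n : ZMod m) + χ⁻¹ (n : ZMod m)
    rw [familyAverage_add, e1] at e2
    simp only [mul_comm _ (primePowerTerm φ L n)]
    rw [e2]
    ring
  have h2 := norm_familyAverage_le hm hm2 fun χ hχ =>
    hC₁ m χ hχ (isPrimitive_of_prime hm hχ) L hLm hL
  rw [familyAverage_sub, familyAverage_sub, familyAverage_const hm hm2, familyAverage_const_mul, h1,
    tsum_mul_primePowerTerm_eq h hL0 ha1] at h2
  have h3 := (hC₂ L a ha1).2
  rw [primeSum_eq hLm, primeSquareSum_eq hLm]
  set S₁ := ∑' p : Nat.Primes, a p * primePowerTerm φ L p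
  set S₂ := ∑' p : Nat.Primes, a (p ^ 2) * primePowerTerm φ L (p ^ 2)
  set S₃ := ∑' (p : Nat.Primes) (k : ℕ), a (p ^ (k + 3)) * primePowerTerm φ L (p ^ (k + 3))
  set D := familyAverage m fun χ => oneLevelDensity χ φ
  have h4 : D - ((∫ y : ℝ, φ y) - 2 * ((L : ℂ)⁻¹ * S₁) - 2 * ((L : ℂ)⁻¹ * S₂)) =
      (D - ((∫ y : ℝ, φ y) - (L : ℂ)⁻¹ * (2 * (S₁ + S₂ + S₃)))) - (L : ℂ)⁻¹ * (2 * S₃) := by ring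
  have h5 : ‖(L : ℂ)⁻¹ * (2 * S₃)‖ ≤ 2 * C₂ / L := by
    rw [norm_mul, norm_mul, norm_inv, Complex.norm_real, Real.norm_of_nonneg hL0.le,
      Complex.norm_ofNat, inv_mul_eq_div]
    gcongr
  calc _ = _ := congrArg norm h4
    _ ≤ C₁ / L + 2 * C₂ / L := (norm_sub_le _ _).trans (add_le_add h2 h5)
    _ = _ := by ring

theorem eventually_primesAtTop {P : ℕ → Prop} (h : ∀ᶠ n in atTop, P n) :
    ∀ᶠ m : Nat.Primes in primesAtTop, P m := tendsto_comap.eventually h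

theorem tendsto_log_div_pi : Tendsto (fun n : ℕ => Real.log (n / Real.pi)) atTop atTop :=
  Real.tendsto_log_atTop.comp (tendsto_natCast_atTop_atTop.atTop_div_const Real.pi_pos)

theorem averaged_explicitFormula {φ : 𝓢(ℝ, ℂ)} {R : ℝ} (hφ : Function.Even φ)
    (h : ∀ ξ, R < |ξ| → (𝓕 φ) ξ = 0) :
    (fun m : Nat.Primes => familyAverage (m : ℕ) (fun χ => oneLevelDensity χ φ) -
      ((∫ y : ℝ, φ y) - 2 * primeSum (m : ℕ) φ - 2 * primeSquareSum (m : ℕ) φ))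
      =O[primesAtTop] fun m : Nat.Primes => 1 / Real.log (m : ℕ) := by
  obtain ⟨C, hC0, hC⟩ := exists_norm_familyAverage_oneLevelDensity_le hφ h
  refine IsBigO.of_bound (2 * C) ?_
  filter_upwards [eventually_primesAtTop (eventually_gt_atTop 2),
    -- With `L ≥ log π` one has `log m ≤ 2L`, which turns `C/L` into `2C/log m`.
    eventually_primesAtTop (tendsto_log_div_pi.eventually_ge_atTop (max 1 (Real.log Real.pi)))]
    with m hm2 hmL
  have hL := (le_max_left _ _).trans hmL
  have hL' := (le_max_right _ _).trans hmL
  refine (hC m m.2 hm2 _ rfl hL).trans ?_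
  have hlog : Real.log (m : ℕ) = Real.log ((m : ℕ) / Real.pi) + Real.log Real.pi := by
    rw [Real.log_div (Nat.cast_ne_zero.mpr m.2.ne_zero) Real.pi_pos.ne']
    ring
  have hlogm : 0 < Real.log (m : ℕ) := Real.log_pos (by exact_mod_cast m.2.one_lt)
  rw [Real.norm_of_nonneg (by positivity), mul_one_div, div_le_div_iff₀ (by linarith) hlogm]
  nlinarith

end AveragedFormula

/-! ### Elementary tools for the prime sums -/

section PrimeSums

/-- Telescoping: `1/√(k+1) ≤ 2√(k+1) - 2√k`. -/
theorem sum_Icc_inv_sqrt_le (K : ℕ) :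
    ∑ n ∈ Finset.Icc 1 K, (Real.sqrt n)⁻¹ ≤ 2 * Real.sqrt K := by
  induction K with
  | zero => simp
  | succ K ih =>
    rw [Finset.sum_Icc_succ_top (by omega)]
    have h1 : 0 < Real.sqrt ((K + 1 : ℕ) : ℝ) := Real.sqrt_pos.mpr (by positivity)
    have h2 := Real.sq_sqrt (Nat.cast_nonneg (α := ℝ) (K + 1))
    have h3 := Real.sq_sqrt (Nat.cast_nonneg (α := ℝ) K)
    have h4 := Real.sqrt_nonneg (K : ℝ)
    set x := Real.sqrt ((K + 1 : ℕ) : ℝ)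
    set y := Real.sqrt (K : ℝ)
    have h5 : x ^ 2 = y ^ 2 + 1 := by rw [h2, h3]; push_cast; ring
    have h6 : x⁻¹ ≤ 2 * x - 2 * y := by
      rw [inv_le_iff_one_le_mul₀ h1]
      nlinarith [sq_nonneg (x - y)]
    linarith

theorem norm_tsum_primes_le {f : Nat.Primes → ℂ} {b : ℕ → ℝ} {s : Finset ℕ} (hb : ∀ n ∈ s, 0 ≤ b n)
    (hf : ∀ p : Nat.Primes, (p : ℕ) ∈ s → ‖f p‖ ≤ b p) (hf0 : ∀ p : Nat.Primes, (p : ℕ) ∉ s → f p = 0) :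
    ‖∑' p, f p‖ ≤ ∑ n ∈ s, b n := by
  classical
  have h1 : ∑' p, f p = ∑ p ∈ s.subtype Nat.Prime, f p :=
    tsum_eq_sum fun p hp => hf0 p fun hps => hp (Finset.mem_subtype.mpr hps)
  rw [h1]
  calc _ ≤ ∑ p ∈ s.subtype Nat.Prime, b (p : ℕ) :=
        norm_sum_le_of_le _ fun p hp => hf p (Finset.mem_subtype.mp hp)
    _ = ∑ n ∈ s with n.Prime, b n := Finset.sum_subtype_eq_sum_filter _
    _ ≤ _ := Finset.sum_le_sum_of_subset_of_nonneg (Finset.filter_subset _ _) fun n hn _ => hb n hn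

end PrimeSums

end OneLevel

/-! ### Bounds for the sums over primes and their squares -/

namespace OneLevel

/-- These `n` are `jm + 1` with `1 ≤ j ≤ K/m`, each contributing at most `1/√(jm)`. The excluded `n
= 1` would contribute `1`. Summing over all integers avoids any input on primes in progressions. -/
theorem sum_Icc_one_mod_inv_sqrt_le {m : ℕ} (hm : 1 < m) (K : ℕ) :
    ∑ n ∈ (Finset.Icc 1 K).filter (fun n : ℕ => (n : ZMod m) = 1 ∧ n ≠ 1), (Real.sqrt n)⁻¹ ≤ 2 * Real.sqrt K / m := by
  classical
  have hm0 : (0 : ℝ) < m := by exact_mod_cast (zero_lt_one.trans hm)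
  have hsub : (Finset.Icc 1 K).filter (fun n : ℕ => (n : ZMod m) = 1 ∧ n ≠ 1) ⊆
      (Finset.Icc 1 (K / m)).image fun j => j * m + 1 := by
    intro n hn
    simp only [Finset.mem_filter, Finset.mem_Icc] at hn
    obtain ⟨⟨h1, hK⟩, hmod, hne⟩ := hn
    have h2 : n ≡ 1 [MOD m] := by
      rw [← ZMod.natCast_eq_natCast_iff, hmod, Nat.cast_one]
    have h3 : m ∣ n - 1 := (Nat.modEq_iff_dvd' h1).mp h2.symm
    obtain ⟨j, hj⟩ := h3
    have hj0 : j ≠ 0 := by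
      rintro rfl
      omega
    refine Finset.mem_image.mpr ⟨j, Finset.mem_Icc.mpr ⟨Nat.one_le_iff_ne_zero.mpr hj0, ?_⟩, ?_⟩
    · rw [Nat.le_div_iff_mul_le (zero_lt_one.trans hm), mul_comm]
      omega
    · rw [mul_comm]; omega
  calc _ ≤ ∑ n ∈ (Finset.Icc 1 (K / m)).image (fun j => j * m + 1), (Real.sqrt n)⁻¹ :=
        Finset.sum_le_sum_of_subset_of_nonneg hsub fun _ _ _ => by positivity
    _ = ∑ j ∈ Finset.Icc 1 (K / m), (Real.sqrt ((j * m + 1 : ℕ) : ℝ))⁻¹ :=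
        Finset.sum_image fun a _ b _ hab => by
          have := Nat.succ_injective hab
          exact Nat.eq_of_mul_eq_mul_right (zero_lt_one.trans hm) this
    _ ≤ ∑ j ∈ Finset.Icc 1 (K / m), (Real.sqrt m)⁻¹ * (Real.sqrt j)⁻¹ := by
        refine Finset.sum_le_sum fun j hj => ?_
        have hj1 : (0 : ℝ) < j := by exact_mod_cast (Finset.mem_Icc.mp hj).1
        rw [← mul_inv, ← Real.sqrt_mul hm0.le]
        refine inv_anti₀ (Real.sqrt_pos.mpr (by positivity)) (Real.sqrt_le_sqrt ?_)
        push_cast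
        linarith
    _ = (Real.sqrt m)⁻¹ * ∑ j ∈ Finset.Icc 1 (K / m), (Real.sqrt j)⁻¹ := by rw [Finset.mul_sum]
    _ ≤ (Real.sqrt m)⁻¹ * (2 * Real.sqrt ((K / m : ℕ) : ℝ)) :=
        mul_le_mul_of_nonneg_left (sum_Icc_inv_sqrt_le _) (by positivity)
    _ ≤ (Real.sqrt m)⁻¹ * (2 * (Real.sqrt K / Real.sqrt m)) := by
        rw [← Real.sqrt_div (Nat.cast_nonneg _)]
        gcongr
        exact Nat.cast_div_le
    _ = _ := by
        have h1 := Real.mul_self_sqrt hm0.le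
        have h2 : (m : ℝ)⁻¹ = (Real.sqrt m)⁻¹ * (Real.sqrt m)⁻¹ := by rw [← mul_inv, h1]
        rw [div_eq_mul_inv _ (m : ℝ), h2]
        ring

variable {φ : 𝓢(ℝ, ℂ)} {σ B : ℝ}

/-- The support cuts the sum at `K = ⌊(m/π)^σ⌋` and gives `log p / L ≤ σ ≤ 2`. A prime is weighted
by `1/(m-2) ≤ 3/m`, plus `1` if it is congruent to `1`; the total is `2B(6 + 2)√K/m`. -/
theorem norm_primeSum_le (hσ : σ < 2) (hσ0 : 0 ≤ σ) (h : ∀ ξ, σ < |ξ| → (𝓕 φ) ξ = 0)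
    (hB : ∀ ξ, ‖(𝓕 φ) ξ‖ ≤ B) {m : ℕ} [NeZero m] (hm : m.Prime) (hm2 : 2 < m)
    (hL : 1 ≤ Real.log (m / Real.pi)) :
    ‖primeSum m φ‖ ≤ 16 * B * (m : ℝ) ^ (σ / 2 - 1) := by
  classical
  set L := Real.log (m / Real.pi) with hLdef
  have hL0 : 0 < L := by linarith
  have hB0 : 0 ≤ B := (norm_nonneg _).trans (hB 0)
  have hm3 : (3 : ℝ) ≤ m := by exact_mod_cast hm2
  have hm0 : (0 : ℝ) < m := by linarith
  have hπ := Real.pi_pos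
  set K := ⌊Real.exp (σ * L)⌋₊
  set ε : ℕ → ℝ := fun n => if (n : ZMod m) = 1 ∧ n ≠ 1 then 1 else 0 with hε
  have hε0 : ∀ n, 0 ≤ ε n := fun n => by simp only [hε]; split_ifs <;> norm_num
  have hi0 : 0 ≤ ((m : ℝ) - 2)⁻¹ := inv_nonneg.mpr (by linarith)
  have h1 : ‖primeSum m φ‖ ≤ ∑ n ∈ Finset.Icc 1 K,
      2 * B * (((m : ℝ) - 2)⁻¹ * (Real.sqrt n)⁻¹ + ε n * (Real.sqrt n)⁻¹) := by
    refine norm_tsum_primes_le (fun n _ => ?_) (fun p hp => ?_) fun p hp => ?_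
    · have := hε0 n
      positivity
    · have hp0 : (0 : ℝ) < p := by exact_mod_cast p.2.pos
      have hlog : Real.log p ≤ 2 * L := by
        have h2 : (p : ℝ) ≤ Real.exp (σ * L) :=
          (Nat.le_floor_iff (Real.exp_pos _).le).mp (Finset.mem_Icc.mp hp).2
        have h3 := (Real.log_le_iff_le_exp hp0).mpr h2
        nlinarith
      have ha : ‖familyAverage m (fun χ => χ ((p : ℕ) : ZMod m))‖ ≤ ((m : ℝ) - 2)⁻¹ + ε p := by
        by_cases hp1 : ((p : ℕ) : ZMod m) = 1
        · have : ε p = 1 := if_pos ⟨hp1, p.2.ne_one⟩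
          rw [this]
          exact (norm_familyAverage_apply_le_one hm hm2 _).trans (by linarith)
        · exact (norm_familyAverage_apply_le hm hm2 hp1).trans (by linarith [hε0 p])
      have hc : ‖((Real.log p / (Real.sqrt p * L) : ℝ) : ℂ)‖ ≤ 2 * (Real.sqrt p)⁻¹ := by
        have hs := Real.sqrt_pos.mpr hp0
        rw [Complex.norm_real, Real.norm_of_nonneg
          (div_nonneg (Real.log_natCast_nonneg _) (by positivity)), div_le_iff₀ (by positivity)]
        calc _ ≤ 2 * L := hlog
          _ = _ := by field_simp
      rw [norm_mul, norm_mul]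
      calc _ ≤ 2 * (Real.sqrt p)⁻¹ * B * (((m : ℝ) - 2)⁻¹ + ε p) := by
            refine mul_le_mul (mul_le_mul hc (hB _) (norm_nonneg _) (by positivity)) ha
              (norm_nonneg _) (by positivity)
        _ = _ := by ring
    · have hp' : Real.exp (σ * L) < p := by
        by_contra! hcon
        exact hp (Finset.mem_Icc.mpr ⟨p.2.one_le, Nat.le_floor hcon⟩)
      have h2 : σ < Real.log p / L := by
        rw [lt_div_iff₀ hL0]
        exact (Real.lt_log_iff_exp_lt ((Real.exp_pos _).trans hp')).mpr hp'
      rw [h _ (h2.trans_le (le_abs_self _)), mul_zero, zero_mul]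
  have h2 : ∑ n ∈ Finset.Icc 1 K, ε n * (Real.sqrt n)⁻¹ ≤ 2 * Real.sqrt K / m := by
    refine le_trans (le_of_eq ?_) (sum_Icc_one_mod_inv_sqrt_le (by omega : 1 < m) K)
    rw [Finset.sum_filter]
    refine Finset.sum_congr rfl fun n _ => ?_
    simp only [hε, ite_mul, one_mul, zero_mul]
  have h3 : Real.sqrt K ≤ (m : ℝ) ^ (σ / 2) := by
    calc Real.sqrt K ≤ Real.sqrt (Real.exp (σ * L)) :=
          Real.sqrt_le_sqrt (Nat.floor_le (Real.exp_pos _).le)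
      _ = ((m : ℝ) / Real.pi) ^ (σ / 2) := by
          rw [← Real.exp_half, Real.rpow_def_of_pos (by positivity)]
          congr 1
          rw [hLdef]; ring
      _ ≤ _ := by
          refine Real.rpow_le_rpow (by positivity) (div_le_self hm0.le ?_) (by linarith)
          linarith [Real.pi_gt_three]
  have h4 : ((m : ℝ) - 2)⁻¹ ≤ 3 / m := by
    rw [inv_le_comm₀ (by linarith) (by positivity), inv_div]
    linarith
  have h5 := sum_Icc_inv_sqrt_le K
  have h6 : (m : ℝ) ^ (σ / 2 - 1) = (m : ℝ) ^ (σ / 2) / m := by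
    rw [Real.rpow_sub_one hm0.ne']
  refine h1.trans ?_
  rw [← Finset.mul_sum, Finset.sum_add_distrib, ← Finset.mul_sum, h6]
  calc _ ≤ 2 * B * (3 / m * (2 * Real.sqrt K) + 2 * Real.sqrt K / m) := by gcongr
    _ = 16 * B * (Real.sqrt K / m) := by ring
    _ ≤ _ := by gcongr

/-- If `p > m/2` then `p > m/π`, so `2 log p / L ≥ 2` is outside the support. If `p ≤ m/2` then `p`
is not `±1` mod `m`, so `p²` is never the residue `1` and every average is at most `1/(m-2)`. -/
theorem norm_primeSquareSum_le (hσ : σ < 2) (h : ∀ ξ, σ < |ξ| → (𝓕 φ) ξ = 0)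
    (hB : ∀ ξ, ‖(𝓕 φ) ξ‖ ≤ B) {m : ℕ} [NeZero m] (hm : m.Prime) (hm2 : 2 < m)
    (hL : 1 ≤ Real.log (m / Real.pi)) :
    ‖primeSquareSum m φ‖ ≤ 24 * B * (Real.sqrt m)⁻¹ := by
  have : Fact m.Prime := ⟨hm⟩
  set L := Real.log (m / Real.pi) with hLdef
  have hL0 : 0 < L := by linarith
  have hB0 : 0 ≤ B := (norm_nonneg _).trans (hB 0)
  have hm3 : (3 : ℝ) ≤ m := by exact_mod_cast hm2
  have hm0 : (0 : ℝ) < m := by linarith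
  have hπ := Real.pi_gt_three
  have hi0 : 0 ≤ ((m : ℝ) - 2)⁻¹ := inv_nonneg.mpr (by linarith)
  have h1 : ‖primeSquareSum m φ‖ ≤ ∑ n ∈ Finset.Icc 1 (m / 2),
      4 * B * ((m : ℝ) - 2)⁻¹ * (Real.sqrt n)⁻¹ := by
    refine norm_tsum_primes_le (fun n _ => by positivity) (fun p hp => ?_) fun p hp => ?_
    · have hp0 : (0 : ℝ) < p := by exact_mod_cast p.2.pos
      have hpm : 2 * (p : ℕ) ≤ m := by
        have := (Finset.mem_Icc.mp hp).2
        omega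
      -- `log m = L + log π`, with `log π ≤ π - 1 < 3` and `L ≥ 1`.
      have hlog : Real.log p ≤ 4 * L := by
        have h2 : Real.log p ≤ Real.log m :=
          Real.log_le_log hp0 (by exact_mod_cast (by omega : (p : ℕ) ≤ m))
        have h3 : Real.log m = L + Real.log Real.pi := by
          rw [hLdef, Real.log_div hm0.ne' Real.pi_pos.ne']
          ring
        have h4 := Real.log_le_sub_one_of_pos Real.pi_pos
        linarith [Real.pi_lt_four]
      have hp2 : ((p : ℕ) : ZMod m) ^ 2 ≠ 1 := fun hcon => by
        have hp1 := p.2.one_lt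
        rw [sq, mul_self_eq_one_iff] at hcon
        rcases hcon with h2 | h2
        · rw [← Nat.cast_one, ZMod.natCast_eq_natCast_iff', Nat.mod_eq_of_lt (by omega),
            Nat.mod_eq_of_lt (by omega)] at h2
          omega
        · rw [eq_neg_iff_add_eq_zero, ← Nat.cast_one, ← Nat.cast_add,
            ZMod.natCast_eq_zero_iff] at h2
          have := Nat.le_of_dvd (by omega) h2
          omega
      have ha : ‖familyAverage m (fun χ => (χ ^ 2) ((p : ℕ) : ZMod m))‖ ≤ ((m : ℝ) - 2)⁻¹ := by
        have e := familyAverage_congr (m := m) (F := fun χ => (χ ^ 2) ((p : ℕ) : ZMod m))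
          (G := fun χ => χ (((p : ℕ) : ZMod m) ^ 2)) fun χ _ => by
            rw [MulChar.pow_apply' χ two_ne_zero, map_pow]
        rw [e]
        exact norm_familyAverage_apply_le hm hm2 hp2
      have hc : ‖((Real.log p / (p * L) : ℝ) : ℂ)‖ ≤ 4 * (Real.sqrt p)⁻¹ := by
        have hs := Real.sqrt_pos.mpr hp0
        rw [Complex.norm_real, Real.norm_of_nonneg
          (div_nonneg (Real.log_natCast_nonneg _) (by positivity))]
        have hsp : Real.sqrt p ≤ p := by
          rw [Real.sqrt_le_left hp0.le]
          have : (1 : ℝ) ≤ p := by exact_mod_cast p.2.one_le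
          nlinarith
        calc _ ≤ 4 * L / (p * L) := by gcongr
          _ = 4 * (p : ℝ)⁻¹ := by field_simp
          _ ≤ _ := by gcongr
      rw [norm_mul, norm_mul]
      calc _ ≤ 4 * (Real.sqrt p)⁻¹ * B * ((m : ℝ) - 2)⁻¹ := by
            refine mul_le_mul (mul_le_mul hc (hB _) (norm_nonneg _) (by positivity)) ha
              (norm_nonneg _) (by positivity)
        _ = _ := by ring
    · have hp0 : (0 : ℝ) < p := by exact_mod_cast p.2.pos
      have hp' : m < 2 * (p : ℕ) := by
        by_contra! hcon
        exact hp (Finset.mem_Icc.mpr ⟨p.2.one_le, by omega⟩)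
      have h2 : L ≤ Real.log p := by
        refine Real.log_le_log (by positivity) ?_
        rw [div_le_iff₀ Real.pi_pos]
        have : (m : ℝ) < 2 * p := by exact_mod_cast hp'
        nlinarith
      have h3 : σ < 2 * Real.log p / L := by
        rw [lt_div_iff₀ hL0]
        nlinarith
      rw [h _ (h3.trans_le (le_abs_self _)), mul_zero, zero_mul]
  have h4 : ((m : ℝ) - 2)⁻¹ ≤ 3 / m := by
    rw [inv_le_comm₀ (by linarith) (by positivity), inv_div]
    linarith
  have h5 : ∑ n ∈ Finset.Icc 1 (m / 2), (Real.sqrt n)⁻¹ ≤ 2 * Real.sqrt m :=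
    (sum_Icc_inv_sqrt_le _).trans (mul_le_mul_of_nonneg_left
      (Real.sqrt_le_sqrt (by exact_mod_cast Nat.div_le_self _ _)) zero_le_two)
  refine h1.trans ?_
  rw [← Finset.mul_sum]
  calc _ ≤ 4 * B * (3 / m) * (2 * Real.sqrt m) := by gcongr
    _ = 24 * B * (Real.sqrt m / m) := by ring
    _ = _ := by rw [Real.sqrt_div_self']; ring

theorem primeSum_isBigO (hσ : σ < 2) (h : ∀ ξ, σ ≤ |ξ| → (𝓕 φ) ξ = 0) :
    (fun m : Nat.Primes => -2 * primeSum (m : ℕ) φ)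
      =O[primesAtTop] fun m : Nat.Primes => ((m : ℕ) : ℝ) ^ (σ / 2 - 1) := by
  -- For negative `σ` the support condition makes `φ̂` vanish identically.
  rcases lt_or_ge σ 0 with hσ0 | hσ0
  · have h0 : ∀ m : Nat.Primes, -2 * primeSum (m : ℕ) φ = 0 := fun m => by
      have : ∀ ξ, (𝓕 φ) ξ = 0 := fun ξ => h ξ (hσ0.le.trans (abs_nonneg ξ))
      simp [primeSum, this]
    simp only [h0]
    exact isBigO_zero _ _
  · obtain ⟨B, hB0, hB⟩ := exists_norm_fourier_le φ
    refine IsBigO.of_bound (32 * B) ?_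
    filter_upwards [eventually_primesAtTop (eventually_gt_atTop 2),
      eventually_primesAtTop (tendsto_log_div_pi.eventually_ge_atTop 1)] with m hm2 hmL
    have h1 := norm_primeSum_le hσ hσ0 (fun ξ hξ => h ξ hξ.le) hB m.2 hm2 hmL
    rw [norm_mul, norm_neg, Complex.norm_ofNat, Real.norm_of_nonneg (by positivity)]
    linarith

theorem tendsto_natCast_primesAtTop :
    Tendsto (fun m : Nat.Primes => ((m : ℕ) : ℝ)) primesAtTop atTop :=
  tendsto_natCast_atTop_atTop.comp tendsto_comap

theorem tendsto_primeSum (hσ : σ < 2) (h : ∀ ξ, σ ≤ |ξ| → (𝓕 φ) ξ = 0) :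
    Tendsto (fun m : Nat.Primes => -2 * primeSum (m : ℕ) φ) primesAtTop (𝓝 0) := by
  refine (primeSum_isBigO hσ h).trans_tendsto ?_
  have h1 := (tendsto_rpow_neg_atTop (y := 1 - σ / 2) (by linarith)).comp
    tendsto_natCast_primesAtTop
  refine h1.congr fun m => ?_
  simp [Function.comp]

theorem tendsto_primeSquareSum (hσ : σ < 2) (h : ∀ ξ, σ ≤ |ξ| → (𝓕 φ) ξ = 0) :
    Tendsto (fun m : Nat.Primes => primeSquareSum (m : ℕ) φ) primesAtTop (𝓝 0) := by
  obtain ⟨B, hB0, hB⟩ := exists_norm_fourier_le φ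
  refine squeeze_zero_norm' (a := fun m : Nat.Primes => 24 * B * (Real.sqrt (m : ℕ))⁻¹) ?_ ?_
  · filter_upwards [eventually_primesAtTop (eventually_gt_atTop 2),
      eventually_primesAtTop (tendsto_log_div_pi.eventually_ge_atTop 1)] with m hm2 hmL
    exact norm_primeSquareSum_le hσ (fun ξ hξ => h ξ hξ.le) hB m.2 hm2 hmL
  · have h1 := (Real.tendsto_sqrt_atTop.comp tendsto_natCast_primesAtTop).inv_tendsto_atTop
    simpa using h1.const_mul (24 * B)

theorem tendsto_familyAverage_oneLevelDensity (hφ : Function.Even φ) (hσ : σ < 2)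
    (h : ∀ ξ, σ ≤ |ξ| → (𝓕 φ) ξ = 0) :
    Tendsto (fun m : Nat.Primes => familyAverage (m : ℕ) (fun χ => oneLevelDensity χ φ))
      primesAtTop (𝓝 (∫ y : ℝ, φ y)) := by
  have h1 : Tendsto (fun m : Nat.Primes => 1 / Real.log (m : ℕ)) primesAtTop (𝓝 0) := by
    simp only [one_div]
    exact (Real.tendsto_log_atTop.comp tendsto_natCast_primesAtTop).inv_tendsto_atTop
  have h2 := (averaged_explicitFormula hφ (R := σ) fun ξ hξ => h ξ hξ.le).trans_tendsto h1
  have h3 := ((h2.add (tendsto_primeSum hσ h)).sub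
    ((tendsto_primeSquareSum hσ h).const_mul 2)).add_const (∫ y : ℝ, φ y)
  simp only [mul_zero, add_zero, sub_zero, zero_add] at h3
  refine h3.congr fun m => ?_
  ring

end OneLevel

/-! ### Eigenvalues of matrix powers -/

namespace OneLevel

section MatrixRoots

open Polynomial

variable {n : Type*} [Fintype n] [DecidableEq n]

theorem charpoly_eq_prod_roots (A : Matrix n n ℂ) :
    A.charpoly = (A.charpoly.roots.map fun z => X - C z).prod :=
  (IsAlgClosed.splits A.charpoly).eq_prod_roots_of_monic A.charpoly_monic

theorem card_roots_charpoly (A : Matrix n n ℂ) :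
    Multiset.card A.charpoly.roots = Fintype.card n := by
  rw [← (IsAlgClosed.splits A.charpoly).natDegree_eq_card_roots, Matrix.charpoly_natDegree_eq_dim]

/-- Both sides are multiplicative in `p`, and over `ℂ` every `p` is a constant times linear factors;
for `X - C c` this is the characteristic polynomial at `c` up to sign. -/
theorem det_aeval_eq_prod_roots (A : Matrix n n ℂ) (p : ℂ[X]) :
    (aeval A p).det = (A.charpoly.roots.map fun z => p.eval z).prod := by
  have hmul : ∀ p q : ℂ[X], (aeval A p).det = (A.charpoly.roots.map fun z => p.eval z).prod →
      (aeval A q).det = (A.charpoly.roots.map fun z => q.eval z).prod →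
      (aeval A (p * q)).det = (A.charpoly.roots.map fun z => (p * q).eval z).prod := by
    intro p q hp hq
    simp only [map_mul, Matrix.det_mul, hp, hq, eval_mul, Multiset.prod_map_mul]
  have hC : ∀ c : ℂ, (aeval A (C c)).det = (A.charpoly.roots.map fun z => (C c).eval z).prod := by
    intro c
    rw [aeval_C, Matrix.algebraMap_eq_diagonal, Matrix.det_diagonal]
    simp [card_roots_charpoly]
  have hX : ∀ c : ℂ, (aeval A (X - C c)).det =
      (A.charpoly.roots.map fun z => (X - C c).eval z).prod := by
    intro c
    have h1 := congrArg (Polynomial.eval c) (charpoly_eq_prod_roots A)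
    rw [Matrix.eval_charpoly, eval_multiset_prod, Multiset.map_map] at h1
    have h2 : aeval A (X - C c) = -(Matrix.scalar n c - A) := by
      rw [map_sub, aeval_X, aeval_C, neg_sub]
      rfl
    rw [h2, Matrix.det_neg, h1, ← card_roots_charpoly A,
      ← Multiset.card_map (eval c ∘ fun z => X - C z), ← Multiset.prod_map_neg, Multiset.map_map]
    simp
  rw [(IsAlgClosed.splits p).eq_prod_roots]
  refine hmul _ _ (hC _) ?_
  induction p.roots using Multiset.induction with
  | empty => simp
  | cons a s ih =>
    rw [Multiset.map_cons, Multiset.prod_cons]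
    exact hmul _ _ (hX a) ih

/-- The determinant formula for `x - X^k` identifies the eigenvalues of `A ^ k`, with multiplicity,
as the `k`-th powers of those of `A`. -/
theorem trace_pow_eq_sum_roots (A : Matrix n n ℂ) (k : ℕ) :
    (A ^ k).trace = (A.charpoly.roots.map fun z => z ^ k).sum := by
  have h1 : (A ^ k).charpoly = ((A.charpoly.roots.map fun z => z ^ k).map fun z => X - C z).prod := by
    refine Polynomial.funext fun x => ?_
    have h2 := det_aeval_eq_prod_roots A (C x - X ^ k)
    rw [Matrix.eval_charpoly, eval_multiset_prod, Multiset.map_map, Multiset.map_map]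
    rw [map_sub, aeval_C, map_pow, aeval_X] at h2
    refine Eq.trans h2 ?_
    simp
  rw [Matrix.trace_eq_sum_roots_charpoly, h1, roots_multiset_prod_X_sub_C]

open scoped Matrix.Norms.L2Operator in
theorem norm_eq_one_of_mem_roots_charpoly {U : Matrix n n ℂ} (hU : U ∈ Matrix.unitaryGroup n ℂ)
    {z : ℂ} (hz : z ∈ U.charpoly.roots) : ‖z‖ = 1 := by
  have h1 := Matrix.mem_spectrum_of_isRoot_charpoly (isRoot_of_mem_roots hz)
  simpa using spectrum.subset_circle_of_unitary (E := Matrix n n ℂ) hU h1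

end MatrixRoots

/-! ### Linear statistics of Haar-random unitary matrices -/

section UnitaryGroup

variable {N : ℕ}

/-- The linear statistic `∑_j F(θ_j / 2π)` of the eigenvalues `e^{iθ_j}` of a unitary matrix. -/
noncomputable def eigenSum (F : UnitAddCircle → ℂ) (U : Matrix.unitaryGroup (Fin N) ℂ) : ℂ :=
  ((U : Matrix (Fin N) (Fin N) ℂ).charpoly.roots.map
    fun z => F ((Complex.arg z / (2 * Real.pi) : ℝ) : UnitAddCircle)).sum

theorem eigenSum_add (F G : UnitAddCircle → ℂ) (U : Matrix.unitaryGroup (Fin N) ℂ) :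
    eigenSum (F + G) U = eigenSum F U + eigenSum G U := by
  simp [eigenSum]

theorem eigenSum_smul (c : ℂ) (F : UnitAddCircle → ℂ) (U : Matrix.unitaryGroup (Fin N) ℂ) :
    eigenSum (c • F) U = c * eigenSum F U := by
  simp [eigenSum, Multiset.sum_map_mul_left]

theorem norm_eigenSum_le (F : C(UnitAddCircle, ℂ)) (U : Matrix.unitaryGroup (Fin N) ℂ) :
    ‖eigenSum F U‖ ≤ N * ‖F‖ := by
  unfold eigenSum
  refine (norm_multiset_sum_le _).trans ?_
  rw [Multiset.map_map]
  refine (Multiset.sum_le_card_nsmul _ ‖F‖ fun x hx => ?_).trans ?_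
  · simp only [Multiset.mem_map, Function.comp_apply] at hx
    obtain ⟨z, -, rfl⟩ := hx
    exact F.norm_coe_le_norm _
  · simp [card_roots_charpoly]

theorem fourier_arg {z : ℂ} (hz : ‖z‖ = 1) (k : ℕ) :
    (fourier (k : ℤ) ((Complex.arg z / (2 * Real.pi) : ℝ) : UnitAddCircle) : ℂ) = z ^ k := by
  have h1 : z = Complex.exp (Complex.arg z * Complex.I) := by
    conv_lhs => rw [← Complex.norm_mul_exp_arg_mul_I z, hz]
    simp
  rw [fourier_coe_apply]
  conv_rhs => rw [h1, ← Complex.exp_nat_mul]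
  congr 1
  have := Real.pi_ne_zero
  push_cast
  field_simp

theorem eigenSum_fourier_natCast (k : ℕ) (U : Matrix.unitaryGroup (Fin N) ℂ) :
    eigenSum (fourier (k : ℤ)) U = ((U : Matrix (Fin N) (Fin N) ℂ) ^ k).trace := by
  rw [trace_pow_eq_sum_roots, eigenSum]
  congr 1
  exact Multiset.map_congr rfl fun z hz =>
    fourier_arg (norm_eq_one_of_mem_roots_charpoly U.2 hz) k

theorem eigenSum_fourier_neg (k : ℤ) (U : Matrix.unitaryGroup (Fin N) ℂ) :
    eigenSum (fourier (-k)) U = (starRingEnd ℂ) (eigenSum (fourier k) U) := by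
  simp [eigenSum, map_multiset_sum]

instance unitaryHaar_isHaarMeasure (N : ℕ) : (unitaryHaar N).IsHaarMeasure := by
  unfold unitaryHaar
  infer_instance

instance unitaryHaar_isProbabilityMeasure (N : ℕ) : IsProbabilityMeasure (unitaryHaar N) :=
  ⟨Measure.haarMeasure_self⟩

/-- The scalar unitary matrices. -/
noncomputable def scalarUnitary (N : ℕ) (c : Circle) : Matrix.unitaryGroup (Fin N) ℂ :=
  ⟨Matrix.scalar (Fin N) (c : ℂ), by
    rw [Matrix.mem_unitaryGroup_iff, Matrix.star_eq_conjTranspose, Matrix.scalar_apply,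
      Matrix.diagonal_conjTranspose, Matrix.diagonal_mul_diagonal, ← Matrix.diagonal_one]
    congr 1
    funext i
    rw [Pi.star_apply, Complex.star_def, Complex.mul_conj, Complex.normSq_eq_norm_sq, c.norm_coe]
    simp⟩

theorem continuous_trace_pow (k : ℕ) : Continuous fun U : Matrix.unitaryGroup (Fin N) ℂ =>
    ((U : Matrix (Fin N) (Fin N) ℂ) ^ k).trace :=
  (continuous_subtype_val.pow k).matrix_trace

/-- Translation by the scalar `e^(iπ/k)` preserves Haar measure and changes the sign of `tr U^k`. -/
theorem integral_trace_pow {k : ℕ} (hk : k ≠ 0) :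
    ∫ U : Matrix.unitaryGroup (Fin N) ℂ, ((U : Matrix (Fin N) (Fin N) ℂ) ^ k).trace
      ∂(unitaryHaar N) = 0 := by
  set c : Circle := Circle.exp (Real.pi / k)
  have hc : (c : ℂ) ^ k = -1 := by
    rw [Circle.coe_exp, ← Complex.exp_nat_mul, ← Complex.exp_pi_mul_I]
    congr 1
    have : (k : ℂ) ≠ 0 := Nat.cast_ne_zero.mpr hk
    push_cast
    field_simp
  have h1 := integral_mul_left_eq_self (μ := unitaryHaar N)
    (fun U : Matrix.unitaryGroup (Fin N) ℂ => ((U : Matrix (Fin N) (Fin N) ℂ) ^ k).trace)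
    (scalarUnitary N c)
  have h2 : ∀ U : Matrix.unitaryGroup (Fin N) ℂ,
      (((scalarUnitary N c * U : Matrix.unitaryGroup (Fin N) ℂ) :
        Matrix (Fin N) (Fin N) ℂ) ^ k).trace = -((U : Matrix (Fin N) (Fin N) ℂ) ^ k).trace := by
    intro U
    have h3 : ((scalarUnitary N c * U : Matrix.unitaryGroup (Fin N) ℂ) :
        Matrix (Fin N) (Fin N) ℂ) = (c : ℂ) • (U : Matrix (Fin N) (Fin N) ℂ) := by
      rw [Submonoid.coe_mul, Matrix.smul_eq_diagonal_mul]
      rfl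
    rw [h3, smul_pow, hc, Matrix.trace_smul, neg_one_smul]
  simp only [h2, integral_neg] at h1
  exact self_eq_neg.mp h1.symm

theorem eigenSum_fourier (n : ℤ) : Continuous (eigenSum (N := N) (fourier n)) ∧
    ∫ U, eigenSum (fourier n) U ∂(unitaryHaar N) = 
      N * ∫ x : UnitAddCircle, fourier n x ∂AddCircle.haarAddCircle := by
  have hint : ∫ x : UnitAddCircle, (fourier n x : ℂ) ∂AddCircle.haarAddCircle =
      if n = 0 then 1 else 0 := by
    have h1 := congrFun (fourierCoeff_fourier (T := 1) n) 0
    simpa [fourierCoeff, Pi.single_apply, eq_comm] using h1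
  have hnat : ∀ k : ℕ, eigenSum (N := N) (fourier (k : ℤ)) =
      fun U : Matrix.unitaryGroup (Fin N) ℂ => ((U : Matrix (Fin N) (Fin N) ℂ) ^ k).trace := fun k =>
    funext fun U => eigenSum_fourier_natCast k U
  have hneg : ∀ k : ℕ, eigenSum (N := N) (fourier (-(k : ℤ))) =
      fun U : Matrix.unitaryGroup (Fin N) ℂ => (starRingEnd ℂ) ((U : Matrix (Fin N) (Fin N) ℂ) ^ k).trace := fun k =>
    funext fun U => by rw [eigenSum_fourier_neg, eigenSum_fourier_natCast]
  rw [hint]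
  obtain ⟨k, rfl | rfl⟩ := n.eq_nat_or_neg
  · refine ⟨by rw [hnat]; exact continuous_trace_pow k, ?_⟩
    rw [hnat]
    rcases eq_or_ne k 0 with rfl | hk
    · simp
    · rw [integral_trace_pow hk]
      simp [hk]
  · refine ⟨by rw [hneg]; exact Complex.continuous_conj.comp (continuous_trace_pow k), ?_⟩
    rw [hneg, integral_conj]
    rcases eq_or_ne k 0 with rfl | hk
    · simp
    · rw [integral_trace_pow hk]
      simp [hk]

/-- Both sides are linear in `F` and bounded by `N‖F‖`, so agreement on Fourier modes passes to
uniform limits, that is, to all continuous `F`. Continuity in `U` is carried along to secure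
integrability, since `arg` itself jumps. -/
theorem integral_eigenSum (F : C(UnitAddCircle, ℂ)) : Continuous (eigenSum (N := N) F) ∧
    ∫ U, eigenSum F U ∂(unitaryHaar N) = N * ∫ x, F x ∂AddCircle.haarAddCircle := by
  have hFi : ∀ F : C(UnitAddCircle, ℂ), Integrable F AddCircle.haarAddCircle := fun F =>
    F.continuous.integrable_of_hasCompactSupport (HasCompactSupport.of_compactSpace _)
  have hEi : ∀ {F : C(UnitAddCircle, ℂ)}, Continuous (eigenSum (N := N) F) →
      Integrable (eigenSum (N := N) F) (unitaryHaar N) := fun h =>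
    h.integrable_of_hasCompactSupport (HasCompactSupport.of_compactSpace _)
  let S : Submodule ℂ C(UnitAddCircle, ℂ) :=
    { carrier := {F | Continuous (eigenSum (N := N) F) ∧
        ∫ U, eigenSum F U ∂(unitaryHaar N) = N * ∫ x, F x ∂AddCircle.haarAddCircle}
      zero_mem' := by
        have : eigenSum (N := N) (0 : C(UnitAddCircle, ℂ)) = fun _ => 0 := by
          funext U; simp [eigenSum]
        refine ⟨by rw [this]; exact continuous_const, ?_⟩
        rw [this]; simp
      add_mem' := by
        rintro F G ⟨hF, hF'⟩ ⟨hG, hG'⟩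
        have : eigenSum (N := N) (F + G : C(UnitAddCircle, ℂ)) =
            fun U => eigenSum F U + eigenSum G U := by
          funext U; exact eigenSum_add F G U
        refine ⟨by rw [this]; exact hF.add hG, ?_⟩
        rw [this, integral_add (hEi hF) (hEi hG), hF', hG', ← mul_add,
          ← integral_add (hFi F) (hFi G)]
        rfl
      smul_mem' := by
        rintro c F ⟨hF, hF'⟩
        have : eigenSum (N := N) (c • F : C(UnitAddCircle, ℂ)) =
            fun U => c * eigenSum F U := by
          funext U; exact eigenSum_smul c F U
        refine ⟨by rw [this]; exact continuous_const.mul hF, ?_⟩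
        rw [this, integral_const_mul, hF']
        simp only [ContinuousMap.coe_smul, Pi.smul_apply, smul_eq_mul, integral_const_mul]
        ring }
  have hsub : ∀ F G : C(UnitAddCircle, ℂ), ∀ U : Matrix.unitaryGroup (Fin N) ℂ,
      eigenSum (F - G : C(UnitAddCircle, ℂ)) U = eigenSum F U - eigenSum G U := fun F G U => by
    simp [eigenSum]
  have hclosed : IsClosed (S : Set C(UnitAddCircle, ℂ)) := by
    refine IsSeqClosed.isClosed fun G F hG hGF => ?_
    have hlim : Tendsto (fun k => (N : ℝ) * ‖F - G k‖) atTop (𝓝 0) := by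
      simpa using ((tendsto_const_nhds (x := F)).sub hGF).norm.const_mul (N : ℝ)
    have hc : Continuous (eigenSum (N := N) F) := by
      have hu : TendstoUniformly (fun k => eigenSum (N := N) (G k)) (eigenSum F) atTop := by
        rw [Metric.tendstoUniformly_iff]
        intro ε hε
        filter_upwards [hlim.eventually_lt_const hε] with k hk U
        rw [dist_eq_norm, ← hsub]
        exact (norm_eigenSum_le _ _).trans_lt hk
      exact hu.continuous (Frequently.of_forall fun k => (hG k).1)
    refine ⟨hc, ?_⟩
    have hbound : ∀ k, ‖(∫ U, eigenSum F U ∂(unitaryHaar N)) -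
        N * ∫ x, F x ∂AddCircle.haarAddCircle‖ ≤ N * ‖F - G k‖ + N * ‖F - G k‖ := fun k => by
      have h1 : (∫ U, eigenSum F U ∂(unitaryHaar N)) -
          N * ∫ x, F x ∂AddCircle.haarAddCircle =
          (∫ U, eigenSum (F - G k : C(UnitAddCircle, ℂ)) U ∂(unitaryHaar N)) -
          N * ∫ x, (F - G k : C(UnitAddCircle, ℂ)) x ∂AddCircle.haarAddCircle := by
        simp only [hsub]
        simp only [ContinuousMap.coe_sub, Pi.sub_apply]
        rw [integral_sub (hEi hc) (hEi (hG k).1), integral_sub (hFi F) (hFi (G k)), (hG k).2]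
        ring
      rw [h1]
      refine (norm_sub_le _ _).trans (add_le_add ?_ ?_)
      · simpa using norm_integral_le_of_norm_le_const (μ := unitaryHaar N)
          (.of_forall fun U => norm_eigenSum_le (F - G k) U)
      · rw [norm_mul, Complex.norm_natCast]
        refine mul_le_mul_of_nonneg_left ?_ (Nat.cast_nonneg N)
        simpa using norm_integral_le_of_norm_le_const
          (μ := (AddCircle.haarAddCircle : Measure UnitAddCircle))
          (.of_forall fun x => (F - G k).norm_coe_le_norm x)
    have h0 : ‖(∫ U, eigenSum F U ∂(unitaryHaar N)) -
        N * ∫ x, F x ∂AddCircle.haarAddCircle‖ ≤ 0 :=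
      ge_of_tendsto' (by simpa using hlim.add hlim) hbound
    exact sub_eq_zero.mp (norm_le_zero_iff.mp h0)
  have hspan : Submodule.span ℂ (Set.range (fourier (T := 1))) ≤ S := by
    rw [Submodule.span_le]
    rintro _ ⟨n, rfl⟩
    exact eigenSum_fourier n
  have htop : (⊤ : Submodule ℂ C(UnitAddCircle, ℂ)) ≤ S := by
    rw [← span_fourier_closure_eq_top]
    exact Submodule.topologicalClosure_minimal _ hspan hclosed
  exact htop (Submodule.mem_top (x := F))

theorem unitaryOneLevelDensity_eq {φ : 𝓢(ℝ, ℂ)} (hφ : Function.Even φ) (N : ℕ) :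
    unitaryOneLevelDensity N φ = ∫ y in (-(N / 2 : ℝ))..(N / 2), φ y := by
  set f : ℝ → ℂ := fun x => φ (N * x) with hf
  have hfc : Continuous f := φ.continuous.comp (by fun_prop)
  -- Evenness makes the endpoint values agree, so the function descends to a continuous one on the
  -- circle.
  have hends : f (-(1 / 2)) = f (-(1 / 2) + 1) := by
    have := hφ (N * (1 / 2))
    simp only [hf]
    rw [show (-(1 / 2) + 1 : ℝ) = 1 / 2 by norm_num, mul_neg, this]
  let F : C(UnitAddCircle, ℂ) :=
    ⟨AddCircle.liftIoc 1 (-(1 / 2)) f, AddCircle.liftIoc_continuous hends hfc.continuousOn⟩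
  have h1 : unitaryOneLevelDensity N φ = ∫ U, eigenSum F U ∂(unitaryHaar N) := by
    unfold unitaryOneLevelDensity eigenSum
    refine integral_congr_ae (.of_forall fun U => ?_)
    simp only
    congr 1
    refine Multiset.map_congr rfl fun z _ => ?_
    have h2 : Complex.arg z / (2 * Real.pi) ∈ Set.Ioc (-(1 / 2) : ℝ) (-(1 / 2) + 1) := by
      have h3 := Complex.neg_pi_lt_arg z
      have h4 := Complex.arg_le_pi z
      have hπ := Real.pi_pos
      constructor
      · rw [lt_div_iff₀ (by positivity)]; linarith
      · rw [div_le_iff₀ (by positivity)]; linarith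
    change _ = AddCircle.liftIoc 1 (-(1 / 2)) f _
    rw [AddCircle.liftIoc_coe_apply h2, hf, mul_div_assoc]
  rw [h1, (integral_eigenSum F).2, AddCircle.integral_haarAddCircle]
  have h2 : ∫ x : UnitAddCircle, F x = ∫ x in (-(1 / 2) : ℝ)..(-(1 / 2) + 1), f x :=
    AddCircle.integral_liftIoc_eq_intervalIntegral (T := 1) (f := f)
  rw [h2]
  rcases eq_or_ne N 0 with rfl | hN
  · simp
  have hN' : (N : ℝ) ≠ 0 := Nat.cast_ne_zero.mpr hN
  simp only [hf]
  rw [intervalIntegral.integral_comp_mul_left (fun y => φ y) hN', inv_one, one_smul,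
    Complex.real_smul, ← mul_assoc]
  push_cast
  rw [mul_inv_cancel₀ (Nat.cast_ne_zero.mpr hN), one_mul]
  congr 1 <;> ring

theorem tendsto_unitaryOneLevelDensity {φ : 𝓢(ℝ, ℂ)} (hφ : Function.Even φ) :
    Tendsto (fun N : ℕ => unitaryOneLevelDensity N φ) atTop (𝓝 (∫ y : ℝ, φ y)) := by
  simp only [unitaryOneLevelDensity_eq hφ]
  have h1 : Tendsto (fun N : ℕ => (N / 2 : ℝ)) atTop atTop :=
    tendsto_natCast_atTop_atTop.atTop_div_const two_pos
  exact intervalIntegral_tendsto_integral φ.integrable (tendsto_neg_atTop_atBot.comp h1) h1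

end UnitaryGroup

end OneLevel

theorem mainTheorem2 (φ : 𝓢(ℝ, ℂ)) (hφ : Function.Even φ) (σ : ℝ) (hσ : σ < 2)
    (hsupp : ∀ ξ : ℝ, σ ≤ |ξ| → (𝓕 φ) ξ = 0) :
    -- the sum over zeros defining each 1-level density converges absolutely
    (∀ (m : Nat.Primes) (χ : DirichletCharacter ℂ (m : ℕ)), χ ≠ 1 →
      Summable fun ρ : OneLevel.nontrivialZeros χ => OneLevel.zeroTerm χ φ ρ) ∧
    -- the averaged explicit formula
    ((fun m : Nat.Primes =>
        OneLevel.familyAverage (m : ℕ) (fun χ => OneLevel.oneLevelDensity χ φ) -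
          ((∫ y : ℝ, φ y) - 2 * OneLevel.primeSum (m : ℕ) φ -
            2 * OneLevel.primeSquareSum (m : ℕ) φ))
      =O[OneLevel.primesAtTop] fun m : Nat.Primes => 1 / Real.log (m : ℕ)) ∧
    -- the prime sum
    ((fun m : Nat.Primes => -2 * OneLevel.primeSum (m : ℕ) φ)
      =O[OneLevel.primesAtTop] fun m : Nat.Primes => ((m : ℕ) : ℝ) ^ (σ / 2 - 1)) ∧
    -- the limit of the family average
    Tendsto (fun m : Nat.Primes =>
        OneLevel.familyAverage (m : ℕ) (fun χ => OneLevel.oneLevelDensity χ φ))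
      OneLevel.primesAtTop (𝓝 (∫ y : ℝ, φ y)) ∧
    -- the limit agrees with that of the 1-level density of Haar-random unitary matrices
    Tendsto (fun N : ℕ => OneLevel.unitaryOneLevelDensity N φ) atTop (𝓝 (∫ y : ℝ, φ y)) := by
  have h : ∀ ξ : ℝ, σ < |ξ| → (𝓕 φ) ξ = 0 := fun ξ hξ => hsupp ξ hξ.le
  refine ⟨fun m χ hχ => OneLevel.summable_zeroTerm h hχ (OneLevel.isPrimitive_of_prime m.2 hχ) ?_,
    OneLevel.averaged_explicitFormula hφ h, OneLevel.primeSum_isBigO hσ hsupp,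
    OneLevel.tendsto_familyAverage_oneLevelDensity hφ hσ hsupp,
    OneLevel.tendsto_unitaryOneLevelDensity hφ⟩
  -- The zero sum needs only `log (m/π) ≠ 0`, which holds for every `m` because `3 < π < 4`; the
  -- sign of the scale is irrelevant.
  have hπ := Real.pi_gt_three
  have hm : (0 : ℝ) < (m : ℕ) := by exact_mod_cast m.2.pos
  have hne : ((m : ℕ) : ℝ) / Real.pi ≠ 1 := fun h1 => by
    rw [div_eq_one_iff_eq Real.pi_ne_zero] at h1
    have h3 : 3 < (m : ℕ) := by
      have : (3 : ℝ) < (m : ℕ) := by rw [h1]; exact hπ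
      exact_mod_cast this
    have h4 : (m : ℕ) < 4 := by
      have : ((m : ℕ) : ℝ) < 4 := by rw [h1]; exact Real.pi_lt_four
      exact_mod_cast this
    omega
  exact Real.log_ne_zero_of_pos_of_ne_one (by positivity) hne
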